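/- Let $\mu\in\mathbb R$ and let $F_\mu$ be the vector field on $\mathbb R^3$ of the autonomous system (obtained in spatially curved scalar-field cosmology with potential $V=V_0\phi^{-\mu}$) $$x'=-2x+\tfrac{\mu}{2}y^2z-xy^2+2x^3,\qquad y'=y-\tfrac{\mu}{2}xyz+2x^2y-y^3,\qquad z'=-xz^2 .$$ **Critical points.** For $\mu\neq0$ the zeros of $F_\mu$ are exactly $C_1=(0,1,0)$, $C_2=(0,-1,0)$, $C_3=(1,0,0)$, $C_4=(-1,0,0)$ and the points $(0,0,z_c)$, $z_c\in\mathbb R$, of the line $C_5$. All of these points are zeros for every $\mu$. $C_3,C_4$ are isolated zeros for every $\mu$, and $C_1,C_2$ are isolated zeros for $\mu\ne0$. The Jacobian of $F_\mu$ has eigenvalues $-3,-2,0$ at $C_1,C_2$; $4,3,0$ at $C_3,C_4$; and $-2,1,0$ at each point of $C_5$. **Nature of the critical points.** 1. If $\mu>0$, $C_1$ and $C_2$ are stable nodes: they are asymptotically stable, and every nearby orbit other than the equilibrium approaches the equilibrium along a definite tangent direction. 2. If $\mu<0$, $C_1$ and $C_2$ are (topological, non-hyperbolic) saddles: in arbitrarily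 small open neighbourhoods $U$ of the point $p$, the points whose forward orbits stay in $U$ form a two-dimensional $C^1$ manifold through $p$ tangent to $\mathrm{span}\{(1,0,0),(0,1,0)\}$, all of whose orbits converge to $p$ as $N\to+\infty$; and the points whose backward orbits stay in $U$ form a $C^1$ curve through $p$ tangent to the zero eigenvector $(\mu/6,0,1)$, all of whose orbits converge to $p$ as $N\to-\infty$. 3. For every $\mu$, $C_3$ and $C_4$ are saddle-nodes. Let $p=(\varepsilon,0,0)$ with $\varepsilon=1$ for $C_3$ and $\varepsilon=-1$ for $C_4$, let $c=(0,0,\varepsilon)$ and $H=\mathrm{span}\{(1,0,0),(0,1,0)\}$. In arbitrarily small open neighbourhoods $U$ of $p$ there are a $C^1$ curve $s\mapsto p+sc+g(s)$, with $g(s)\in H$, tangent to $c$ at $p$, and a $C^1$ surface $\{p+h+k(h)c: h\in H\}$ tangent to $H$ at $p$, such that: the points of $U$ whose forward orbits stay in $U$ are exactly those on the half $s\ge0$ of the curve, and they converge to $p$ as $N\to+\infty$; the points of $U$ whose backward orbits stay in $U$ are exactly the points $p+h+sc$ of $U$ with $s\le k(h)$, and they converge to $p$ as $N\to-\infty$;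 and backward orbits starting on the half $s\le0$ of the curve in $U$ remain on that half. Moreover, for the system restricted to the invariant plane $z=0$, the points $(\pm1,0)$ are unstable nodes (stable nodes, in the sense of 1, of the time-reversed system). 4. For every $\mu$, the line $C_5$ is a normally hyperbolic saddle. At each point $q$ of the line, the Jacobian vanishes in the direction of the line, and the direction of the line together with one eigenvector with negative eigenvalue and one with positive eigenvalue spans $\mathbb R^3$. Further, in arbitrarily small open neighbourhoods $U$ of $q$, the points whose forward (respectively backward) orbits stay in $U$ and converge to $q$ as $N\to+\infty$ (respectively $N\to-\infty$) form a $C^1$ curve through $q$ tangent to the eigenvector with negative (respectively positive) eigenvalue, and every orbit that stays in $U$ for all forward (respectively backward) time converges in that time direction to a point of the line. -/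

import Mathlib

open Set Filter Topology Polynomial

/-- Points `(x, y, z)` of three-dimensional Euclidean phase space. -/
abbrev Phase3 : Type := EuclideanSpace ℝ (Fin 3)

/-- The right-hand side of the autonomous system
`x' = -2x + (μ/2) y² z - x y² + 2x³`, `y' = y - (μ/2) x y z + 2x² y - y³`, `z' = -x z²`. -/
noncomputable def powerLawField (μ : ℝ) (q : Phase3) : Phase3 :=
  !₂[-2 * q 0 + μ / 2 * q 1 ^ 2 * q 2 - q 0 * q 1 ^ 2 + 2 * q 0 ^ 3,
     q 1 - μ / 2 * q 0 * q 1 * q 2 + 2 * q 0 ^ 2 * q 1 - q 1 ^ 3,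
     -q 0 * q 2 ^ 2]

/-- The system restricted to the invariant plane `z = 0`, in the coordinates `(x, y)`. -/
noncomputable def xyPlaneField (μ : ℝ) (q : EuclideanSpace ℝ (Fin 2)) : EuclideanSpace ℝ (Fin 2) :=
  !₂[powerLawField μ !₂[q 0, q 1, 0] 0, powerLawField μ !₂[q 0, q 1, 0] 1]

section LocalDynamics

variable {E : Type*} [NormedAddCommGroup E] [NormedSpace ℝ E]

/-- `γ` restricted to `[0, ∞)` solves `γ' = F γ` with `γ 0 = q`. Backward solutions of `F` are the
forward solutions of `-F`. -/
def IsForwardSolution (F : E → E) (q : E) (γ : ℝ → E) : Prop :=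
  γ 0 = q ∧ IsIntegralCurveOn γ (fun _ => F) (Ici 0)

/-- The points whose forward orbit exists for all time and never leaves `U`. -/
def stayingSet (F : E → E) (U : Set E) : Set E :=
  {q | ∃ γ : ℝ → E, IsForwardSolution F q γ ∧ ∀ t, 0 ≤ t → γ t ∈ U}

/-- The local stable set of `p` in `U`: the points whose forward orbit never leaves `U` and
converges to `p`. The local unstable set is the local stable set of `-F`. -/
def localStableSet (F : E → E) (U : Set E) (p : E) : Set E :=
  {q | ∃ γ : ℝ → E, IsForwardSolution F q γ ∧ (∀ t, 0 ≤ t → γ t ∈ U) ∧ Tendsto γ atTop (𝓝 p)}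

/-- Stable node: an asymptotically stable equilibrium which every nearby orbit other than the
equilibrium approaches along a definite tangent direction `e`. (All fields considered here are
smooth, so solutions are unique.) -/
def IsStableNode (F : E → E) (p : E) : Prop :=
  F p = 0 ∧
  (∀ ε > 0, ∃ δ > 0, Metric.ball p δ ⊆ stayingSet F (Metric.ball p ε)) ∧
  ∃ δ > 0, ∀ q ∈ Metric.ball p δ, q ≠ p → ∃ γ : ℝ → E, IsForwardSolution F q γ ∧
    Tendsto γ atTop (𝓝 p) ∧ (∀ t, 0 ≤ t → γ t ≠ p) ∧
    ∃ e : E, ‖e‖ = 1 ∧ Tendsto (fun t => ‖γ t - p‖⁻¹ • (γ t - p)) atTop (𝓝 e)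

/-- Unstable node: a stable node for the time-reversed field. -/
def IsUnstableNode (F : E → E) (p : E) : Prop := IsStableNode (-F) p

/-- `A` is a `C¹` submanifold through `p` with tangent space `S` at `p`, written as the graph over
a neighbourhood `D` of `0` in `S` of a `C¹` map `h` into a complement `N` of `S`. -/
def IsC1GraphAt (A : Set E) (p : E) (S : Submodule ℝ E) : Prop :=
  ∃ (N : Submodule ℝ E) (D : Set S) (h : S → N), IsCompl S N ∧ IsOpen D ∧ (0 : S) ∈ D ∧
    ContDiffOn ℝ 1 h D ∧ h 0 = 0 ∧ fderiv ℝ h 0 = 0 ∧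
    A = {q | ∃ s ∈ D, q = p + (s : E) + (h s : E)}

/-- Saddle-type phase portrait at the point `p` of a set `L` of equilibria: in arbitrarily small
open neighbourhoods `U` of `p`, the local stable set of `p` is a `C¹` submanifold tangent to `S`,
the local unstable set of `p` is a `C¹` submanifold tangent to `T`, and every orbit that stays in
`U` for all forward (backward) time converges in forward (backward) time to a point of `L`. -/
def HasSaddlePortraitAt (F : E → E) (L : Set E) (p : E) (S T : Submodule ℝ E) : Prop :=
  ∀ V ∈ 𝓝 p, ∃ U ⊆ V, IsOpen U ∧ p ∈ U ∧
    IsC1GraphAt (localStableSet F U p) p S ∧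
    IsC1GraphAt (localStableSet (-F) U p) p T ∧
    (∀ q ∈ stayingSet F U, ∃ l ∈ L, q ∈ localStableSet F U l) ∧
    (∀ q ∈ stayingSet (-F) U, ∃ l ∈ L, q ∈ localStableSet (-F) U l)

/-- (Topological) saddle: the phase space splits into nonzero subspaces `S`, `T`, invariant under
the linearization; a local stable manifold tangent to `S` and a local unstable manifold tangent to
`T` pass through `p`; all orbits off the stable (unstable) manifold leave a neighbourhood of `p` in
forward (backward) time. One of the subspaces may contain directions with eigenvalue `0`. -/
def IsSaddle (F : E → E) (p : E) (S T : Submodule ℝ E) : Prop :=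
  F p = 0 ∧ S ≠ ⊥ ∧ T ≠ ⊥ ∧ IsCompl S T ∧
  (∀ v ∈ S, fderiv ℝ F p v ∈ S) ∧ (∀ v ∈ T, fderiv ℝ F p v ∈ T) ∧
  HasSaddlePortraitAt F {p} p S T

/-- Saddle-node with repelling hyperbolic part. The phase space splits into a subspace `H`,
invariant under the linearization, and the line spanned by a null vector `c` of the linearization.
In arbitrarily small open neighbourhoods `U` of `p` there are a `C¹` centre curve
`s ↦ p + s • c + g s` tangent to `c` and a `C¹` hypersurface `p + h + k h • c`, `h ∈ H`, tangent to
`H`, such that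
* the half `s ≥ 0` of the centre curve converges to `p` in forward time, and all other points of
  `U` leave `U` in forward time;
* all points of `U` on the side `s ≤ k h` of the hypersurface converge to `p` in backward time
  (nodal sector), and all points on the other side leave `U` in backward time (saddle sector);
* the half `s ≤ 0` of the centre curve is backward invariant, so that along the centre curve orbits
  approach `p` on one side and move away from `p` on the other. -/
def IsRepellingSaddleNode (F : E → E) (p : E) (H : Submodule ℝ E) (c : E) : Prop :=
  F p = 0 ∧ H ≠ ⊥ ∧ c ≠ 0 ∧ IsCompl H (Submodule.span ℝ {c}) ∧
  (∀ v ∈ H, fderiv ℝ F p v ∈ H) ∧ fderiv ℝ F p c = 0 ∧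
  ∀ V ∈ 𝓝 p, ∃ U ⊆ V, IsOpen U ∧ p ∈ U ∧
    ∃ (g : ℝ → H) (k : H → ℝ),
      ContDiff ℝ 1 g ∧ g 0 = 0 ∧ deriv g 0 = 0 ∧
      ContDiff ℝ 1 k ∧ k 0 = 0 ∧ fderiv ℝ k 0 = 0 ∧
      stayingSet F U = localStableSet F U p ∧
      stayingSet F U = {q ∈ U | ∃ s : ℝ, 0 ≤ s ∧ q = p + s • c + (g s : E)} ∧
      stayingSet (-F) U = localStableSet (-F) U p ∧
      stayingSet (-F) U = {q ∈ U | ∃ (h : H) (s : ℝ), s ≤ k h ∧ q = p + (h : E) + s • c} ∧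
      {q ∈ U | ∃ s : ℝ, s ≤ 0 ∧ q = p + s • c + (g s : E)} ⊆
        stayingSet (-F) {q ∈ U | ∃ s : ℝ, s ≤ 0 ∧ q = p + s • c + (g s : E)}

/-- The line `p + ℝ k` consists of equilibria and is normally hyperbolic of saddle type: at each of
its points `q` the linearization vanishes along the line, and is transversally spanned by one
eigenvector `s` with negative and one eigenvector `t` with positive eigenvalue; stable and unstable
manifolds tangent to `s` and `t` pass through `q`, and every orbit that stays near `q` in forward
(backward) time converges to a point of the line. -/
def IsNormallyHyperbolicSaddleLine (F : E → E) (p k : E) : Prop :=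
  k ≠ 0 ∧ ∀ q ∈ range (fun r : ℝ => p + r • k),
    F q = 0 ∧ fderiv ℝ F q k = 0 ∧
    ∃ (α β : ℝ) (s t : E), α < 0 ∧ 0 < β ∧ s ≠ 0 ∧ t ≠ 0 ∧
      fderiv ℝ F q s = α • s ∧ fderiv ℝ F q t = β • t ∧
      Submodule.span ℝ {s, t, k} = ⊤ ∧
      HasSaddlePortraitAt F (range (fun r : ℝ => p + r • k)) q
        (Submodule.span ℝ {s}) (Submodule.span ℝ {t})

end LocalDynamics

/-- The characteristic polynomial of the Jacobian of `F` at `p`. -/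
noncomputable def jacobianCharpoly (F : Phase3 → Phase3) (p : Phase3) : ℝ[X] :=
  (fderiv ℝ F p : Phase3 →ₗ[ℝ] Phase3).charpoly

/-! ### Scalar differential inequalities on a half-line -/

section ScalarDynamics

variable {f f' : ℝ → ℝ} {a : ℝ}

/-! Three functions satisfy homogeneous linear equations along every orbit: y, z and u = 1 - x² -
y², the last with u' = (4x² - 2y²) u because the μ-terms cancel. So y = 0, z = 0 and u = 0 are
invariant, and near each equilibrium the coefficients for y and u have a definite sign. A bounded
solution of an expanding linear equation vanishes, and a contracting one decays exponentially. Most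
of the portrait follows from this together with the behaviour of the slow variable z.

At (ε,0,0) both y and u expand. An orbit that stays near in forward time therefore has y = u = 0,
hence x = ε, where z' = -εz² is explicit. Backward in time the squared distance is a Lyapunov
function in the half-space εz ≤ 0. The centre curve and the hypersurface are thus a straight line
and a plane (`isRepellingSaddleNode_powerLawField`).

At (0,ε,0) put w = x - μz/6, which vanishes on the zero eigenvector. The function w² + u² + z² has
derivative at most -(w² + u²) + (|μ| - 2μ)/6 z⁴ (`IsLyapunovRadius.deriv_le`). For μ > 0 it is
strictly decreasing, and quotients of solutions of linear equations give the tangent directions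
(`exists_direction_y_node`). For μ < 0 it still decreases on z = 0, which is the stable manifold.
Off that plane x/z becomes negative and bounded away from zero, and z² then grows until the orbit
leaves (`forward_staying_y_saddle`).

The unstable curve of this saddle and the stable and unstable curves at the points of the line are
not explicit. They come from one cone argument, `IsConeSplitting.exists_nhds_isC1GraphAt`. If the
eigenvalue of ℓ₀ lies below ν/2 and the two others lie above it, the form Q = ℓ₁² + ℓ₂² - κ²ℓ₀² of a
difference of orbits satisfies Q' ≥ νQ. Two orbits that converge to p faster than exp(νt/2) hence
differ by a vector of the cone Q ≤ 0, and so they are told apart by ℓ₀. Existence over each value of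
ℓ₀ follows from the intermediate value theorem and compactness. Arbitrarily narrow cones near p give
C¹ smoothness at p; elsewhere the curve is locally a piece of an orbit transversal to ker ℓ₀.

On the line of equilibria ν = -1, and the required fast convergence is itself proved from the decay
of x and y (`forward_staying_line`, `backward_staying_line`). -/

lemma monotoneOn_Ici_of_hasDerivWithinAt (h : ∀ t ∈ Ici a, HasDerivWithinAt f (f' t) (Ici a) t)
    (h0 : ∀ t ∈ Ici a, 0 ≤ f' t) : MonotoneOn f (Ici a) := by
  refine monotoneOn_of_deriv_nonneg (convex_Ici a) (fun t ht => (h t ht).continuousWithinAt)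
    (fun t ht => ?_) (fun t ht => ?_)
  · exact ((h t (interior_subset ht)).mono interior_subset).differentiableWithinAt
  · rw [((h t (interior_subset ht)).hasDerivAt (mem_interior_iff_mem_nhds.1 ht)).deriv]
    exact h0 t (interior_subset ht)

lemma antitoneOn_Ici_of_hasDerivWithinAt (h : ∀ t ∈ Ici a, HasDerivWithinAt f (f' t) (Ici a) t)
    (h0 : ∀ t ∈ Ici a, f' t ≤ 0) : AntitoneOn f (Ici a) := by
  have := monotoneOn_Ici_of_hasDerivWithinAt (f := fun t => -f t) (f' := fun t => -f' t)
    (fun t ht => (h t ht).neg) (fun t ht => by linarith [h0 t ht])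
  intro s hs t ht hst
  linarith [this hs ht hst]

lemma le_mul_exp_of_hasDerivWithinAt {c : ℝ}
    (h : ∀ t ∈ Ici a, HasDerivWithinAt f (f' t) (Ici a) t)
    (h0 : ∀ t ∈ Ici a, f' t ≤ c * f t) {t : ℝ} (ht : a ≤ t) :
    f t ≤ f a * Real.exp (c * (t - a)) := by
  have h1 : ∀ t ∈ Ici a, HasDerivWithinAt (fun t => f t * Real.exp (-(c * (t - a))))
      ((f' t - c * f t) * Real.exp (-(c * (t - a)))) (Ici a) t := by
    intro t ht
    have h2 : HasDerivAt (fun t => Real.exp (-(c * (t - a)))) (Real.exp (-(c * (t - a))) * -c) t := by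
      have := ((((hasDerivAt_id t).sub_const a).const_mul c).neg).exp
      simpa using this
    refine ((h t ht).mul h2.hasDerivWithinAt).congr_deriv ?_
    ring
  have h3 := antitoneOn_Ici_of_hasDerivWithinAt h1 (fun t ht =>
    mul_nonpos_of_nonpos_of_nonneg (by linarith [h0 t ht]) (Real.exp_pos _).le) self_mem_Ici ht ht
  simp only [sub_self, mul_zero, neg_zero, Real.exp_zero, mul_one] at h3
  calc f t = (f t * Real.exp (-(c * (t - a)))) * Real.exp (c * (t - a)) := by
        rw [mul_assoc, ← Real.exp_add]; simp
    _ ≤ _ := by gcongr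

lemma mul_exp_le_of_hasDerivWithinAt {c : ℝ}
    (h : ∀ t ∈ Ici a, HasDerivWithinAt f (f' t) (Ici a) t)
    (h0 : ∀ t ∈ Ici a, c * f t ≤ f' t) {t : ℝ} (ht : a ≤ t) :
    f a * Real.exp (c * (t - a)) ≤ f t := by
  have := le_mul_exp_of_hasDerivWithinAt (f := fun t => -f t) (f' := fun t => -f' t) (c := c)
    (fun t ht => (h t ht).neg) (fun t ht => by linarith [h0 t ht]) ht
  linarith

/-- Squaring avoids differentiating the absolute value: (f²)' = 2b f², so the one-sided Gronwall
bound applies to f² with constant 2c. -/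
lemma abs_le_mul_exp_of_linear {b : ℝ → ℝ} {c : ℝ}
    (h : ∀ t ∈ Ici a, HasDerivWithinAt f (b t * f t) (Ici a) t)
    (h0 : ∀ t ∈ Ici a, b t ≤ c) {t : ℝ} (ht : a ≤ t) :
    |f t| ≤ |f a| * Real.exp (c * (t - a)) := by
  have := le_mul_exp_of_hasDerivWithinAt (f := fun t => f t ^ 2)
    (f' := fun t => 2 * f t * (b t * f t)) (c := 2 * c)
    (fun t ht => ((h t ht).pow 2).congr_deriv (by ring))
    (fun t ht => by nlinarith [h0 t ht, sq_nonneg (f t)]) ht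
  refine abs_le_of_sq_le_sq' ?_ (by positivity) |> abs_le.2
  refine this.trans_eq ?_
  rw [mul_pow, sq_abs, ← Real.exp_nat_mul]
  push_cast; ring_nf

lemma mul_exp_le_abs_of_linear {b : ℝ → ℝ} {c : ℝ}
    (h : ∀ t ∈ Ici a, HasDerivWithinAt f (b t * f t) (Ici a) t)
    (h0 : ∀ t ∈ Ici a, c ≤ b t) {t : ℝ} (ht : a ≤ t) :
    |f a| * Real.exp (c * (t - a)) ≤ |f t| := by
  have := mul_exp_le_of_hasDerivWithinAt (f := fun t => f t ^ 2)
    (f' := fun t => 2 * f t * (b t * f t)) (c := 2 * c)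
    (fun t ht => ((h t ht).pow 2).congr_deriv (by ring))
    (fun t ht => by nlinarith [h0 t ht, sq_nonneg (f t)]) ht
  refine abs_le_of_sq_le_sq (a := |f a| * Real.exp (c * (t - a))) (b := |f t|) ?_ (abs_nonneg _) |>
    (le_abs_self _).trans
  refine le_trans (le_of_eq ?_) (this.trans_eq (sq_abs _).symm)
  rw [mul_pow, sq_abs, ← Real.exp_nat_mul]
  push_cast; ring_nf

lemma tendsto_exp_mul_atTop_zero {c : ℝ} (hc : c < 0) (a K : ℝ) :
    Tendsto (fun t => K * Real.exp (c * (t - a))) atTop (𝓝 0) := by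
  have h : Tendsto (fun t : ℝ => c * (t - a)) atTop atBot :=
    (tendsto_atTop_add_const_right _ (-a) tendsto_id).const_mul_atTop_of_neg hc
  simpa using (Real.tendsto_exp_atBot.comp h).const_mul K

lemma tendsto_mul_exp_atTop {c K : ℝ} (hc : 0 < c) (hK : 0 < K) (a : ℝ) :
    Tendsto (fun t => K * Real.exp (c * (t - a))) atTop atTop := by
  have h : Tendsto (fun t : ℝ => c * (t - a)) atTop atTop :=
    (tendsto_atTop_add_const_right _ (-a) tendsto_id).const_mul_atTop hc
  exact (Real.tendsto_exp_atTop.comp h).const_mul_atTop hK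

lemma tendsto_zero_of_linear {b : ℝ → ℝ} {c : ℝ} (hc : c < 0)
    (h : ∀ t ∈ Ici a, HasDerivWithinAt f (b t * f t) (Ici a) t)
    (h0 : ∀ t ∈ Ici a, b t ≤ c) : Tendsto f atTop (𝓝 0) := by
  refine squeeze_zero_norm' ?_ (tendsto_exp_mul_atTop_zero hc a |f a|)
  filter_upwards [eventually_ge_atTop a] with t ht
  exact abs_le_mul_exp_of_linear h h0 ht

/-- A bounded solution of a linear equation with coefficient bounded below by a positive
constant vanishes. -/
lemma eq_zero_of_linear_of_bounded {b : ℝ → ℝ} {c M : ℝ} (hc : 0 < c)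
    (h : ∀ t ∈ Ici a, HasDerivWithinAt f (b t * f t) (Ici a) t)
    (h0 : ∀ t ∈ Ici a, c ≤ b t) (hM : ∀ t ∈ Ici a, |f t| ≤ M) : f a = 0 := by
  by_contra hne
  obtain ⟨t, ht, ht'⟩ := (((tendsto_mul_exp_atTop hc (abs_pos.2 hne) a).eventually_gt_atTop M).and
    (eventually_ge_atTop a)).exists
  linarith [mul_exp_le_abs_of_linear h h0 ht', hM t ht']

/-- A nonnegative function which decreases at a definite rate as long as it is not small tends to
zero. -/
lemma tendsto_zero_of_strict_decay (hf : ∀ t ∈ Ici a, HasDerivWithinAt f (f' t) (Ici a) t)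
    (hpos : ∀ t ∈ Ici a, 0 ≤ f t) (hneg : ∀ t ∈ Ici a, f' t ≤ 0)
    (hdec : ∀ c > 0, ∃ m > 0, ∀ t ∈ Ici a, c ≤ f t → f' t ≤ -m) : Tendsto f atTop (𝓝 0) := by
  have hanti := antitoneOn_Ici_of_hasDerivWithinAt hf hneg
  rw [Metric.tendsto_atTop]
  intro c hc
  obtain ⟨m, hm, hdm⟩ := hdec c hc
  obtain ⟨T, hT, hTc⟩ : ∃ T ≥ a, f T < c := by
    by_contra! hcon
    have h1 := antitoneOn_Ici_of_hasDerivWithinAt (f := fun t => f t + m * t)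
      (f' := fun t => f' t + m) (a := a)
      (fun t ht => ((hf t ht).add ((hasDerivWithinAt_id t _).const_mul m)).congr_deriv (by simp))
      (fun t ht => by linarith [hdm t ht (hcon t ht)])
    have h0 := hpos a self_mem_Ici
    have h2 : a ≤ a + (f a + 1) / m := le_add_of_nonneg_right (by positivity)
    have h3 := h1 self_mem_Ici (show a + (f a + 1) / m ∈ Ici a from h2) h2
    have h4 := hpos (a + (f a + 1) / m) h2
    simp only [mul_add, mul_div_cancel₀ _ hm.ne'] at h3
    linarith
  refine ⟨T, fun t ht => ?_⟩
  have h1 := hanti hT (show t ∈ Ici a from le_trans hT ht) ht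
  rw [Real.dist_eq, sub_zero, abs_of_nonneg (hpos t (le_trans hT ht))]
  linarith

/-- An integrable exponential bound on the derivative gives convergence at an exponential rate. -/
lemma exists_tendsto_of_deriv_le_exp {C c : ℝ} (hc : 0 < c)
    (h : ∀ t ∈ Ici (0 : ℝ), HasDerivWithinAt f (f' t) (Ici 0) t)
    (hb : ∀ t ∈ Ici (0 : ℝ), |f' t| ≤ C * Real.exp (-c * t)) :
    ∃ l, Tendsto f atTop (𝓝 l) ∧ ∀ t ∈ Ici (0 : ℝ), |f t - l| ≤ C / c * Real.exp (-c * t) := by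
  have hE : ∀ t : ℝ, HasDerivAt (fun t => C / c * Real.exp (-c * t)) (-(C * Real.exp (-c * t))) t := by
    intro t
    have := (((hasDerivAt_id t).const_mul (-c)).exp).const_mul (C / c)
    refine this.congr_deriv ?_
    simp only [id, mul_one]
    field_simp
  -- (C / c) exp(-c t) is the integral of the bound from t to infinity. Subtracting it makes f
  -- monotone and adding it makes f antitone, so the limit lies between the two.
  have h1 : MonotoneOn (fun t => f t - C / c * Real.exp (-c * t)) (Ici 0) :=
    monotoneOn_Ici_of_hasDerivWithinAt (fun t ht => (h t ht).sub (hE t).hasDerivWithinAt)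
      (fun t ht => by linarith [neg_le_of_abs_le (hb t ht)])
  have h2 : AntitoneOn (fun t => f t + C / c * Real.exp (-c * t)) (Ici 0) :=
    antitoneOn_Ici_of_hasDerivWithinAt (fun t ht => (h t ht).add (hE t).hasDerivWithinAt)
      (fun t ht => by linarith [le_of_abs_le (hb t ht)])
  have hC : 0 ≤ C := by simpa using (abs_nonneg _).trans (hb 0 self_mem_Ici)
  have hE0 : Tendsto (fun t => C / c * Real.exp (-c * t)) atTop (𝓝 0) := by
    simpa using tendsto_exp_mul_atTop_zero (neg_lt_zero.2 hc) 0 (C / c)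
  have hEp : ∀ t : ℝ, 0 ≤ C / c * Real.exp (-c * t) := fun t => by positivity
  have hub : ∀ s ∈ Ici (0 : ℝ), ∀ t ∈ Ici (0 : ℝ),
      f t - C / c * Real.exp (-c * t) ≤ f s + C / c * Real.exp (-c * s) := by
    intro s hs t ht
    rcases le_total s t with hst | hst
    · have := h2 hs ht hst
      simp only at this
      linarith [hEp t]
    · have := h1 ht hs hst
      simp only at this
      linarith [hEp s]
  -- Freezing the function for t < 0 makes it monotone on all of ℝ, as the supremum criterion
  -- requires.
  set g : ℝ → ℝ := fun t => f (max t 0) - C / c * Real.exp (-c * max t 0) with hg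
  have hgm : Monotone g := fun s t hst =>
    h1 (mem_Ici.2 (le_max_right s 0)) (mem_Ici.2 (le_max_right t 0)) (max_le_max_right 0 hst)
  have hgb : BddAbove (range g) := by
    refine ⟨f 0 + C / c * Real.exp (-c * 0), ?_⟩
    rintro _ ⟨t, rfl⟩
    exact hub 0 self_mem_Ici _ (mem_Ici.2 (le_max_right t 0))
  have hgl := tendsto_atTop_ciSup hgm hgb
  refine ⟨⨆ t, g t, ?_, fun t ht => ?_⟩
  · have := hgl.add hE0
    rw [add_zero] at this
    refine this.congr' ?_
    filter_upwards [eventually_ge_atTop 0] with t ht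
    simp [hg, max_eq_left ht]
  · rw [abs_le]
    constructor
    · have : ⨆ t, g t ≤ f t + C / c * Real.exp (-c * t) :=
        ciSup_le fun s => hub t ht _ (mem_Ici.2 (le_max_right s 0))
      linarith
    · have := le_ciSup hgb t
      simp only [hg, max_eq_left (show (0 : ℝ) ≤ t from ht)] at this
      linarith

/-- Solutions of `f' = -b f + d` with `b → β > 0` and `d → δ` tend to `δ / β`. -/
lemma tendsto_div_of_linear {b d : ℝ → ℝ} {β δ : ℝ} (hβ : 0 < β)
    (h : ∀ t ∈ Ici a, HasDerivWithinAt f (-b t * f t + d t) (Ici a) t)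
    (hb : Tendsto b atTop (𝓝 β)) (hd : Tendsto d atTop (𝓝 δ)) :
    Tendsto f atTop (𝓝 (δ / β)) := by
  rw [tendsto_iff_norm_sub_tendsto_zero, Metric.tendsto_atTop]
  intro ε hε
  have hr : Tendsto (fun t => d t - b t * (δ / β)) atTop (𝓝 0) := by
    have := hd.sub (hb.mul_const (δ / β))
    rwa [mul_div_cancel₀ _ hβ.ne', sub_self] at this
  have hη : 0 < β * ε / 4 := by positivity
  obtain ⟨T, hT⟩ := eventually_atTop.1 ((hb.eventually (lt_mem_nhds (half_lt_self hβ))).and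
    ((Metric.tendsto_nhds.1 hr _ hη).and (eventually_ge_atTop a)))
  have hTa := (hT T le_rfl).2.2
  have hsub : Ici T ⊆ Ici a := Ici_subset_Ici.2 hTa
  -- The error e = f - δ/β solves e' = -b e + r with r → 0. Once b > β/2 and |r| < βε/4, completing
  -- the square shows that e² - ε²/4 satisfies a Gronwall inequality with rate -β/2.
  have hw : ∀ t ∈ Ici T, HasDerivWithinAt (fun t => (f t - δ / β) ^ 2 - ε ^ 2 / 4)
      (2 * (f t - δ / β) * (-b t * f t + d t)) (Ici T) t := fun t ht =>
    (((((h t (hsub ht)).mono hsub).sub_const _).pow 2).sub_const _).congr_deriv (by simp)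
  have hle : ∀ t ∈ Ici T, 2 * (f t - δ / β) * (-b t * f t + d t) ≤
      (-β / 2) * ((f t - δ / β) ^ 2 - ε ^ 2 / 4) := by
    intro t ht
    obtain ⟨hbt, hrt, -⟩ := hT t ht
    rw [Real.dist_eq, sub_zero] at hrt
    set e := f t - δ / β with he
    set r := d t - b t * (δ / β) with hr'
    have : -b t * f t + d t = -b t * e + r := by rw [he, hr']; ring
    rw [this]
    have h1 : 2 * e * r ≤ 2 * |e| * (β * ε / 4) := by
      calc 2 * e * r ≤ |2 * e * r| := le_abs_self _
        _ = 2 * |e| * |r| := by rw [abs_mul, abs_mul]; simp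
        _ ≤ _ := by gcongr
    have h2 : e ^ 2 = |e| ^ 2 := (sq_abs e).symm
    have h3 : β * e ^ 2 ≤ 2 * b t * e ^ 2 := by nlinarith [sq_nonneg e]
    have h4 : 0 ≤ β * (|e| - ε / 2) ^ 2 := by positivity
    nlinarith
  have hlim := tendsto_exp_mul_atTop_zero (show -β / 2 < 0 by linarith) T
    ((f T - δ / β) ^ 2 - ε ^ 2 / 4)
  obtain ⟨T', hT'⟩ := eventually_atTop.1
    ((hlim.eventually (gt_mem_nhds (show 0 < ε ^ 2 / 4 by positivity))).and (eventually_ge_atTop T))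
  refine ⟨T', fun t ht => ?_⟩
  obtain ⟨h1, h2⟩ := hT' t ht
  have h3 := le_mul_exp_of_hasDerivWithinAt hw hle h2
  rw [Real.dist_eq, sub_zero, Real.norm_eq_abs, abs_abs]
  refine abs_lt_of_sq_lt_sq ?_ hε.le
  nlinarith [sq_nonneg ε, sq_pos_of_pos hε]

/-- A solution of a linear equation with continuous coefficient keeps its sign. -/
lemma eq_mul_exp_of_linear {b : ℝ → ℝ} (hb : Continuous b)
    (h : ∀ t, HasDerivAt f (b t * f t) t) (t : ℝ) :
    f t = f 0 * Real.exp (∫ s in (0 : ℝ)..t, b s) := by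
  have hI : ∀ t, HasDerivAt (fun t => ∫ s in (0 : ℝ)..t, b s) (b t) t := fun t =>
    intervalIntegral.integral_hasDerivAt_right (hb.intervalIntegrable _ _)
      (hb.stronglyMeasurableAtFilter _ _) hb.continuousAt
  have h1 : ∀ t, HasDerivAt (fun t => f t * Real.exp (-∫ s in (0 : ℝ)..t, b s)) 0 t := fun t =>
    ((h t).mul (hI t).neg.exp).congr_deriv (by ring)
  have h2 := is_const_of_deriv_eq_zero (fun t => (h1 t).differentiableAt) (fun t => (h1 t).deriv) t 0
  simp only [intervalIntegral.integral_same, neg_zero, Real.exp_zero, mul_one] at h2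
  rw [← h2, mul_assoc, ← Real.exp_add]
  simp

lemma pos_of_continuousOn_of_ne_zero (hf : ContinuousOn f (Ici a)) (h0 : 0 < f a)
    (hne : ∀ t ∈ Ici a, f t ≠ 0) {t : ℝ} (ht : a ≤ t) : 0 < f t := by
  by_contra hcon
  obtain ⟨s, hs, hs0⟩ := (isPreconnected_Ici.intermediate_value (show t ∈ Ici a from ht) self_mem_Ici hf)
    ⟨not_lt.1 hcon, h0.le⟩
  exact hne s hs hs0

end ScalarDynamics

/-! ### Global flows of Lipschitz fields -/

section Flow

variable {E : Type*} [NormedAddCommGroup E] [NormedSpace ℝ E]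

lemma IsIntegralCurveOn.glue {v : ℝ → E → E} {γ₁ γ₂ : ℝ → E} {a b c : ℝ}
    (h₁ : IsIntegralCurveOn γ₁ v (Icc a b)) (h₂ : IsIntegralCurveOn γ₂ v (Icc b c))
    (hab : a ≤ b) (hbc : b ≤ c) (h : γ₁ b = γ₂ b) :
    IsIntegralCurveOn (fun t => if t ≤ b then γ₁ t else γ₂ t) v (Icc a c) := by
  set γ : ℝ → E := fun t => if t ≤ b then γ₁ t else γ₂ t with hγ
  have e₁ : EqOn γ γ₁ (Icc a b) := fun t ht => if_pos ht.2
  have e₂ : EqOn γ γ₂ (Icc b c) := by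
    intro t ht
    rcases ht.1.eq_or_lt with rfl | h'
    · simp [hγ, h]
    · exact if_neg (not_le.2 h')
  -- Off a closed interval the derivative within it is vacuous. Stating both halves for every t lets
  -- them be united without a case split at b.
  have key₁ : ∀ t, HasDerivWithinAt γ (v t (γ t)) (Icc a b) t := by
    intro t
    by_cases ht : t ∈ Icc a b
    · rw [e₁ ht]
      exact (h₁ t ht).congr e₁ (e₁ ht)
    · exact HasFDerivWithinAt.of_notMem_closure (by rwa [isClosed_Icc.closure_eq])
  have key₂ : ∀ t, HasDerivWithinAt γ (v t (γ t)) (Icc b c) t := by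
    intro t
    by_cases ht : t ∈ Icc b c
    · rw [e₂ ht]
      exact (h₂ t ht).congr e₂ (e₂ ht)
    · exact HasFDerivWithinAt.of_notMem_closure (by rwa [isClosed_Icc.closure_eq])
  intro t _
  rw [← Icc_union_Icc_eq_Icc hab hbc]
  exact (key₁ t).union (key₂ t)

lemma LipschitzWith.isIntegralCurve_unique {G : E → E} {K : NNReal} (hG : LipschitzWith K G)
    {γ₁ γ₂ : ℝ → E} (h₁ : IsIntegralCurve γ₁ (fun _ => G)) (h₂ : IsIntegralCurve γ₂ (fun _ => G))
    {t₀ : ℝ} (h : γ₁ t₀ = γ₂ t₀) : γ₁ = γ₂ :=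
  ODE_solution_unique_univ (v := fun _ => G) (s := fun _ => univ) (K := K)
    (fun _ => hG.lipschitzOnWith) (fun t => ⟨h₁ t, trivial⟩) (fun t => ⟨h₂ t, trivial⟩) h

variable [CompleteSpace E]

/-- The Picard step 1 / (2(K + 1)) depends on K alone: on the ball of radius ‖G q‖ + 1 the field is
at most ‖G q‖ + K(‖G q‖ + 1), and this times the step does not exceed the radius. Pieces of constant
length can therefore be glued on both sides. -/
lemma LipschitzWith.exists_isIntegralCurveOn_Icc {G : E → E} {K : NNReal} (hG : LipschitzWith K G)
    (n : ℕ) (q : E) : ∃ γ : ℝ → E, γ 0 = q ∧ IsIntegralCurveOn γ (fun _ => G) (Icc (-n : ℝ) n) := by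
  set h : ℝ := 1 / (2 * (K + 1)) with hh
  have hK : (0 : ℝ) ≤ K := K.2
  have hpos : 0 < h := by positivity
  have step : ∀ q : E, ∃ γ : ℝ → E, γ 0 = q ∧ IsIntegralCurveOn γ (fun _ => G) (Icc (-h) h) := by
    intro q
    have hPL : IsPicardLindelof (fun _ => G) (⟨0, by constructor <;> linarith⟩ : Icc (-h) h) q
        (‖G q‖₊ + 1) 0 (‖G q‖₊ + K * (‖G q‖₊ + 1)) K := by
      refine IsPicardLindelof.of_time_independent (fun x hx => ?_) hG.lipschitzOnWith ?_
      · have h1 := hG.dist_le_mul x q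
        rw [dist_eq_norm] at h1
        have h2 : ‖G x‖ ≤ ‖G q‖ + ‖G x - G q‖ := by
          simpa using norm_add_le (G q) (G x - G q)
        have h3 : (K : ℝ) * dist x q ≤ K * (‖G q‖ + 1) :=
          mul_le_mul_of_nonneg_left (by simpa using hx) hK
        push_cast
        linarith
      · push_cast
        simp only [sub_zero, zero_sub, neg_neg, max_self]
        have h3 := norm_nonneg (G q)
        rw [hh, mul_one_div, div_le_iff₀ (by positivity)]
        nlinarith [mul_nonneg hK h3]
    obtain ⟨γ, h0, h1⟩ := hPL.exists_eq_forall_mem_Icc_hasDerivWithinAt₀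
    exact ⟨γ, h0, h1⟩
  have main : ∀ m : ℕ, ∀ q : E, ∃ γ : ℝ → E, γ 0 = q ∧
      IsIntegralCurveOn γ (fun _ => G) (Icc (-(m * h)) (m * h)) := by
    intro m
    induction m with
    | zero =>
      intro q
      obtain ⟨γ, h0, h1⟩ := step q
      exact ⟨γ, h0, h1.mono (Icc_subset_Icc (by simp [hpos.le]) (by simp [hpos.le]))⟩
    | succ m ih =>
      intro q
      obtain ⟨γ, h0, h1⟩ := ih q
      have hm : 0 ≤ m * h := by positivity
      obtain ⟨β, b0, b1⟩ := step (γ (m * h))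
      obtain ⟨α, a0, a1⟩ := step (γ (-(m * h)))
      have b2 : IsIntegralCurveOn (fun t => β (t - m * h)) (fun _ => G)
          (Icc (m * h) ((m + 1) * h)) := by
        refine (b1.comp_sub (m * h)).mono fun t ht => ?_
        rw [mem_vadd_set]
        exact ⟨t - m * h, ⟨by linarith [ht.1], by linarith [ht.2]⟩, by simp⟩
      have a2 : IsIntegralCurveOn (fun t => α (t + m * h)) (fun _ => G)
          (Icc (-((m + 1) * h)) (-(m * h))) := by
        refine (a1.comp_add (m * h)).mono fun t ht => ?_
        rw [mem_vadd_set]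
        exact ⟨t + m * h, ⟨by linarith [ht.1], by linarith [ht.2]⟩, by simp⟩
      have g1 := h1.glue b2 (by linarith) (by nlinarith) (by simp [b0])
      have g2 := a2.glue g1 (by nlinarith) (by nlinarith) (by simp [a0, hm])
      refine ⟨_, ?_, by push_cast; exact g2⟩
      by_cases hm0 : m * h = 0
      · simp [hm0, a0, h0]
      · have : ¬ (0 : ℝ) ≤ -(m * h) := by
          have := lt_of_le_of_ne hm (Ne.symm hm0)
          linarith
        simp only [if_neg this, if_pos hm, h0]
  obtain ⟨m, hm⟩ := exists_nat_ge ((n : ℝ) / h)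
  rw [div_le_iff₀ hpos] at hm
  obtain ⟨γ, h0, h1⟩ := main m q
  exact ⟨γ, h0, h1.mono (Icc_subset_Icc (by linarith) hm)⟩

lemma LipschitzWith.exists_isIntegralCurve {G : E → E} {K : NNReal} (hG : LipschitzWith K G)
    (q : E) : ∃ γ : ℝ → E, γ 0 = q ∧ IsIntegralCurve γ (fun _ => G) := by
  choose γ h0 hγ using fun n : ℕ => hG.exists_isIntegralCurveOn_Icc n q
  have huniq : ∀ m n : ℕ, m ≤ n → EqOn (γ m) (γ n) (Ioo (-m : ℝ) m) := by
    intro m n hmn t ht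
    have hm : (0 : ℝ) < m := by linarith [ht.1, ht.2]
    have hmn' : (m : ℝ) ≤ n := by exact_mod_cast hmn
    have hd : ∀ k : ℕ, m ≤ k → ∀ t ∈ Ioo (-m : ℝ) m, HasDerivAt (γ k) (G (γ k t)) t := by
      intro k hk t ht
      have hk' : (m : ℝ) ≤ k := by exact_mod_cast hk
      exact (hγ k t ⟨by linarith [ht.1], by linarith [ht.2]⟩).hasDerivAt
        (Icc_mem_nhds (by linarith [ht.1]) (by linarith [ht.2]))
    exact ODE_solution_unique_of_mem_Ioo (v := fun _ => G) (s := fun _ => univ) (t₀ := 0) (K := K)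
      (fun _ _ => hG.lipschitzOnWith) ⟨by linarith, hm⟩
      (fun t ht => ⟨hd m le_rfl t ht, trivial⟩) (fun t ht => ⟨hd n hmn t ht, trivial⟩)
      (by rw [h0, h0]) ht
  have hN : ∀ t : ℝ, |t| < (⌈|t|⌉₊ + 1 : ℕ) := fun t => by
    push_cast
    linarith [Nat.le_ceil |t|]
  refine ⟨fun t => γ (⌈|t|⌉₊ + 1) t, by simp [h0], fun t => ?_⟩
  -- The index ⌈|s|⌉ + 1 varies with s, but for s near t it never exceeds ⌈|t|⌉ + 2; by uniqueness
  -- one fixed solution describes the curve near t.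
  set N : ℕ := ⌈|t|⌉₊ + 2 with hNdef
  have hev : (fun t => γ (⌈|t|⌉₊ + 1) t) =ᶠ[𝓝 t] γ N := by
    have : ∀ᶠ s in 𝓝 t, |s| < |t| + 1 :=
      continuous_abs.continuousAt.eventually (gt_mem_nhds (by linarith))
    filter_upwards [this] with s hs
    refine huniq _ _ ?_ (abs_lt.1 (hN s))
    have : ⌈|s|⌉₊ ≤ ⌈|t|⌉₊ + 1 := by
      refine Nat.ceil_le.2 ?_
      push_cast
      linarith [Nat.le_ceil |t|]
    omega
  have ht : |t| < N := by
    have := hN t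
    rw [hNdef]; push_cast at this ⊢; linarith
  refine HasDerivAt.congr_of_eventuallyEq ?_ hev
  have hval : γ (⌈|t|⌉₊ + 1) t = γ N t := hev.eq_of_nhds
  simp only [hval]
  exact (hγ N t (abs_le.1 ht.le)).hasDerivAt (Icc_mem_nhds (abs_lt.1 ht).1 (abs_lt.1 ht).2)

/-- A globally Lipschitz vector field has a global continuous flow. -/
lemma LipschitzWith.exists_flow {G : E → E} {K : NNReal} (hG : LipschitzWith K G) :
    ∃ φ : ℝ → E → E, (∀ q, φ 0 q = q) ∧ (∀ q, IsIntegralCurve (fun t => φ t q) (fun _ => G)) ∧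
      (∀ s t q, φ (s + t) q = φ s (φ t q)) ∧ ∀ t, Continuous (φ t) := by
  choose γ h0 hγ using hG.exists_isIntegralCurve
  have hadd : ∀ s t q, γ q (s + t) = γ (γ q t) s := by
    intro s t q
    have := hG.isIntegralCurve_unique ((hγ q).comp_add t) (hγ (γ q t)) (t₀ := 0) (by simp [h0])
    exact congrFun this s
  have hfwd : ∀ t, 0 ≤ t → Continuous fun q => γ q t := by
    intro t ht
    have : LipschitzWith (Real.toNNReal (Real.exp (K * t))) fun q => γ q t := by
      refine LipschitzWith.of_dist_le_mul fun p q => ?_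
      have := dist_le_of_trajectories_ODE (v := fun _ => G) (fun _ => hG)
        (hγ p).continuous.continuousOn (fun s _ => (hγ p s).hasDerivWithinAt)
        (hγ q).continuous.continuousOn (fun s _ => (hγ q s).hasDerivWithinAt)
        (le_refl (dist (γ p 0) (γ q 0))) t ⟨ht, le_rfl⟩
      rw [h0, h0, sub_zero] at this
      rw [Real.coe_toNNReal _ (Real.exp_pos _).le, mul_comm]
      exact this
    exact this.continuous
  refine ⟨fun t q => γ q t, h0, hγ, hadd, fun t => ?_⟩
  rcases le_total 0 t with ht | ht
  · exact hfwd t ht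
  · have hneg : ∀ q, IsIntegralCurve (fun t => γ q (-t)) (fun _ q => -G q) := by
      intro q s
      have := (hγ q (-s)).scomp s (hasDerivAt_neg s)
      simpa [Function.comp_def] using this
    have : LipschitzWith (Real.toNNReal (Real.exp (K * -t))) fun q => γ q t := by
      refine LipschitzWith.of_dist_le_mul fun p q => ?_
      have := dist_le_of_trajectories_ODE (v := fun _ q => -G q) (fun _ => hG.neg)
        (hneg p).continuous.continuousOn (fun s _ => (hneg p s).hasDerivWithinAt)
        (hneg q).continuous.continuousOn (fun s _ => (hneg q s).hasDerivWithinAt)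
        (le_refl (dist (γ p (-0)) (γ q (-0)))) (-t) ⟨neg_nonneg.2 ht, le_rfl⟩
      simp only [neg_zero, h0, sub_zero, neg_neg] at this
      rw [Real.coe_toNNReal _ (Real.exp_pos _).le, mul_comm]
      exact this
    exact this.continuous

end Flow

/-! ### Positively invariant regions -/

section Barrier

variable {E : Type*} [NormedAddCommGroup E] [NormedSpace ℝ E] [FiniteDimensional ℝ E]

/-- A bounded region `{V ≤ c} ∩ C` is positively invariant if `V` decreases strictly along the
field at the points with `V = c` and `C` is positively invariant under all rescalings of the
field; `V' q` is the derivative of `V` along the field at `q`. -/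
lemma exists_isForwardSolution_of_barrier {F : E → E} (hF : ContDiff ℝ 1 F) {V V' : E → ℝ} {c : ℝ}
    {C : Set E}
    (hV : ∀ (γ : ℝ → E) (t χ : ℝ), HasDerivAt γ (χ • F (γ t)) t →
      HasDerivAt (fun s => V (γ s)) (χ * V' (γ t)) t)
    (hbdd : Bornology.IsBounded {q ∈ C | V q ≤ c})
    (hC : ∀ (χ : E → ℝ) (γ : ℝ → E), Continuous χ → IsIntegralCurve γ (fun _ q => χ q • F q) →
      γ 0 ∈ C → ∀ t, 0 ≤ t → γ t ∈ C)
    (hlt : ∀ q ∈ C, V q = c → V' q < 0) {q : E} (hq : q ∈ C) (hqc : V q ≤ c) :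
    ∃ γ : ℝ → E, IsForwardSolution F q γ ∧ ∀ t, 0 ≤ t → γ t ∈ C ∧ V (γ t) ≤ c := by
  have := FiniteDimensional.complete ℝ E
  obtain ⟨R, hR0, hR⟩ := hbdd.subset_closedBall_lt 0 (0 : E)
  let χ : ContDiffBump (0 : E) := ⟨R, R + 1, hR0, by linarith⟩
  -- The cutoff field has compact support and hence a global solution. As the cutoff is 1 on the
  -- region, a solution confined there solves the original equation.
  have hG : ContDiff ℝ 1 fun q => χ q • F q := χ.contDiff.smul hF
  obtain ⟨K, hK⟩ := hG.lipschitzWith_of_hasCompactSupport χ.hasCompactSupport.smul_right one_ne_zero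
  obtain ⟨γ, h0, hγ⟩ := hK.exists_isIntegralCurve q
  have hγC : ∀ t, 0 ≤ t → γ t ∈ C := hC χ γ χ.continuous hγ (h0 ▸ hq)
  have hVd := fun t => hV γ t _ (hγ t)
  have hone : ∀ q ∈ C, V q ≤ c → χ q = 1 := fun q hqC hqV =>
    χ.one_of_mem_closedBall (hR ⟨hqC, hqV⟩)
  have hVle : ∀ t, 0 ≤ t → V (γ t) ≤ c := by
    intro T hT
    refine image_le_of_deriv_right_lt_deriv_boundary (a := 0) (b := T) (f := fun t => V (γ t))
      (fun t _ => (hVd t).continuousAt.continuousWithinAt) (fun t _ => (hVd t).hasDerivWithinAt)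
      (B := fun _ => c) (B' := fun _ => 0) (h0 ▸ hqc) (fun t => hasDerivAt_const _ _)
      (fun t ht htc => ?_) ⟨hT, le_rfl⟩
    rw [hone _ (hγC t ht.1) htc.le, one_mul]
    exact hlt _ (hγC t ht.1) htc
  refine ⟨γ, ⟨h0, fun t ht => ?_⟩, fun t ht => ⟨hγC t ht, hVle t ht⟩⟩
  have : HasDerivWithinAt γ (χ (γ t) • F (γ t)) (Ici 0) t := (hγ t).hasDerivWithinAt
  rwa [hone _ (hγC t ht) (hVle t ht), one_smul] at this

end Barrier

/-! ### Cone inequalities near an equilibrium -/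

section Cone

variable {E : Type*} [NormedAddCommGroup E] [NormedSpace ℝ E]

/-- The quadratic form `ℓ₁² + ℓ₂² - κ² ℓ₀²`; the set where it is nonpositive is a cone around the
common kernel of `ℓ₁` and `ℓ₂`. -/
def coneForm (ℓ₀ ℓ₁ ℓ₂ : E →L[ℝ] ℝ) (κ : ℝ) (v : E) : ℝ :=
  ℓ₁ v ^ 2 + ℓ₂ v ^ 2 - κ ^ 2 * ℓ₀ v ^ 2

/-- The derivative of `coneForm` at `v` in the direction `w`. -/
def coneFormDeriv (ℓ₀ ℓ₁ ℓ₂ : E →L[ℝ] ℝ) (κ : ℝ) (v w : E) : ℝ :=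
  2 * ℓ₁ v * ℓ₁ w + 2 * ℓ₂ v * ℓ₂ w - κ ^ 2 * (2 * ℓ₀ v * ℓ₀ w)

/-- The functionals `ℓ₀, ℓ₁, ℓ₂` diagonalize the linearization `A` of the field `G` at the
equilibrium `p`, and the eigenvalue belonging to `ℓ₀` is dominated by the two others: they are
separated by `ν / 2`. The vector `e` is the eigenvector dual to `ℓ₀`. -/
structure IsConeSplitting (G : E → E) (p : E) (A : E →L[ℝ] E) (ℓ₀ ℓ₁ ℓ₂ : E →L[ℝ] ℝ) (e : E)
    (l₀ l₁ l₂ ν C : ℝ) : Prop where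
  strict : HasStrictFDerivAt G A p
  zero : G p = 0
  eig₀ : ∀ v, ℓ₀ (A v) = l₀ * ℓ₀ v
  eig₁ : ∀ v, ℓ₁ (A v) = l₁ * ℓ₁ v
  eig₂ : ∀ v, ℓ₂ (A v) = l₂ * ℓ₂ v
  lt₀ : 2 * l₀ < ν
  lt₁ : ν < 2 * l₁
  lt₂ : ν < 2 * l₂
  apply₀ : ℓ₀ e = 1
  apply₁ : ℓ₁ e = 0
  apply₂ : ℓ₂ e = 0
  pos : 0 < C
  norm_le : ∀ v, ‖v‖ ≤ C * (|ℓ₀ v| + |ℓ₁ v| + |ℓ₂ v|)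

variable {G : E → E} {p : E} {A : E →L[ℝ] E} {ℓ₀ ℓ₁ ℓ₂ : E →L[ℝ] ℝ} {e : E}
  {l₀ l₁ l₂ ν C : ℝ}

lemma HasDerivWithinAt.coneForm {γ : ℝ → E} {v : E} {s : Set ℝ} {t : ℝ} (κ : ℝ)
    (h : HasDerivWithinAt γ v s t) :
    HasDerivWithinAt (fun t => coneForm ℓ₀ ℓ₁ ℓ₂ κ (γ t)) (coneFormDeriv ℓ₀ ℓ₁ ℓ₂ κ (γ t) v) s t := by
  have h0 := ℓ₀.hasFDerivAt.comp_hasDerivWithinAt t h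
  have h1 := ℓ₁.hasFDerivAt.comp_hasDerivWithinAt t h
  have h2 := ℓ₂.hasFDerivAt.comp_hasDerivWithinAt t h
  refine (((h1.pow 2).add (h2.pow 2)).sub ((h0.pow 2).const_mul (κ ^ 2))).congr_deriv ?_
  simp [coneFormDeriv]

lemma continuous_coneForm (κ : ℝ) : Continuous (coneForm ℓ₀ ℓ₁ ℓ₂ κ) := by
  unfold coneForm
  fun_prop

lemma abs_le_of_coneForm_nonpos {κ : ℝ} (hκ : 0 ≤ κ) {v : E} (h : coneForm ℓ₀ ℓ₁ ℓ₂ κ v ≤ 0) :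
    |ℓ₁ v| ≤ κ * |ℓ₀ v| ∧ |ℓ₂ v| ≤ κ * |ℓ₀ v| := by
  unfold _root_.coneForm at h
  have hn : 0 ≤ κ * |ℓ₀ v| := by positivity
  have hs : (κ * |ℓ₀ v|) ^ 2 = κ ^ 2 * ℓ₀ v ^ 2 := by rw [mul_pow, sq_abs]
  constructor <;> refine abs_le_of_sq_le_sq ?_ hn <;>
    nlinarith [sq_nonneg (ℓ₁ v), sq_nonneg (ℓ₂ v)]

lemma abs_coneFormDeriv_le (κ : ℝ) {v r : E} {B : ℝ} (b0 : |ℓ₀ r| ≤ B) (b1 : |ℓ₁ r| ≤ B)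
    (b2 : |ℓ₂ r| ≤ B) : |coneFormDeriv ℓ₀ ℓ₁ ℓ₂ κ v r| ≤
      2 * (1 + κ ^ 2) * B * (|ℓ₀ v| + |ℓ₁ v| + |ℓ₂ v|) := by
  have hB0 : 0 ≤ B := (abs_nonneg _).trans b0
  unfold coneFormDeriv
  have a0 : |2 * ℓ₀ v * ℓ₀ r| ≤ 2 * |ℓ₀ v| * B := by
    rw [abs_mul, abs_mul, abs_two]; gcongr
  have a1 : |2 * ℓ₁ v * ℓ₁ r| ≤ 2 * |ℓ₁ v| * B := by
    rw [abs_mul, abs_mul, abs_two]; gcongr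
  have a2 : |2 * ℓ₂ v * ℓ₂ r| ≤ 2 * |ℓ₂ v| * B := by
    rw [abs_mul, abs_mul, abs_two]; gcongr
  have a3 : |κ ^ 2 * (2 * ℓ₀ v * ℓ₀ r)| ≤ κ ^ 2 * (2 * |ℓ₀ v| * B) := by
    rw [abs_mul, abs_of_nonneg (sq_nonneg κ)]; gcongr
  have c1 : 0 ≤ κ ^ 2 * (|ℓ₁ v| * B) := by positivity
  have c2 : 0 ≤ κ ^ 2 * (|ℓ₂ v| * B) := by positivity
  have c3 : 0 ≤ |ℓ₀ v| * B := by positivity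
  refine (abs_sub _ _).trans ?_
  have := abs_add_le (2 * ℓ₁ v * ℓ₁ r) (2 * ℓ₂ v * ℓ₂ r)
  linarith

namespace IsConeSplitting

variable (h : IsConeSplitting G p A ℓ₀ ℓ₁ ℓ₂ e l₀ l₁ l₂ ν C)
include h

lemma norm_le_of_coneForm_nonpos {κ : ℝ} (hκ : 0 ≤ κ) {v : E} (hv : coneForm ℓ₀ ℓ₁ ℓ₂ κ v ≤ 0) :
    ‖v‖ ≤ C * (1 + 2 * κ) * |ℓ₀ v| := by
  obtain ⟨h1, h2⟩ := abs_le_of_coneForm_nonpos hκ hv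
  refine (h.norm_le v).trans ?_
  rw [mul_assoc]
  refine mul_le_mul_of_nonneg_left ?_ h.pos.le
  linarith

/-- The cone inequality for small perturbations of the linearization. -/
lemma exists_perturbation_bound {κ : ℝ} (hκ : 0 < κ) :
    ∃ η > 0, ∀ v r : E, ‖r‖ ≤ η * ‖v‖ →
      ν * coneForm ℓ₀ ℓ₁ ℓ₂ κ v ≤ coneFormDeriv ℓ₀ ℓ₁ ℓ₂ κ v (A v + r) := by
  have hC := h.pos
  obtain ⟨m, hm, m0, m1, m2⟩ : ∃ m > 0, m ≤ κ ^ 2 * (ν - 2 * l₀) ∧ m ≤ 2 * l₁ - ν ∧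
      m ≤ 2 * l₂ - ν := by
    have := h.lt₀
    have := h.lt₁
    have := h.lt₂
    refine ⟨min (κ ^ 2 * (ν - 2 * l₀)) (min (2 * l₁ - ν) (2 * l₂ - ν)), ?_, min_le_left _ _,
      (min_le_right _ _).trans (min_le_left _ _), (min_le_right _ _).trans (min_le_right _ _)⟩
    refine lt_min (by have : 0 < ν - 2 * l₀ := by linarith
                      positivity) (lt_min (by linarith) (by linarith))
  obtain ⟨L, hL0, L0, L1, L2⟩ : ∃ L ≥ 0, ‖ℓ₀‖ ≤ L ∧ ‖ℓ₁‖ ≤ L ∧ ‖ℓ₂‖ ≤ L :=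
    ⟨‖ℓ₀‖ + ‖ℓ₁‖ + ‖ℓ₂‖, by positivity, by linarith [norm_nonneg ℓ₁, norm_nonneg ℓ₂],
      by linarith [norm_nonneg ℓ₀, norm_nonneg ℓ₂], by linarith [norm_nonneg ℓ₁, norm_nonneg ℓ₀]⟩
  -- The 6 is the 2 of `abs_coneFormDeriv_le` times the 3 of (a + b + c)² ≤ 3(a² + b² + c²).
  obtain ⟨η, hη0, hηm⟩ : ∃ η > 0, 6 * (1 + κ ^ 2) * L * C * η ≤ m := by
    refine ⟨m / (6 * (1 + κ ^ 2) * L * C + 1), by positivity, ?_⟩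
    rw [mul_div_assoc', div_le_iff₀ (by positivity)]
    nlinarith
  refine ⟨η, hη0, fun v r hr => ?_⟩
  obtain ⟨s, hs⟩ : ∃ s, s = |ℓ₀ v| + |ℓ₁ v| + |ℓ₂ v| := ⟨_, rfl⟩
  have hs0 : 0 ≤ s := by rw [hs]; positivity
  have hs2 : s ^ 2 ≤ 3 * (ℓ₀ v ^ 2 + ℓ₁ v ^ 2 + ℓ₂ v ^ 2) := by
    rw [hs, ← sq_abs (ℓ₀ v), ← sq_abs (ℓ₁ v), ← sq_abs (ℓ₂ v)]
    nlinarith [sq_nonneg (|ℓ₀ v| - |ℓ₁ v|), sq_nonneg (|ℓ₀ v| - |ℓ₂ v|),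
      sq_nonneg (|ℓ₁ v| - |ℓ₂ v|)]
  have hrs : ‖r‖ ≤ η * (C * s) :=
    hr.trans (mul_le_mul_of_nonneg_left (hs ▸ h.norm_le v) hη0.le)
  have hl : ∀ ℓ : E →L[ℝ] ℝ, ‖ℓ‖ ≤ L → |ℓ r| ≤ L * (η * (C * s)) := fun ℓ hℓ =>
    (ℓ.le_opNorm r).trans (mul_le_mul hℓ hrs (norm_nonneg _) hL0)
  have key := abs_coneFormDeriv_le κ (v := v) (hl ℓ₀ L0) (hl ℓ₁ L1) (hl ℓ₂ L2)
  rw [← hs] at key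
  -- For the linearization Q' - νQ is diagonal in the ℓᵢ, and the separation by ν/2 makes all three
  -- coefficients at least m > 0. This surplus pays for the perturbation r.
  have hlin : coneFormDeriv ℓ₀ ℓ₁ ℓ₂ κ v (A v + r) - ν * coneForm ℓ₀ ℓ₁ ℓ₂ κ v =
      (κ ^ 2 * (ν - 2 * l₀)) * ℓ₀ v ^ 2 + (2 * l₁ - ν) * ℓ₁ v ^ 2 + (2 * l₂ - ν) * ℓ₂ v ^ 2 +
        coneFormDeriv ℓ₀ ℓ₁ ℓ₂ κ v r := by
    unfold coneFormDeriv coneForm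
    rw [map_add, map_add, map_add, h.eig₀, h.eig₁, h.eig₂]
    ring
  have hBs : 2 * (1 + κ ^ 2) * (L * (η * (C * s))) * s ≤
      m * (ℓ₀ v ^ 2 + ℓ₁ v ^ 2 + ℓ₂ v ^ 2) := by
    have e1 : 2 * (1 + κ ^ 2) * (L * (η * (C * s))) * s =
      (6 * (1 + κ ^ 2) * L * C * η) * (s ^ 2 / 3) := by ring
    rw [e1]
    refine (mul_le_mul_of_nonneg_right hηm (by positivity)).trans ?_
    exact mul_le_mul_of_nonneg_left (by linarith) hm.le
  have := neg_le_of_abs_le key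
  have := mul_le_mul_of_nonneg_right m0 (sq_nonneg (ℓ₀ v))
  have := mul_le_mul_of_nonneg_right m1 (sq_nonneg (ℓ₁ v))
  have := mul_le_mul_of_nonneg_right m2 (sq_nonneg (ℓ₂ v))
  linarith

/-- Strict differentiability controls the remainder of G a - G b for all pairs near p, not only for
b = p; comparing two orbits requires this. -/
lemma exists_nhds_coneFormDeriv {κ : ℝ} (hκ : 0 < κ) :
    ∃ O ∈ 𝓝 p, ∀ a ∈ O, ∀ b ∈ O,
      ν * coneForm ℓ₀ ℓ₁ ℓ₂ κ (a - b) ≤ coneFormDeriv ℓ₀ ℓ₁ ℓ₂ κ (a - b) (G a - G b) := by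
  obtain ⟨η, hη, hb⟩ := h.exists_perturbation_bound hκ
  obtain ⟨O, hO, hap⟩ := h.strict.approximates_deriv_on_nhds (c := ⟨η, hη.le⟩) (Or.inr hη)
  refine ⟨O, hO, fun a ha b hb' => ?_⟩
  have := hb (a - b) (G a - G b - A (a - b)) (hap a ha b hb')
  rwa [add_sub_cancel] at this

/-- The field can be modified off a neighbourhood of `p` so as to be globally Lipschitz and to
satisfy the cone inequality globally. -/
lemma exists_extension [FiniteDimensional ℝ E] {κ : ℝ} (hκ : 0 < κ) :
    ∃ (G' : E → E) (K : NNReal), LipschitzWith K G' ∧ (∃ O ∈ 𝓝 p, EqOn G' G O) ∧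
      ∀ a b, ν * coneForm ℓ₀ ℓ₁ ℓ₂ κ (a - b) ≤
        coneFormDeriv ℓ₀ ℓ₁ ℓ₂ κ (a - b) (G' a - G' b) := by
  obtain ⟨η, hη, hb⟩ := h.exists_perturbation_bound hκ
  -- Extending a Lipschitz map multiplies its constant by `lipschitzExtensionConstant E`; dividing
  -- beforehand leaves a remainder that is globally η-Lipschitz.
  set c : NNReal := ⟨η, hη.le⟩ / lipschitzExtensionConstant E with hc
  have hLE := lipschitzExtensionConstant_pos E
  have hc0 : 0 < c := div_pos hη hLE
  obtain ⟨O, hO, hap⟩ := h.strict.approximates_deriv_on_nhds (c := c) (Or.inr hc0)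
  obtain ⟨r, hr, hrO⟩ := hap.lipschitzOnWith.extend_finite_dimension
  have hcη : lipschitzExtensionConstant E * c = ⟨η, hη.le⟩ := mul_div_cancel₀ _ hLE.ne'
  rw [hcη] at hr
  refine ⟨fun q => A q + r q, _, A.lipschitz.add hr, ⟨O, hO, fun q hq => ?_⟩, fun a b => ?_⟩
  · have := hrO hq
    simp only [Pi.sub_apply] at this
    simp [← this]
  · have := hb (a - b) (r a - r b) (by
      have := hr.dist_le_mul a b
      rwa [dist_eq_norm, dist_eq_norm] at this)
    rw [map_sub] at this
    rwa [add_sub_add_comm]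

end IsConeSplitting

/-- The cone form of the difference of two trajectories grows at least like `exp (ν t)`. -/
lemma mul_exp_le_coneForm {κ : ℝ} {a b va vb : ℝ → E}
    (ha : ∀ t ∈ Ici (0 : ℝ), HasDerivWithinAt a (va t) (Ici 0) t)
    (hb : ∀ t ∈ Ici (0 : ℝ), HasDerivWithinAt b (vb t) (Ici 0) t)
    (hab : ∀ t ∈ Ici (0 : ℝ), ν * coneForm ℓ₀ ℓ₁ ℓ₂ κ (a t - b t) ≤
      coneFormDeriv ℓ₀ ℓ₁ ℓ₂ κ (a t - b t) (va t - vb t)) {t : ℝ} (ht : 0 ≤ t) :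
    coneForm ℓ₀ ℓ₁ ℓ₂ κ (a 0 - b 0) * Real.exp (ν * t) ≤ coneForm ℓ₀ ℓ₁ ℓ₂ κ (a t - b t) := by
  have := mul_exp_le_of_hasDerivWithinAt (a := 0) (c := ν)
    (fun t ht => ((ha t ht).sub (hb t ht)).coneForm (ℓ₀ := ℓ₀) (ℓ₁ := ℓ₁) (ℓ₂ := ℓ₂) κ)
    (fun t ht => hab t ht) ht
  simpa using this

/-- Two trajectories which approach each other fast lie in a common cone. -/
lemma coneForm_nonpos_of_tendsto {κ : ℝ} {a b va vb : ℝ → E}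
    (ha : ∀ t ∈ Ici (0 : ℝ), HasDerivWithinAt a (va t) (Ici 0) t)
    (hb : ∀ t ∈ Ici (0 : ℝ), HasDerivWithinAt b (vb t) (Ici 0) t)
    (hab : ∀ t ∈ Ici (0 : ℝ), ν * coneForm ℓ₀ ℓ₁ ℓ₂ κ (a t - b t) ≤
      coneFormDeriv ℓ₀ ℓ₁ ℓ₂ κ (a t - b t) (va t - vb t))
    (ha' : Tendsto (fun t => Real.exp (-ν * t) * ‖a t - p‖ ^ 2) atTop (𝓝 0))
    (hb' : Tendsto (fun t => Real.exp (-ν * t) * ‖b t - p‖ ^ 2) atTop (𝓝 0)) :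
    coneForm ℓ₀ ℓ₁ ℓ₂ κ (a 0 - b 0) ≤ 0 := by
  -- The growth estimate gives Q(0) ≤ exp(-νt) Q(t), and Q(t) is at most a constant times ‖a - b‖²,
  -- so the right-hand side tends to zero.
  have hlim := ((ha'.add hb').const_mul (2 * (‖ℓ₁‖ ^ 2 + ‖ℓ₂‖ ^ 2)))
  rw [add_zero, mul_zero] at hlim
  refine ge_of_tendsto hlim ?_
  filter_upwards [eventually_ge_atTop 0] with t ht
  have h1 := mul_exp_le_coneForm ha hb hab ht
  have h2 : coneForm ℓ₀ ℓ₁ ℓ₂ κ (a t - b t) ≤ (‖ℓ₁‖ ^ 2 + ‖ℓ₂‖ ^ 2) * ‖a t - b t‖ ^ 2 := by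
    have e1 := pow_le_pow_left₀ (norm_nonneg _) (ℓ₁.le_opNorm (a t - b t)) 2
    have e2 := pow_le_pow_left₀ (norm_nonneg _) (ℓ₂.le_opNorm (a t - b t)) 2
    rw [Real.norm_eq_abs, sq_abs] at e1 e2
    unfold coneForm
    nlinarith [mul_nonneg (sq_nonneg κ) (sq_nonneg (ℓ₀ (a t - b t)))]
  have h3 : ‖a t - b t‖ ^ 2 ≤ 2 * (‖a t - p‖ ^ 2 + ‖b t - p‖ ^ 2) := by
    have := norm_sub_le (a t - p) (b t - p)
    rw [sub_sub_sub_cancel_right] at this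
    nlinarith [sq_nonneg (‖a t - p‖ - ‖b t - p‖), norm_nonneg (a t - b t)]
  have hexp : Real.exp (ν * t) * Real.exp (-ν * t) = 1 := by
    rw [← Real.exp_add]; simp
  have h4 : coneForm ℓ₀ ℓ₁ ℓ₂ κ (a 0 - b 0) * Real.exp (ν * t) ≤
      (‖ℓ₁‖ ^ 2 + ‖ℓ₂‖ ^ 2) * (2 * (‖a t - p‖ ^ 2 + ‖b t - p‖ ^ 2)) :=
    h1.trans (h2.trans (mul_le_mul_of_nonneg_left h3 (by positivity)))
  have h5 := mul_le_mul_of_nonneg_right h4 (Real.exp_pos (-ν * t)).le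
  rw [mul_assoc, hexp, mul_one] at h5
  exact h5.trans_eq (by ring)

end Cone

/-! ### Orbits confined to a cone: existence and convergence -/

section ConeGraph

variable {E : Type*} [NormedAddCommGroup E] [NormedSpace ℝ E]

variable {G : E → E} {p : E} {A : E →L[ℝ] E} {ℓ₀ ℓ₁ ℓ₂ : E →L[ℝ] ℝ} {e : E}
  {l₀ l₁ l₂ ν C : ℝ}

lemma IsForwardSolution.hasDerivWithinAt_sq {q : E} {γ : ℝ → E}
    (hγ : IsForwardSolution G q γ) (t : ℝ)
    (ht : t ∈ Ici (0 : ℝ)) : HasDerivWithinAt (fun t => ℓ₀ (γ t - p) ^ 2)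
      (2 * (ℓ₀ (γ t - p) * ℓ₀ (G (γ t)))) (Ici 0) t :=
  ((ℓ₀.hasFDerivAt.comp_hasDerivWithinAt t ((hγ.2 t ht).sub_const p)).pow 2).congr_deriv
    (by simp [mul_assoc])

lemma mul_nonpos_of_approach {κ : ℝ} {O : Set E}
    (happ : ∀ q ∈ O, coneForm ℓ₀ ℓ₁ ℓ₂ κ (q - p) ≤ 0 → ℓ₀ (q - p) ≠ 0 →
      ℓ₀ (q - p) * ℓ₀ (G q) < 0) {q : E} (hq : q ∈ O)
    (hc : coneForm ℓ₀ ℓ₁ ℓ₂ κ (q - p) ≤ 0) : ℓ₀ (q - p) * ℓ₀ (G q) ≤ 0 := by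
  by_cases h0 : ℓ₀ (q - p) = 0
  · simp [h0]
  · exact (happ q hq hc h0).le

namespace IsConeSplitting

variable (h : IsConeSplitting G p A ℓ₀ ℓ₁ ℓ₂ e l₀ l₁ l₂ ν C)
include h

lemma coneForm_smul (κ s : ℝ) : coneForm ℓ₀ ℓ₁ ℓ₂ κ (s • e) = -(κ * s) ^ 2 := by
  simp [coneForm, h.apply₀, h.apply₁, h.apply₂]; ring

variable [FiniteDimensional ℝ E]

lemma isCompact_cone {κ : ℝ} (hκ : 0 ≤ κ) (b : ℝ) :
    IsCompact {q | |ℓ₀ (q - p)| ≤ b ∧ coneForm ℓ₀ ℓ₁ ℓ₂ κ (q - p) ≤ 0} := by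
  have hcl : IsClosed {q | |ℓ₀ (q - p)| ≤ b ∧ coneForm ℓ₀ ℓ₁ ℓ₂ κ (q - p) ≤ 0} :=
    (isClosed_le (f := fun q => |ℓ₀ (q - p)|) (by fun_prop) continuous_const).inter
      (isClosed_le (f := fun q => coneForm ℓ₀ ℓ₁ ℓ₂ κ (q - p))
        ((continuous_coneForm κ).comp (continuous_sub_right p)) continuous_const)
  refine Metric.isCompact_of_isClosed_isBounded hcl ?_
  refine (Metric.isBounded_closedBall (x := p) (r := C * (1 + 2 * κ) * b)).subset fun q hq => ?_
  rw [Metric.mem_closedBall, dist_eq_norm]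
  refine (h.norm_le_of_coneForm_nonpos hκ hq.2).trans (mul_le_mul_of_nonneg_left hq.1 ?_)
  have := h.pos
  positivity

/-- A shooting argument. The cone is invariant in backward time, so points of the axis near p are
flowed back by time n until one of them reaches ℓ₀ = s₀. The points over s₀ that remain in the cone
up to time n form nested compact sets, and a common point remains there forever. -/
lemma exists_forward_in_cone {κ : ℝ} (hκ : 0 < κ) {G' : E → E} {φ : ℝ → E → E} {O : Set E}
    (φ0 : ∀ q, φ 0 q = q) (hφ : ∀ q, IsIntegralCurve (fun t => φ t q) (fun _ => G'))
    (φadd : ∀ s t q, φ (s + t) q = φ s (φ t q)) (φc : ∀ t, Continuous (φ t))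
    (φp : ∀ t, φ t p = p) (hEq : EqOn G' G O) (hp : p ∈ O)
    (hcone : ∀ a b, ν * coneForm ℓ₀ ℓ₁ ℓ₂ κ (a - b) ≤
        coneFormDeriv ℓ₀ ℓ₁ ℓ₂ κ (a - b) (G' a - G' b))
    (happ : ∀ q ∈ O, coneForm ℓ₀ ℓ₁ ℓ₂ κ (q - p) ≤ 0 → ℓ₀ (q - p) ≠ 0 →
      ℓ₀ (q - p) * ℓ₀ (G q) < 0) {s₀ : ℝ} (hs₀ : s₀ ≠ 0)
    (hKO : ∀ q, |ℓ₀ (q - p)| ≤ |s₀| → coneForm ℓ₀ ℓ₁ ℓ₂ κ (q - p) ≤ 0 → q ∈ O) :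
    ∃ q, ℓ₀ (q - p) = s₀ ∧ ∃ γ, IsForwardSolution G q γ ∧
      ∀ t, 0 ≤ t → |ℓ₀ (γ t - p)| ≤ |s₀| ∧ coneForm ℓ₀ ℓ₁ ℓ₂ κ (γ t - p) ≤ 0 := by
  have hGp : G' p = 0 := by rw [hEq hp, h.zero]
  have hback : ∀ q, coneForm ℓ₀ ℓ₁ ℓ₂ κ (q - p) ≤ 0 → ∀ t, 0 ≤ t →
      coneForm ℓ₀ ℓ₁ ℓ₂ κ (φ (-t) q - p) ≤ 0 := by
    intro q hq t ht
    have := mul_exp_le_coneForm (ν := ν) (κ := κ) (ℓ₀ := ℓ₀) (ℓ₁ := ℓ₁) (ℓ₂ := ℓ₂)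
      (fun s _ => (hφ (φ (-t) q) s).hasDerivWithinAt)
      (fun s _ => (hasDerivWithinAt_const s (Ici 0) p).congr_deriv hGp.symm)
      (fun s _ => hcone _ _) ht
    simp only [φ0, ← φadd, add_neg_cancel] at this
    by_contra hcon
    have := mul_pos (not_le.1 hcon) (Real.exp_pos (ν * t))
    linarith
  have hℓ : ∀ q t, HasDerivAt (fun t => ℓ₀ (φ t q - p)) (ℓ₀ (G' (φ t q))) t := fun q t =>
    ℓ₀.hasFDerivAt.comp_hasDerivAt t ((hφ q t).sub_const p)
  have hstart : ∀ ε : ℝ, coneForm ℓ₀ ℓ₁ ℓ₂ κ (p + (ε * s₀) • e - p) ≤ 0 := fun ε => by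
    rw [add_sub_cancel_left, h.coneForm_smul]
    exact neg_nonpos.2 (sq_nonneg _)
  have hA : ∀ n : ℕ, ∃ q, ℓ₀ (q - p) = s₀ ∧ ∀ t ∈ Icc (0 : ℝ) n,
      |ℓ₀ (φ t q - p)| ≤ |s₀| ∧ coneForm ℓ₀ ℓ₁ ℓ₂ κ (φ t q - p) ≤ 0 := by
    intro n
    have hcont : Continuous fun ε : ℝ => ℓ₀ (φ (-n) (p + (ε * s₀) • e) - p) / s₀ :=
      (ℓ₀.continuous.comp (((φc _).comp (by fun_prop)).sub continuous_const)).div_const _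
    -- The point at ε = 1 starts with ℓ₀ = s₀. Where ℓ₀ = s₀ inside the cone, `happ` makes ℓ₀ / s₀
    -- increase in backward time, so it cannot drop below 1. At ε = 0 the point is p and the ratio
    -- is 0.
    have h1 : 1 ≤ ℓ₀ (φ (-n) (p + ((1 : ℝ) * s₀) • e) - p) / s₀ := by
      have hd : ∀ t, HasDerivAt (fun t => -(ℓ₀ (φ (-t) (p + ((1 : ℝ) * s₀) • e) - p) / s₀))
          (ℓ₀ (G' (φ (-t) (p + ((1 : ℝ) * s₀) • e))) / s₀) t := by
        intro t
        have := ((hℓ (p + ((1 : ℝ) * s₀) • e) (-t)).scomp t (hasDerivAt_neg t)).div_const s₀ |>.neg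
        refine this.congr_deriv ?_
        simp [neg_div]
      have := image_le_of_deriv_right_lt_deriv_boundary (a := 0) (b := (n : ℝ))
        (fun t _ => (hd t).continuousAt.continuousWithinAt) (fun t _ => (hd t).hasDerivWithinAt)
        (B := fun _ => -1) (B' := fun _ => 0)
        (by simp [φ0, h.apply₀, hs₀]) (fun t => hasDerivAt_const _ _)
        (fun t ht hte => ?_) ⟨n.cast_nonneg, le_rfl⟩
      · linarith
      · have hval : ℓ₀ (φ (-t) (p + ((1 : ℝ) * s₀) • e) - p) = s₀ := by
          rw [neg_inj, div_eq_one_iff_eq hs₀] at hte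
          exact hte
        have hc := hback _ (hstart 1) t ht.1
        have hO := hKO _ (by rw [hval]) hc
        have := happ _ hO hc (by rw [hval]; exact hs₀)
        rw [hval] at this
        rw [hEq hO, ← neg_pos, ← neg_div, ← mul_div_mul_left _ _ hs₀]
        exact div_pos (by linarith) (mul_self_pos.2 hs₀)
    obtain ⟨ε, -, hε⟩ := intermediate_value_Icc (zero_le_one' ℝ) hcont.continuousOn
      (show (1 : ℝ) ∈ _ from ⟨by simp [φp], h1⟩)
    have hε' : ℓ₀ (φ (-n) (p + (ε * s₀) • e) - p) = s₀ := by
      have : ℓ₀ (φ (-n) (p + (ε * s₀) • e) - p) / s₀ = 1 := hε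
      rwa [div_eq_one_iff_eq hs₀] at this
    have hform : ∀ t ∈ Icc (0 : ℝ) n,
        coneForm ℓ₀ ℓ₁ ℓ₂ κ (φ t (φ (-n) (p + (ε * s₀) • e)) - p) ≤ 0 := by
      intro t ht
      rw [← φadd, show t + -(n : ℝ) = -(n - t) by ring]
      exact hback _ (hstart ε) _ (by linarith [ht.2])
    refine ⟨_, hε', fun t ht => ⟨?_, hform t ht⟩⟩
    refine sq_le_sq.1 ?_
    have hd : ∀ t, HasDerivAt (fun t => ℓ₀ (φ t (φ (-n) (p + (ε * s₀) • e)) - p) ^ 2) _ t :=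
      fun t => (hℓ _ t).pow 2
    refine image_le_of_deriv_right_lt_deriv_boundary (a := 0) (b := (n : ℝ))
      (fun t _ => (hd t).continuousAt.continuousWithinAt) (fun t _ => (hd t).hasDerivWithinAt)
      (B := fun _ => s₀ ^ 2) (B' := fun _ => 0) (by simp only [φ0, hε']; rfl)
      (fun t => hasDerivAt_const _ _) (fun t ht hte => ?_) ht
    have hc := hform t ⟨ht.1, ht.2.le⟩
    have hO := hKO _ (sq_le_sq.1 hte.le) hc
    have := happ _ hO hc (fun h0 => hs₀ (by simpa [h0] using hte.symm))
    rw [hEq hO]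
    simp only [Nat.cast_ofNat, Nat.add_one_sub_one, pow_one]
    linarith
  set S : ℕ → Set E := fun n => {q | ℓ₀ (q - p) = s₀ ∧ ∀ t ∈ Icc (0 : ℝ) n,
      |ℓ₀ (φ t q - p)| ≤ |s₀| ∧ coneForm ℓ₀ ℓ₁ ℓ₂ κ (φ t q - p) ≤ 0} with hS
  have hScl : ∀ n, IsClosed (S n) := by
    intro n
    have hSn : S n = {q | ℓ₀ (q - p) = s₀} ∩ ⋂ t ∈ Icc (0 : ℝ) n,
        φ t ⁻¹' {q | |ℓ₀ (q - p)| ≤ |s₀| ∧ coneForm ℓ₀ ℓ₁ ℓ₂ κ (q - p) ≤ 0} := by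
      ext q
      simp [hS]
    rw [hSn]
    exact (isClosed_eq (by fun_prop) continuous_const).inter (isClosed_biInter fun t _ =>
      (h.isCompact_cone hκ.le |s₀|).isClosed.preimage (φc t))
  have hScpt : IsCompact (S 0) := by
    refine (h.isCompact_cone hκ.le |s₀|).of_isClosed_subset (hScl 0) fun q hq => ?_
    simpa [φ0] using hq.2 0 (by simp)
  obtain ⟨q, hq⟩ := IsCompact.nonempty_iInter_of_sequence_nonempty_isCompact_isClosed S
    (fun n q hq => ⟨hq.1, fun t ht => hq.2 t ⟨ht.1, ht.2.trans (by simp)⟩⟩)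
    hA hScpt hScl
  rw [mem_iInter] at hq
  have hq' : ∀ t, 0 ≤ t → |ℓ₀ (φ t q - p)| ≤ |s₀| ∧ coneForm ℓ₀ ℓ₁ ℓ₂ κ (φ t q - p) ≤ 0 :=
    fun t ht => (hq ⌈t⌉₊).2 t ⟨ht, Nat.le_ceil t⟩
  refine ⟨q, (hq 0).1, fun t => φ t q, ⟨φ0 q, fun t ht => ?_⟩, hq'⟩
  have := (hφ q t).hasDerivWithinAt (s := Ici 0)
  simp only at this
  rwa [hEq (hKO _ (hq' t ht).1 (hq' t ht).2)] at this

/-- Inside the cone ℓ₀ controls the norm, so it suffices that ℓ₀² tends to zero. Its derivative is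
negative, and on the compact part of the cone where ℓ₀² ≥ c it is bounded away from zero. -/
lemma tendsto_of_forward_in_cone {κ : ℝ} (hκ : 0 < κ) {O : Set E} (hGc : ContinuousOn G O)
    (happ : ∀ q ∈ O, coneForm ℓ₀ ℓ₁ ℓ₂ κ (q - p) ≤ 0 → ℓ₀ (q - p) ≠ 0 →
      ℓ₀ (q - p) * ℓ₀ (G q) < 0) {b : ℝ}
    (hKO : ∀ q, |ℓ₀ (q - p)| ≤ b → coneForm ℓ₀ ℓ₁ ℓ₂ κ (q - p) ≤ 0 → q ∈ O) {q : E} {γ : ℝ → E}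
    (hγ : IsForwardSolution G q γ)
    (hγK : ∀ t, 0 ≤ t → |ℓ₀ (γ t - p)| ≤ b ∧ coneForm ℓ₀ ℓ₁ ℓ₂ κ (γ t - p) ≤ 0) :
    Tendsto γ atTop (𝓝 p) := by
  have hO : ∀ t, 0 ≤ t → γ t ∈ O := fun t ht => hKO _ (hγK t ht).1 (hγK t ht).2
  have hlim := tendsto_zero_of_strict_decay hγ.hasDerivWithinAt_sq (fun t _ => sq_nonneg _)
    (fun t ht => by linarith [mul_nonpos_of_approach happ (hO t ht) (hγK t ht).2]) ?_
  · have hlim' : Tendsto (fun t => |ℓ₀ (γ t - p)|) atTop (𝓝 0) := by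
      have := (Real.continuous_sqrt.tendsto 0).comp hlim
      simpa [Function.comp_def, Real.sqrt_sq_eq_abs] using this
    rw [tendsto_iff_norm_sub_tendsto_zero]
    refine squeeze_zero' (Eventually.of_forall fun _ => norm_nonneg _) ?_
      (by have := hlim'.const_mul (C * (1 + 2 * κ)); rwa [mul_zero] at this)
    filter_upwards [eventually_ge_atTop 0] with t ht
    exact h.norm_le_of_coneForm_nonpos hκ.le (hγK t ht).2
  · intro c hc
    set S := {q | |ℓ₀ (q - p)| ≤ b ∧ coneForm ℓ₀ ℓ₁ ℓ₂ κ (q - p) ≤ 0} ∩ {q | c ≤ ℓ₀ (q - p) ^ 2}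
    have hS : IsCompact S :=
      (h.isCompact_cone hκ.le b).inter_right (isClosed_le continuous_const (by fun_prop))
    rcases S.eq_empty_or_nonempty with hemp | hne
    · refine ⟨1, one_pos, fun t ht htc => absurd ?_ (notMem_empty (γ t))⟩
      rw [← hemp]
      exact ⟨hγK t ht, htc⟩
    · have hcont : ContinuousOn (fun q => 2 * (ℓ₀ (q - p) * ℓ₀ (G q))) S := by
        have hSO : S ⊆ O := fun q hq => hKO q hq.1.1 hq.1.2
        have h1 : ContinuousOn (fun q => ℓ₀ (q - p)) S := by fun_prop
        exact (h1.mul (ℓ₀.continuous.comp_continuousOn (hGc.mono hSO))).const_smul (2 : ℝ)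
      obtain ⟨q₀, hq₀, hmax⟩ := hS.exists_isMaxOn hne hcont
      refine ⟨-(2 * (ℓ₀ (q₀ - p) * ℓ₀ (G q₀))), ?_, fun t ht htc => ?_⟩
      · have := happ q₀ (hKO q₀ hq₀.1.1 hq₀.1.2) hq₀.1.2 (fun h0 => by
          have := hq₀.2
          rw [mem_ofPred_eq, h0] at this
          norm_num at this
          linarith)
        linarith
      · rw [neg_neg]
        exact hmax ⟨hγK t ht, htc⟩

end IsConeSplitting

end ConeGraph

/-! ### Smoothness of curves lying in narrow cones -/

section ConeGraph

variable {E : Type*} [NormedAddCommGroup E] [NormedSpace ℝ E]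

variable {G : E → E} {p : E} {A : E →L[ℝ] E} {ℓ₀ ℓ₁ ℓ₂ : E →L[ℝ] ℝ} {e : E}
  {l₀ l₁ l₂ ν C : ℝ}

/-- A `C¹` curve parametrized by the value of a functional `ℓ₀` is a `C¹` graph. -/
lemma isC1GraphAt_of_curve {Γ : ℝ → E} {b : ℝ} (hb : 0 < b) (he : ℓ₀ e = 1)
    (hΓ : ContDiffOn ℝ 1 Γ (Ioo (-b) b)) (hΓ0 : Γ 0 = p) (hΓ' : HasDerivAt Γ e 0)
    (hℓ : ∀ s ∈ Ioo (-b) b, ℓ₀ (Γ s - p) = s) :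
    IsC1GraphAt (Γ '' Ioo (-b) b) p (Submodule.span ℝ {e}) := by
  -- P is the projection onto ker ℓ₀ along e. In the splitting by span e and ker ℓ₀ the curve is the
  -- graph of P (Γ - p).
  set P : E →L[ℝ] (LinearMap.ker (ℓ₀ : E →ₗ[ℝ] ℝ)) :=
    (ContinuousLinearMap.id ℝ E - ℓ₀.smulRight e).codRestrict _ (fun v => by simp [he]) with hP
  have hPv : ∀ v, (P v : E) = v - ℓ₀ v • e := fun v => by simp [hP]
  have hspan : ∀ s : Submodule.span ℝ {e}, (s : E) = ℓ₀ s • e := by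
    rintro ⟨s, hs⟩
    obtain ⟨c, rfl⟩ := Submodule.mem_span_singleton.1 hs
    simp [he]
  set j : Submodule.span ℝ {e} →L[ℝ] ℝ := ℓ₀.comp (Submodule.subtypeL _) with hj
  have hj' : ∀ s : Submodule.span ℝ {e}, j s = ℓ₀ s := fun s => rfl
  have hPe : P e = 0 := Subtype.ext (by simp [hPv, he])
  refine ⟨LinearMap.ker (ℓ₀ : E →ₗ[ℝ] ℝ), j ⁻¹' Ioo (-b) b, fun s => P (Γ (j s) - p), ?_,
    isOpen_Ioo.preimage j.continuous, by simp [hb], ?_, by simp [hΓ0], ?_, ?_⟩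
  · constructor
    · rw [Submodule.disjoint_def]
      intro x hx hx'
      have h1 : ℓ₀ x = 0 := hx'
      have h2 : x = ℓ₀ x • e := hspan ⟨x, hx⟩
      rw [h2, h1, zero_smul]
    · rw [codisjoint_iff, eq_top_iff]
      rintro x -
      rw [Submodule.mem_sup]
      exact ⟨ℓ₀ x • e, Submodule.smul_mem _ _ (Submodule.mem_span_singleton_self e),
        x - ℓ₀ x • e, by simp [he], by simp⟩
  · exact P.contDiff.comp_contDiffOn
      ((hΓ.comp j.contDiff.contDiffOn (fun s hs => hs)).sub contDiffOn_const)
  · have h1 : HasFDerivAt (fun s => P (Γ (j s) - p))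
        (P.comp ((ContinuousLinearMap.toSpanSingleton ℝ e).comp j)) 0 := by
      have h2 : HasFDerivAt Γ (ContinuousLinearMap.toSpanSingleton ℝ e) (j 0) := by
        rw [map_zero]; exact hΓ'.hasFDerivAt
      exact P.hasFDerivAt.comp 0 ((h2.comp 0 j.hasFDerivAt).sub_const p)
    rw [h1.fderiv]
    ext s
    simp [hPe]
  · ext q
    constructor
    · rintro ⟨s, hs, rfl⟩
      refine ⟨⟨s • e, Submodule.smul_mem _ _ (Submodule.mem_span_singleton_self e)⟩, ?_, ?_⟩
      · simpa [hj, he] using hs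
      · simp only [hj', hPv, map_smul, he, smul_eq_mul, mul_one, hℓ s hs]
        abel
    · rintro ⟨s, hs, rfl⟩
      refine ⟨j s, hs, ?_⟩
      rw [hPv, hℓ _ hs, hspan s, hj']
      simp

namespace IsConeSplitting

variable (h : IsConeSplitting G p A ℓ₀ ℓ₁ ℓ₂ e l₀ l₁ l₂ ν C)
include h

/-- The deviation from the axis is of order κ: narrow cones force difference quotients close to e.
-/
lemma norm_sub_smul_le {κ : ℝ} (hκ : 0 ≤ κ) {v : E} (hv : coneForm ℓ₀ ℓ₁ ℓ₂ κ v ≤ 0) :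
    ‖v - ℓ₀ v • e‖ ≤ 2 * C * κ * |ℓ₀ v| := by
  obtain ⟨h1, h2⟩ := abs_le_of_coneForm_nonpos hκ hv
  refine (h.norm_le _).trans ?_
  simp only [map_sub, map_smul, h.apply₀, h.apply₁, h.apply₂, smul_eq_mul, mul_one, mul_zero,
    sub_self, sub_zero, abs_zero, zero_add]
  have := mul_le_mul_of_nonneg_left (add_le_add h1 h2) h.pos.le
  linarith

/-- A curve which lies in arbitrarily narrow cones near `p` is `C¹` at `p`. -/
lemma contDiffOn_curve {Γ D : ℝ → E} {b : ℝ} (hb : 0 < b)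
    (hℓ : ∀ s ∈ Ioo (-b) b, ℓ₀ (Γ s - p) = s)
    (hcone : ∀ κ > 0, ∃ ρ > 0, ∀ s t, |s| < ρ → |t| < ρ → coneForm ℓ₀ ℓ₁ ℓ₂ κ (Γ s - Γ t) ≤ 0)
    (hD : ∀ s ∈ Ioo (-b) b, s ≠ 0 → HasDerivAt Γ (D s) s ∧ ContinuousAt D s) :
    ContDiffOn ℝ 1 Γ (Ioo (-b) b) ∧ HasDerivAt Γ e 0 := by
  have hlip : ∀ ε > 0, ∃ ρ > 0, ρ ≤ b ∧ ∀ s t, |s| < ρ → |t| < ρ →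
      ‖Γ s - Γ t - (s - t) • e‖ ≤ ε * |s - t| := by
    intro ε hε
    have hC := h.pos
    obtain ⟨ρ, hρ, hρc⟩ := hcone (ε / (2 * C)) (by positivity)
    refine ⟨min ρ b, lt_min hρ hb, min_le_right _ _, fun s t hs ht => ?_⟩
    have hst : ℓ₀ (Γ s - Γ t) = s - t := by
      have e1 := hℓ s (abs_lt.1 (hs.trans_le (min_le_right _ _)))
      have e2 := hℓ t (abs_lt.1 (ht.trans_le (min_le_right _ _)))
      rw [map_sub] at e1 e2 ⊢
      linarith
    have := h.norm_sub_smul_le (by positivity)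
      (hρc s t (hs.trans_le (min_le_left _ _)) (ht.trans_le (min_le_left _ _)))
    rw [hst] at this
    refine this.trans_eq ?_
    field_simp
  have hd0 : HasDerivAt Γ e 0 := by
    rw [hasDerivAt_iff_isLittleO, Asymptotics.isLittleO_iff]
    intro ε hε
    obtain ⟨ρ, hρ, -, hρl⟩ := hlip ε hε
    filter_upwards [Metric.ball_mem_nhds 0 hρ] with s hs
    rw [Metric.mem_ball, Real.dist_eq, sub_zero] at hs
    simpa using hρl s 0 hs (by simpa using hρ)
  have hdiff : ∀ s ∈ Ioo (-b) b, DifferentiableAt ℝ Γ s := by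
    intro s hs
    by_cases h0 : s = 0
    · rw [h0]; exact hd0.differentiableAt
    · exact (hD s hs h0).1.differentiableAt
  refine ⟨?_, hd0⟩
  rw [show (1 : WithTop ℕ∞) = 0 + 1 by simp, contDiffOn_succ_iff_deriv_of_isOpen isOpen_Ioo]
  refine ⟨fun s hs => (hdiff s hs).differentiableWithinAt, by simp, ?_⟩
  rw [contDiffOn_zero]
  refine fun s hs => ContinuousAt.continuousWithinAt ?_
  by_cases h0 : s = 0
  · rw [h0, Metric.continuousAt_iff]
    intro ε hε
    obtain ⟨ρ, hρ, hρb, hρl⟩ := hlip (ε / 2) (by positivity)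
    refine ⟨ρ, hρ, fun {t} ht => ?_⟩
    rw [Real.dist_eq, sub_zero] at ht
    rw [dist_eq_norm, hd0.deriv]
    have htb := abs_lt.1 (ht.trans_le hρb)
    -- Near 0 the map Γ - r e is ε/2-Lipschitz, so its derivative is at most ε/2. This gives
    -- continuity of the derivative at 0, not just its existence.
    have hder : HasDerivAt (fun r => Γ r - r • e) (deriv Γ t - e) t := by
      simpa only [one_smul] using (hdiff t htb).hasDerivAt.fun_sub ((hasDerivAt_id' t).smul_const e)
    have hle : ‖deriv Γ t - e‖ ≤ ε / 2 := by
      rw [← hder.deriv]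
      refine norm_deriv_le_of_lip' (by positivity) ?_
      have hev : ∀ᶠ r in 𝓝 t, |r| < ρ := continuous_abs.continuousAt.eventually (gt_mem_nhds ht)
      filter_upwards [hev] with r hr
      have := hρl r t hr ht
      rw [sub_smul] at this
      rw [Real.norm_eq_abs]
      convert this using 2
      abel
    linarith
  · refine (hD s hs h0).2.congr ?_
    filter_upwards [Ioo_mem_nhds hs.1 hs.2, isOpen_ne.mem_nhds h0] with t ht ht0
    exact (hD t ht ht0).1.deriv.symm

end IsConeSplitting

/-- A set which contains a piece of the trajectory through each of its points is, where it is
parametrized by `ℓ₀` and transversal to `ker ℓ₀`, differentiable. -/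
lemma hasDerivAt_of_trajectory {Γ γ : ℝ → E} {G' : E → E} (hG' : Continuous G')
    (hγ : IsIntegralCurve γ (fun _ => G'))
    (hne : ℓ₀ (G' (γ 0)) ≠ 0) (hΓ : ∀ᶠ t in 𝓝 (0 : ℝ), Γ (ℓ₀ (γ t - p)) = γ t) :
    HasDerivAt Γ ((ℓ₀ (G' (γ 0)))⁻¹ • G' (γ 0)) (ℓ₀ (γ 0 - p)) := by
  have hd : ∀ t, HasDerivAt (fun t => ℓ₀ (γ t - p)) (ℓ₀ (G' (γ t))) t := fun t =>
    ℓ₀.hasFDerivAt.comp_hasDerivAt t ((hγ t).sub_const p)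
  have hcont : Continuous fun t => ℓ₀ (G' (γ t)) := ℓ₀.continuous.comp (hG'.comp hγ.continuous)
  have hs : HasStrictDerivAt (fun t => ℓ₀ (γ t - p)) (ℓ₀ (G' (γ 0))) 0 :=
    hasStrictDerivAt_of_hasDerivAt_of_continuousAt (Eventually.of_forall hd) hcont.continuousAt
  -- Transversality makes ℓ₀ a local time parameter, and Γ agrees near the point with γ composed
  -- with the inverse time change τ.
  set τ := hs.localInverse _ _ _ hne with hτ
  have hτd : HasStrictDerivAt τ (ℓ₀ (G' (γ 0)))⁻¹ (ℓ₀ (γ 0 - p)) := hs.to_localInverse hne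
  have hτ0 : τ (ℓ₀ (γ 0 - p)) = 0 :=
    (hs.hasStrictFDerivAt_equiv hne).localInverse_apply_image
  have hτt : Tendsto τ (𝓝 (ℓ₀ (γ 0 - p))) (𝓝 0) := by
    have := hτd.hasDerivAt.continuousAt.tendsto
    rwa [hτ0] at this
  have hinv : ∀ᶠ s in 𝓝 (ℓ₀ (γ 0 - p)), ℓ₀ (γ (τ s) - p) = s :=
    (hs.hasStrictFDerivAt_equiv hne).eventually_right_inverse
  have hev : Γ =ᶠ[𝓝 (ℓ₀ (γ 0 - p))] γ ∘ τ := by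
    filter_upwards [hτt.eventually hΓ, hinv] with s h1 h2
    rw [← h2] at h1 ⊢
    simpa [h2] using h1
  refine HasDerivAt.congr_of_eventuallyEq ?_ hev
  have hγ' : HasDerivAt γ (G' (γ 0)) (τ (ℓ₀ (γ 0 - p))) := by rw [hτ0]; exact hγ 0
  exact hγ'.scomp _ hτd.hasDerivAt

end ConeGraph

/-! ### The invariant curve as a C¹ graph -/

section ConeGraph

variable {E : Type*} [NormedAddCommGroup E] [NormedSpace ℝ E]

variable {G : E → E} {p : E} {A : E →L[ℝ] E} {ℓ₀ ℓ₁ ℓ₂ : E →L[ℝ] ℝ} {e : E}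
  {l₀ l₁ l₂ ν C : ℝ}

lemma IsForwardSolution.eqOn_of_lipschitz {G' : E → E} {K : NNReal} (hG' : LipschitzWith K G')
    {O : Set E} (hEq : EqOn G' G O) {γ γ' : ℝ → E} {q : E} (hγ : IsForwardSolution G q γ)
    (hO : ∀ t, 0 ≤ t → γ t ∈ O) (hγ' : IsIntegralCurve γ' (fun _ => G')) (h0 : γ' 0 = q) {t : ℝ}
    (ht : 0 ≤ t) : γ t = γ' t := by
  refine ODE_solution_unique (v := fun _ => G') (K := K) (a := 0) (b := t) (fun _ => hG')
    (fun s hs => (hγ.2 s hs.1).continuousWithinAt.mono fun _ hr => hr.1) (fun s hs => ?_)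
    hγ'.continuous.continuousOn (fun s _ => (hγ' s).hasDerivWithinAt) (hγ.1.trans h0.symm)
    ⟨ht, le_rfl⟩
  have := (hγ.2 s hs.1).mono (Ici_subset_Ici.2 hs.1)
  simp only at this
  rwa [← hEq (hO s hs.1)] at this

lemma IsForwardSolution.shift {q : E} {γ : ℝ → E} (hγ : IsForwardSolution G q γ) {T : ℝ}
    (hT : 0 ≤ T) : IsForwardSolution G (γ T) (fun t => γ (t + T)) := by
  refine ⟨by simp, (hγ.2.comp_add T).mono fun t ht => ?_⟩
  rw [mem_vadd_set]
  exact ⟨t + T, add_nonneg ht hT, by simp⟩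

lemma isForwardSolution_const (hp : G p = 0) : IsForwardSolution G p (fun _ => p) :=
  ⟨rfl, fun t _ => (hasDerivWithinAt_const t _ p).congr_deriv hp.symm⟩

namespace IsConeSplitting

/-- The points whose trajectories converge to `p` inside `U`, and fast enough to be separated from
the directions `ℓ₁`, `ℓ₂`, form a `C¹` curve tangent to the eigenvector `e`. -/
theorem exists_nhds_isC1GraphAt [FiniteDimensional ℝ E]
    (h : IsConeSplitting G p A ℓ₀ ℓ₁ ℓ₂ e l₀ l₁ l₂ ν C) {κ : ℝ} (hκ : 0 < κ)
    (happ : ∀ᶠ q in 𝓝 p, coneForm ℓ₀ ℓ₁ ℓ₂ κ (q - p) ≤ 0 → ℓ₀ (q - p) ≠ 0 →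
      ℓ₀ (q - p) * ℓ₀ (G q) < 0) :
    ∃ O ∈ 𝓝 p, ∀ U ⊆ O, IsOpen U → ∀ b > 0, (∀ q ∈ U, |ℓ₀ (q - p)| < b) →
      (∀ q, |ℓ₀ (q - p)| < b → coneForm ℓ₀ ℓ₁ ℓ₂ κ (q - p) ≤ 0 → q ∈ U) →
      (∀ q γ, IsForwardSolution G q γ → (∀ t, 0 ≤ t → γ t ∈ U) → Tendsto γ atTop (𝓝 p) →
        Tendsto (fun t => Real.exp (-ν * t) * ‖γ t - p‖ ^ 2) atTop (𝓝 0)) →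
      IsC1GraphAt (localStableSet G U p) p (Submodule.span ℝ {e}) := by
  have := FiniteDimensional.complete ℝ E
  obtain ⟨G', K, hK, ⟨O₁, hO₁, hEq⟩, hcone⟩ := h.exists_extension hκ
  obtain ⟨φ, φ0, hφ, φadd, φc⟩ := hK.exists_flow
  refine ⟨O₁ ∩ {q | coneForm ℓ₀ ℓ₁ ℓ₂ κ (q - p) ≤ 0 → ℓ₀ (q - p) ≠ 0 →
      ℓ₀ (q - p) * ℓ₀ (G q) < 0}, inter_mem hO₁ happ, ?_⟩
  -- The conditions on U and b say that U lies in the slab |ℓ₀| < b and contains the part of the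
  -- cone in that slab, so the parameter interval is exactly (-b, b).
  intro U hUO hU b hb hUb hbU hfast
  have hEqU : EqOn G' G U := fun q hq => hEq (hUO hq).1
  have happU : ∀ q ∈ U, coneForm ℓ₀ ℓ₁ ℓ₂ κ (q - p) ≤ 0 → ℓ₀ (q - p) ≠ 0 →
      ℓ₀ (q - p) * ℓ₀ (G q) < 0 := fun q hq => (hUO hq).2
  have hGc : ContinuousOn G U := hK.continuous.continuousOn.congr fun q hq => (hEqU hq).symm
  have hpU : p ∈ U := hbU p (by simpa using hb) (by simp [coneForm])
  have hGp : G' p = 0 := by rw [hEqU hpU, h.zero]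
  have φp : ∀ t, φ t p = p := fun t => congrFun (hK.isIntegralCurve_unique (hφ p)
    (fun t => (hasDerivAt_const t p).congr_deriv hGp.symm) (φ0 p)) t
  set W := localStableSet G U p with hW
  -- the set is described by the flow of the extended field
  have hWφ : ∀ q ∈ W, IsForwardSolution G q (fun t => φ t q) ∧ (∀ t, 0 ≤ t → φ t q ∈ U) ∧
      Tendsto (fun t => φ t q) atTop (𝓝 p) := by
    rintro q ⟨γ, hγ, hγU, hγt⟩
    have heq : ∀ t, 0 ≤ t → γ t = φ t q := fun t ht =>
      hγ.eqOn_of_lipschitz hK hEqU hγU (hφ q) (φ0 q) ht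
    refine ⟨⟨φ0 q, fun t ht => ?_⟩, fun t ht => heq t ht ▸ hγU t ht,
      hγt.congr' ((eventually_ge_atTop 0).mono heq)⟩
    have := (hφ q t).hasDerivWithinAt (s := Ici 0)
    simp only at this
    rwa [hEqU (heq t ht ▸ hγU t ht)] at this
  have hW0 : ∀ q, q ∈ W → q ∈ U := fun q hq => by simpa [φ0] using (hWφ q hq).2.1 0 le_rfl
  have hpW : p ∈ W := ⟨_, isForwardSolution_const h.zero, fun _ _ => hpU, tendsto_const_nhds⟩
  have hpair : ∀ κ' : ℝ, ∀ q₁ ∈ W, ∀ q₂ ∈ W,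
      (∀ t, 0 ≤ t → ν * coneForm ℓ₀ ℓ₁ ℓ₂ κ' (φ t q₁ - φ t q₂) ≤
        coneFormDeriv ℓ₀ ℓ₁ ℓ₂ κ' (φ t q₁ - φ t q₂) (G (φ t q₁) - G (φ t q₂))) →
      coneForm ℓ₀ ℓ₁ ℓ₂ κ' (q₁ - q₂) ≤ 0 := by
    intro κ' q₁ h₁ q₂ h₂ hc
    obtain ⟨s₁, u₁, t₁⟩ := hWφ q₁ h₁
    obtain ⟨s₂, u₂, t₂⟩ := hWφ q₂ h₂
    have := coneForm_nonpos_of_tendsto (ν := ν) (p := p) s₁.2 s₂.2 hc (hfast _ _ s₁ u₁ t₁)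
      (hfast _ _ s₂ u₂ t₂)
    simpa only [φ0] using this
  have hpairκ : ∀ q₁ ∈ W, ∀ q₂ ∈ W, coneForm ℓ₀ ℓ₁ ℓ₂ κ (q₁ - q₂) ≤ 0 := by
    intro q₁ h₁ q₂ h₂
    refine hpair κ q₁ h₁ q₂ h₂ fun t ht => ?_
    rw [← hEqU ((hWφ q₁ h₁).2.1 t ht), ← hEqU ((hWφ q₂ h₂).2.1 t ht)]
    exact hcone _ _
  have hshift : ∀ q ∈ W, ∀ t, 0 ≤ t → φ t q ∈ W := fun q hq t ht =>
    ⟨_, (hWφ q hq).1.shift ht, fun r hr => (hWφ q hq).2.1 _ (add_nonneg hr ht),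
      (hWφ q hq).2.2.comp (tendsto_atTop_add_const_right _ t tendsto_id)⟩
  -- existence of a point over each parameter
  have hex : ∀ s ∈ Ioo (-b) b, ∃ q ∈ W, ℓ₀ (q - p) = s := by
    intro s hs
    rcases eq_or_ne s 0 with rfl | hs0
    · exact ⟨p, hpW, by simp⟩
    have hKU : ∀ q, |ℓ₀ (q - p)| ≤ |s| → coneForm ℓ₀ ℓ₁ ℓ₂ κ (q - p) ≤ 0 → q ∈ U :=
      fun q hq => hbU q (hq.trans_lt (abs_lt.2 hs))
    obtain ⟨q, hq, γ, hγ, hγK⟩ := h.exists_forward_in_cone hκ φ0 hφ φadd φc φp hEqU hpU hcone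
      happU hs0 hKU
    exact ⟨q, ⟨γ, hγ, fun t ht => hKU _ (hγK t ht).1 (hγK t ht).2,
      h.tendsto_of_forward_in_cone hκ hGc happU hKU hγ hγK⟩, hq⟩
  choose! Γ hΓW hΓℓ using hex
  -- Two points of W differ by a vector of the cone, and a vector of the cone with ℓ₀ = 0 vanishes.
  have huniq : ∀ q ∈ W, ∀ q' ∈ W, ℓ₀ (q - p) = ℓ₀ (q' - p) → q = q' := by
    intro q hq q' hq' heq
    have h0 : ℓ₀ (q - q') = 0 := by
      rw [map_sub] at heq ⊢
      rw [map_sub] at heq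
      linarith
    have := h.norm_le_of_coneForm_nonpos hκ.le (hpairκ q hq q' hq')
    rw [h0, abs_zero, mul_zero] at this
    exact sub_eq_zero.1 (norm_le_zero_iff.1 this)
  have hWΓ : ∀ q ∈ W, q = Γ (ℓ₀ (q - p)) := fun q hq =>
    have hs := abs_lt.1 (hUb q (hW0 q hq))
    huniq q hq _ (hΓW _ hs) (hΓℓ _ hs).symm
  have hb0 : (0 : ℝ) ∈ Ioo (-b) b := ⟨by linarith, hb⟩
  have hΓ0 : Γ 0 = p := huniq _ (hΓW 0 hb0) p hpW (by rw [hΓℓ 0 hb0]; simp)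
  have himage : W = Γ '' Ioo (-b) b := by
    ext q
    exact ⟨fun hq => ⟨_, abs_lt.1 (hUb q (hW0 q hq)), (hWΓ q hq).symm⟩,
      fun ⟨s, hs, hsq⟩ => hsq ▸ hΓW s hs⟩
  -- orbits stay close to `p`
  have hdec : ∀ q ∈ W, ∀ t, 0 ≤ t → ‖φ t q - p‖ ≤ C * (1 + 2 * κ) * |ℓ₀ (q - p)| := by
    intro q hq t ht
    have hcf : ∀ t, 0 ≤ t → coneForm ℓ₀ ℓ₁ ℓ₂ κ (φ t q - p) ≤ 0 := fun t ht =>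
      hpairκ _ (hshift q hq t ht) _ hpW
    have hanti := antitoneOn_Ici_of_hasDerivWithinAt (hWφ q hq).1.hasDerivWithinAt_sq
      (fun t ht => by
        linarith [mul_nonpos_of_approach happU ((hWφ q hq).2.1 t ht) (hcf t ht)])
      self_mem_Ici (show t ∈ Ici 0 from ht) ht
    simp only [φ0] at hanti
    have := h.pos
    exact (h.norm_le_of_coneForm_nonpos hκ.le (hcf t ht)).trans
      (mul_le_mul_of_nonneg_left (sq_le_sq.1 hanti) (by positivity))
  have hnarrow : ∀ κ' > 0, ∃ ρ > 0, ∀ s t, |s| < ρ → |t| < ρ →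
      coneForm ℓ₀ ℓ₁ ℓ₂ κ' (Γ s - Γ t) ≤ 0 := by
    intro κ' hκ'
    obtain ⟨O', hO', hc'⟩ := h.exists_nhds_coneFormDeriv hκ'
    obtain ⟨r, hr, hrO⟩ := Metric.mem_nhds_iff.1 hO'
    have hC := h.pos
    have hmem : ∀ s, |s| < min b (r / (C * (1 + 2 * κ))) → Γ s ∈ W ∧
        ∀ t, 0 ≤ t → φ t (Γ s) ∈ O' := by
      intro s hs
      have hsb := abs_lt.1 (hs.trans_le (min_le_left _ _))
      refine ⟨hΓW s hsb, fun t ht => hrO ?_⟩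
      rw [Metric.mem_ball, dist_eq_norm]
      have := hdec _ (hΓW s hsb) t ht
      rw [hΓℓ s hsb] at this
      refine this.trans_lt ?_
      have := hs.trans_le (min_le_right _ _)
      rwa [lt_div_iff₀' (by positivity)] at this
    refine ⟨min b (r / (C * (1 + 2 * κ))), lt_min hb (by positivity), fun s t hs ht => ?_⟩
    -- Orbits of W that start close to p never leave the smaller neighbourhood where the
    -- κ'-inequality holds, so the comparison can be repeated with any opening.
    exact hpair κ' _ (hmem s hs).1 _ (hmem t ht).1 fun τ hτ =>
      hc' _ ((hmem s hs).2 τ hτ) _ ((hmem t ht).2 τ hτ)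
  have hΓlip : ∀ s ∈ Ioo (-b) b, ContinuousAt Γ s := by
    intro s hs
    rw [ContinuousAt, tendsto_iff_norm_sub_tendsto_zero]
    have hev : ∀ᶠ t in 𝓝 s, ‖Γ t - Γ s‖ ≤ C * (1 + 2 * κ) * |t - s| := by
      filter_upwards [Ioo_mem_nhds hs.1 hs.2] with t ht
      have := h.norm_le_of_coneForm_nonpos hκ.le (hpairκ _ (hΓW t ht) _ (hΓW s hs))
      have e1 := hΓℓ t ht
      have e2 := hΓℓ s hs
      rw [map_sub] at e1 e2 this
      rwa [show ℓ₀ (Γ t) - ℓ₀ (Γ s) = t - s by linarith] at this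
    refine squeeze_zero' (Eventually.of_forall fun _ => norm_nonneg _) hev ?_
    have hc : Continuous fun t => C * (1 + 2 * κ) * |t - s| := by fun_prop
    simpa using hc.tendsto s
  have hne : ∀ s ∈ Ioo (-b) b, s ≠ 0 → ℓ₀ (G' (Γ s)) ≠ 0 := by
    intro s hs hs0 h0
    have := happU _ (hW0 _ (hΓW s hs)) (hpairκ _ (hΓW s hs) _ hpW) (by rw [hΓℓ s hs]; exact hs0)
    rw [← hEqU (hW0 _ (hΓW s hs)), h0, mul_zero] at this
    exact lt_irrefl _ this
  have hD : ∀ s ∈ Ioo (-b) b, s ≠ 0 →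
      HasDerivAt Γ ((ℓ₀ (G' (Γ s)))⁻¹ • G' (Γ s)) s ∧
        ContinuousAt (fun s => (ℓ₀ (G' (Γ s)))⁻¹ • G' (Γ s)) s := by
    intro s hs hs0
    constructor
    · have hloc : ∀ᶠ t in 𝓝 (0 : ℝ), Γ (ℓ₀ (φ t (Γ s) - p)) = φ t (Γ s) := by
        have hφc : Continuous fun t => φ t (Γ s) := (hφ (Γ s)).continuous
        have hUn : ∀ᶠ t in 𝓝 (0 : ℝ), φ t (Γ s) ∈ U :=
          hφc.continuousAt.eventually_mem (hU.mem_nhds (by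
            simp only [φ0]
            exact hW0 _ (hΓW s hs)))
        obtain ⟨δ, hδ, hδU⟩ := Metric.eventually_nhds_iff.1 hUn
        refine Metric.eventually_nhds_iff.2 ⟨δ, hδ, fun {t} ht => (hWΓ _ ?_).symm⟩
        rw [Real.dist_eq, sub_zero] at ht
        obtain ⟨s₁, u₁, t₁⟩ := hWφ _ (hΓW s hs)
        -- For small negative t as well: U is open, so the short arc before the starting point lies
        -- in U and the earlier point belongs to W.
        have hin : ∀ r, 0 ≤ r → φ (r + t) (Γ s) ∈ U := by
          intro r hr
          rcases le_or_gt 0 (r + t) with h1 | h1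
          · exact u₁ _ h1
          · refine hδU ?_
            rw [Real.dist_eq, sub_zero]
            have := abs_lt.1 ht
            exact abs_lt.2 ⟨by linarith, by linarith⟩
        refine ⟨fun r => φ (r + t) (Γ s), ⟨by simp, fun r hr => ?_⟩, hin,
          t₁.comp (tendsto_atTop_add_const_right _ t tendsto_id)⟩
        have := ((hφ (Γ s)).comp_add t r).hasDerivWithinAt (s := Ici 0)
        simp only [Function.comp_apply] at this
        rw [hEqU (hin r hr)] at this
        exact this
      have := hasDerivAt_of_trajectory (ℓ₀ := ℓ₀) (p := p) hK.continuous (hφ (Γ s))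
        (by simpa only [φ0] using hne s hs hs0) hloc
      simpa only [φ0, hΓℓ s hs] using this
    · have h1 : ContinuousAt (fun s => G' (Γ s)) s :=
        hK.continuous.continuousAt.comp (hΓlip s hs)
      exact ((ℓ₀.continuous.continuousAt.comp h1).inv₀ (hne s hs hs0)).smul h1
  obtain ⟨hC1, hC1'⟩ := h.contDiffOn_curve hb hΓℓ hnarrow hD
  rw [himage]
  exact isC1GraphAt_of_curve hb h.apply₀ hC1 hΓ0 hC1' hΓℓ

end IsConeSplitting

end ConeGraph

/-! ### Coordinates in Euclidean space -/

section Coordinates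

variable {n : ℕ}

lemma HasDerivWithinAt.euclidean_apply {γ : ℝ → EuclideanSpace ℝ (Fin n)} {v : EuclideanSpace ℝ (Fin n)}
    {s : Set ℝ} {t : ℝ} (h : HasDerivWithinAt γ v s t) (i : Fin n) :
    HasDerivWithinAt (fun t => γ t i) (v i) s t :=
  (EuclideanSpace.proj (𝕜 := ℝ) i).hasFDerivAt.comp_hasDerivWithinAt t h

lemma hasDerivWithinAt_euclidean {γ : ℝ → EuclideanSpace ℝ (Fin n)} {v : EuclideanSpace ℝ (Fin n)}
    {s : Set ℝ} {t : ℝ} (h : ∀ i, HasDerivWithinAt (fun t => γ t i) (v i) s t) :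
    HasDerivWithinAt γ v s t := by
  have h1 : HasDerivWithinAt (fun t i => γ t i) (fun i => v i) s t := hasDerivWithinAt_pi.2 h
  exact (EuclideanSpace.equiv (Fin n) ℝ).symm.hasFDerivAt.comp_hasDerivWithinAt t h1

lemma tendsto_euclidean {α : Type*} {l : Filter α} {f : α → EuclideanSpace ℝ (Fin n)}
    {p : EuclideanSpace ℝ (Fin n)} (h : ∀ i, Tendsto (fun a => f a i) l (𝓝 (p i))) :
    Tendsto f l (𝓝 p) := by
  have h1 : Tendsto (fun a i => f a i) l (𝓝 fun i => p i) := tendsto_pi_nhds.2 h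
  exact ((EuclideanSpace.equiv (Fin n) ℝ).symm.continuous.tendsto _).comp h1

lemma tendsto_euclidean_apply {α : Type*} {l : Filter α} {f : α → EuclideanSpace ℝ (Fin n)}
    {p : EuclideanSpace ℝ (Fin n)} (h : Tendsto f l (𝓝 p)) (i : Fin n) :
    Tendsto (fun a => f a i) l (𝓝 (p i)) :=
  ((EuclideanSpace.proj (𝕜 := ℝ) i).continuous.tendsto p).comp h

lemma exists_box_subset {p : EuclideanSpace ℝ (Fin n)} {V : Set (EuclideanSpace ℝ (Fin n))}
    (hV : V ∈ 𝓝 p) : ∃ r > 0, ∀ q : EuclideanSpace ℝ (Fin n), (∀ i, |q i - p i| < r) → q ∈ V := by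
  have h1 : (EuclideanSpace.equiv (Fin n) ℝ).symm ⁻¹' V ∈ 𝓝 (fun i => p i) :=
    (EuclideanSpace.equiv (Fin n) ℝ).symm.continuous.continuousAt.preimage_mem_nhds hV
  obtain ⟨r, hr, hrV⟩ := Metric.mem_nhds_iff.1 h1
  refine ⟨r, hr, fun q hq => hrV (show (fun i => q i) ∈ _ from ?_)⟩
  rw [Metric.mem_ball, dist_pi_lt_iff hr]
  exact hq

lemma box_mem_nhds (p : EuclideanSpace ℝ (Fin n)) {r : ℝ} (hr : 0 < r) :
    ∀ᶠ q in 𝓝 p, ∀ i, |q i - p i| < r := by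
  refine eventually_all.2 fun i => ?_
  have : ContinuousAt (fun q : EuclideanSpace ℝ (Fin n) => |q i - p i|) p := by fun_prop
  exact this.eventually (gt_mem_nhds (by simpa using hr))

end Coordinates

/-! ### The vector field, its Jacobian and its linear equations -/

section PowerLaw

variable {μ : ℝ}

/-- The curvature variable `1 - x² - y²`, which satisfies a homogeneous linear equation along the
trajectories of the system. -/
noncomputable def curvature (q : Phase3) : ℝ := 1 - q 0 ^ 2 - q 1 ^ 2

lemma phase3_ext {p q : Phase3} (h0 : p 0 = q 0) (h1 : p 1 = q 1) (h2 : p 2 = q 2) : p = q := by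
  ext i
  fin_cases i
  · exact h0
  · exact h1
  · exact h2

lemma powerLawField_apply_zero (q : Phase3) : powerLawField μ q 0 =
    -2 * q 0 + μ / 2 * q 1 ^ 2 * q 2 - q 0 * q 1 ^ 2 + 2 * q 0 ^ 3 := rfl

lemma powerLawField_apply_one (q : Phase3) : powerLawField μ q 1 =
    q 1 - μ / 2 * q 0 * q 1 * q 2 + 2 * q 0 ^ 2 * q 1 - q 1 ^ 3 := rfl

lemma powerLawField_apply_two (q : Phase3) : powerLawField μ q 2 = -q 0 * q 2 ^ 2 := rfl

lemma contDiff_powerLawField : ContDiff ℝ 1 (powerLawField μ) := by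
  rw [contDiff_euclidean]
  intro i
  fin_cases i
  · simp only [Fin.zero_eta, powerLawField_apply_zero]
    fun_prop
  · simp only [Fin.mk_one, powerLawField_apply_one]
    fun_prop
  · simp only [Fin.reduceFinMk, powerLawField_apply_two]
    fun_prop

lemma fderiv_powerLawField (q v : Phase3) : fderiv ℝ (powerLawField μ) q v =
    !₂[(-2 - q 1 ^ 2 + 6 * q 0 ^ 2) * v 0 + (μ * q 1 * q 2 - 2 * q 0 * q 1) * v 1 +
        μ / 2 * q 1 ^ 2 * v 2,
      (-(μ / 2) * q 1 * q 2 + 4 * q 0 * q 1) * v 0 +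
        (1 - μ / 2 * q 0 * q 2 + 2 * q 0 ^ 2 - 3 * q 1 ^ 2) * v 1 - μ / 2 * q 0 * q 1 * v 2,
      -q 2 ^ 2 * v 0 - 2 * q 0 * q 2 * v 2] := by
  have hF : HasFDerivAt (powerLawField μ) (fderiv ℝ (powerLawField μ) q) q :=
    (contDiff_powerLawField.differentiable one_ne_zero q).hasFDerivAt
  have hline : ∀ i, HasDerivAt (fun t : ℝ => q i + t * v i) (v i) 0 := fun i => by
    simpa using ((hasDerivAt_id (0 : ℝ)).mul_const (v i)).const_add (q i)
  have hl : HasDerivAt (fun t : ℝ => q + t • v) v 0 := by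
    simpa using ((hasDerivAt_id (0 : ℝ)).smul_const v).const_add q
  have hF0 : HasFDerivAt (powerLawField μ) (fderiv ℝ (powerLawField μ) q) (q + (0 : ℝ) • v) := by
    simpa using hF
  have h1 := hF0.comp_hasDerivAt 0 hl
  have h2 : ∀ i, HasDerivAt (fun t : ℝ => powerLawField μ (q + t • v) i)
      (fderiv ℝ (powerLawField μ) q v i) 0 := fun i =>
    (EuclideanSpace.proj (𝕜 := ℝ) i).hasFDerivAt.comp_hasDerivAt 0 h1
  have x := hline 0
  have y := hline 1
  have z := hline 2
  refine phase3_ext ?_ ?_ ?_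
  · refine (h2 0).unique ?_
    refine (((((x.const_mul (-2)).add (((y.pow 2).const_mul (μ / 2)).mul z)).sub
      (x.mul (y.pow 2))).add ((x.pow 3).const_mul 2))).congr_deriv ?_
    simp; ring
  · refine (h2 1).unique ?_
    refine (((y.sub (((x.const_mul (μ / 2)).mul y).mul z)).add
      (((x.pow 2).const_mul 2).mul y)).sub (y.pow 3)).congr_deriv ?_
    simp; ring
  · refine (h2 2).unique ?_
    refine (x.neg.mul (z.pow 2)).congr_deriv ?_
    simp; ring

lemma hasStrictFDerivAt_powerLawField (q : Phase3) :
    HasStrictFDerivAt (powerLawField μ) (fderiv ℝ (powerLawField μ) q) q :=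
  contDiff_powerLawField.contDiffAt.hasStrictFDerivAt one_ne_zero

lemma jacobianCharpoly_powerLawField (q : Phase3) : jacobianCharpoly (powerLawField μ) q =
    (!![-2 - q 1 ^ 2 + 6 * q 0 ^ 2, μ * q 1 * q 2 - 2 * q 0 * q 1, μ / 2 * q 1 ^ 2;
      -(μ / 2) * q 1 * q 2 + 4 * q 0 * q 1, 1 - μ / 2 * q 0 * q 2 + 2 * q 0 ^ 2 - 3 * q 1 ^ 2,
        -(μ / 2 * q 0 * q 1);
      -q 2 ^ 2, 0, -(2 * q 0 * q 2)] : Matrix (Fin 3) (Fin 3) ℝ).charpoly := by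
  rw [jacobianCharpoly, ← LinearMap.charpoly_toMatrix _ (EuclideanSpace.basisFun (Fin 3) ℝ).toBasis]
  congr 1
  ext i j
  rw [LinearMap.toMatrix_apply]
  simp only [ContinuousLinearMap.coe_coe, fderiv_powerLawField, OrthonormalBasis.coe_toBasis,
    EuclideanSpace.basisFun_apply, OrthonormalBasis.coe_toBasis_repr_apply,
    EuclideanSpace.basisFun_repr]
  fin_cases i <;> fin_cases j <;> simp

section Trajectories

variable {γ : ℝ → Phase3} {s : Set ℝ} {t χ : ℝ}
  (h : HasDerivWithinAt γ (χ • powerLawField μ (γ t)) s t)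
include h

/-- The factor χ treats at once the field (χ = 1), its time reversal (χ = -1) and the cutoff fields
of the barrier argument. -/
lemma hasDerivWithinAt_x : HasDerivWithinAt (fun t => γ t 0) (χ * (-2 * γ t 0 +
    μ / 2 * γ t 1 ^ 2 * γ t 2 - γ t 0 * γ t 1 ^ 2 + 2 * γ t 0 ^ 3)) s t :=
  h.euclidean_apply 0

lemma hasDerivWithinAt_y : HasDerivWithinAt (fun t => γ t 1) (χ *
    (1 - μ / 2 * γ t 0 * γ t 2 + 2 * γ t 0 ^ 2 - γ t 1 ^ 2) * γ t 1) s t :=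
  (h.euclidean_apply 1).congr_deriv (by
    rw [PiLp.smul_apply, powerLawField_apply_one, smul_eq_mul]; ring)

lemma hasDerivWithinAt_z : HasDerivWithinAt (fun t => γ t 2) (χ * (-γ t 0 * γ t 2) * γ t 2) s t :=
  (h.euclidean_apply 2).congr_deriv (by
    rw [PiLp.smul_apply, powerLawField_apply_two, smul_eq_mul]; ring)

/-- In x x' + y y' the terms with μ cancel, and the remaining polynomial is divisible by 1 - x² -
y². -/
lemma hasDerivWithinAt_curvature : HasDerivWithinAt (fun t => curvature (γ t))
    (χ * (4 * γ t 0 ^ 2 - 2 * γ t 1 ^ 2) * curvature (γ t)) s t :=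
  ((((hasDerivWithinAt_x h).pow 2).const_sub 1).sub ((hasDerivWithinAt_y h).pow 2)).congr_deriv (by
    simp only [curvature]; push_cast; ring)

end Trajectories

lemma IsForwardSolution.hasDerivWithinAt_smul {q : Phase3} {γ : ℝ → Phase3}
    (h : IsForwardSolution (powerLawField μ) q γ) (t : ℝ) (ht : t ∈ Ici (0 : ℝ)) :
    HasDerivWithinAt γ ((1 : ℝ) • powerLawField μ (γ t)) (Ici 0) t := by
  rw [one_smul]; exact h.2 t ht

lemma IsForwardSolution.hasDerivWithinAt_neg_smul {q : Phase3} {γ : ℝ → Phase3}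
    (h : IsForwardSolution (-powerLawField μ) q γ) (t : ℝ) (ht : t ∈ Ici (0 : ℝ)) :
    HasDerivWithinAt γ ((-1 : ℝ) • powerLawField μ (γ t)) (Ici 0) t := by
  rw [neg_one_smul]; exact h.2 t ht

end PowerLaw

/-! ### Equilibria and eigenvalues -/

section CriticalPoints

variable {μ : ℝ}

/-- The third component forces x = 0 or z = 0. If x ≠ 0, combining the first two components yields
3y = 0. The condition μz = 0 keeps the case μ = 0 included. -/
lemma powerLawField_eq_zero_iff {q : Phase3} : powerLawField μ q = 0 ↔
    (q 0 = 0 ∧ q 1 = 0) ∨ (q 0 = 0 ∧ q 1 ^ 2 = 1 ∧ μ * q 2 = 0) ∨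
      (q 0 ^ 2 = 1 ∧ q 1 = 0 ∧ q 2 = 0) := by
  constructor
  · intro h
    have h0 := congrArg (fun v : Phase3 => v 0) h
    have h1 := congrArg (fun v : Phase3 => v 1) h
    have h2 := congrArg (fun v : Phase3 => v 2) h
    simp only [powerLawField_apply_zero, powerLawField_apply_one, powerLawField_apply_two,
      PiLp.zero_apply] at h0 h1 h2
    by_cases hx : q 0 = 0
    · rw [hx] at h0 h1
      by_cases hy : q 1 = 0
      · exact Or.inl ⟨hx, hy⟩
      · have hy1 : q 1 * (1 - q 1 ^ 2) = 0 := by linear_combination h1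
        have hy2 := (mul_eq_zero.1 hy1).resolve_left hy
        have hy3 : q 1 ^ 2 = 1 := by linarith
        refine Or.inr (Or.inl ⟨hx, hy3, ?_⟩)
        rw [hy3] at h0
        linarith
    · have hz : q 2 = 0 := by simpa [hx] using h2
      rw [hz] at h0 h1
      have hx1 : q 0 * (2 * q 0 ^ 2 - 2 - q 1 ^ 2) = 0 := by linear_combination h0
      have hx2 := (mul_eq_zero.1 hx1).resolve_left hx
      have hy : q 1 = 0 := by
        have : q 1 * 3 = 0 := by linear_combination h1 - q 1 * hx2
        linarith
      refine Or.inr (Or.inr ⟨?_, hy, hz⟩)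
      rw [hy] at hx2
      linarith
  · intro h
    refine phase3_ext ?_ ?_ ?_ <;>
      simp only [powerLawField_apply_zero, powerLawField_apply_one, powerLawField_apply_two,
        PiLp.zero_apply] <;>
      rcases h with ⟨hx, hy⟩ | ⟨hx, hy, hz⟩ | ⟨hx, hy, hz⟩
    · rw [hx, hy]; ring
    · rw [hx]; linear_combination (q 1 ^ 2 / 2) * hz
    · rw [hy]; linear_combination 2 * q 0 * hx
    · rw [hy]; ring
    · rw [hx]; linear_combination -q 1 * hy
    · rw [hy]; ring
    · rw [hx]; ring
    · rw [hx]; ring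
    · rw [hz]; ring

lemma powerLawField_zeros (hμ : μ ≠ 0) : {q : Phase3 | powerLawField μ q = 0} =
    {!₂[0, 1, 0], !₂[0, -1, 0], !₂[1, 0, 0], !₂[-1, 0, 0]} ∪ range (fun r : ℝ => !₂[0, 0, r]) := by
  ext q
  rw [mem_ofPred_eq, powerLawField_eq_zero_iff]
  constructor
  · rintro (⟨hx, hy⟩ | ⟨hx, hy, hz⟩ | ⟨hx, hy, hz⟩)
    · exact Or.inr ⟨q 2, phase3_ext (by simp [hx]) (by simp [hy]) (by simp)⟩
    · have hz' : q 2 = 0 := (mul_eq_zero.1 hz).resolve_left hμ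
      rcases mul_self_eq_one_iff.1 ((sq _).symm.trans hy) with h | h
      · exact Or.inl (Or.inl (phase3_ext (by simp [hx]) (by simp [h]) (by simp [hz'])))
      · exact Or.inl (Or.inr (Or.inl (phase3_ext (by simp [hx]) (by simp [h]) (by simp [hz']))))
    · rcases mul_self_eq_one_iff.1 ((sq _).symm.trans hx) with h | h
      · exact Or.inl (Or.inr (Or.inr (Or.inl
          (phase3_ext (by simp [h]) (by simp [hy]) (by simp [hz])))))
      · exact Or.inl (Or.inr (Or.inr (Or.inr
          (phase3_ext (by simp [h]) (by simp [hy]) (by simp [hz])))))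
  · rintro ((rfl | rfl | rfl | rfl) | ⟨r, rfl⟩) <;> simp

lemma powerLawField_eq_zero_of_y {ε : ℝ} (hε : ε ^ 2 = 1) : powerLawField μ !₂[0, ε, 0] = 0 :=
  powerLawField_eq_zero_iff.2 (Or.inr (Or.inl (by simp [hε])))

lemma powerLawField_eq_zero_of_x {ε : ℝ} (hε : ε ^ 2 = 1) : powerLawField μ !₂[ε, 0, 0] = 0 :=
  powerLawField_eq_zero_iff.2 (Or.inr (Or.inr (by simp [hε])))

lemma eq_of_sq_eq_of_abs_sub_lt {x ε : ℝ} (hε : ε ^ 2 = 1) (hx : x ^ 2 = 1) (h : |x - ε| < 1) :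
    x = ε := by
  have h1 : (x - ε) * (x + ε) = 0 := by linear_combination hx - hε
  rcases mul_eq_zero.1 h1 with h2 | h2
  · linarith
  · have h3 : x = -ε := by linarith
    rw [h3] at h
    have := sq_lt_one_iff_abs_lt_one _ |>.2 h
    nlinarith

lemma eventually_ne_zero_of_y (hμ : μ ≠ 0) {ε : ℝ} (hε : ε ^ 2 = 1) :
    ∀ᶠ q in 𝓝[≠] (!₂[0, ε, 0] : Phase3), powerLawField μ q ≠ 0 := by
  rw [eventually_nhdsWithin_iff]
  filter_upwards [box_mem_nhds (!₂[0, ε, 0] : Phase3) one_pos] with q hq hne h0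
  have hy : |q 1 - ε| < 1 := by simpa using hq 1
  have hx : |q 0| < 1 := by simpa using hq 0
  refine hne ?_
  rcases powerLawField_eq_zero_iff.1 h0 with ⟨h1, h2⟩ | ⟨h1, h2, h3⟩ | ⟨h1, h2, h3⟩
  · rw [h2] at hy
    have := (sq_lt_one_iff_abs_lt_one _).2 hy
    nlinarith
  · exact phase3_ext (by simp [h1]) (by simpa using eq_of_sq_eq_of_abs_sub_lt hε h2 hy)
      (by simpa using (mul_eq_zero.1 h3).resolve_left hμ)
  · have := (sq_lt_one_iff_abs_lt_one _).2 hx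
    linarith

lemma eventually_ne_zero_of_x {ε : ℝ} (hε : ε ^ 2 = 1) :
    ∀ᶠ q in 𝓝[≠] (!₂[ε, 0, 0] : Phase3), powerLawField μ q ≠ 0 := by
  rw [eventually_nhdsWithin_iff]
  filter_upwards [box_mem_nhds (!₂[ε, 0, 0] : Phase3) one_pos] with q hq hne h0
  have hx : |q 0 - ε| < 1 := by simpa using hq 0
  have hx0 : q 0 ≠ 0 := by
    intro h
    rw [h] at hx
    have := (sq_lt_one_iff_abs_lt_one _).2 hx
    nlinarith
  refine hne ?_
  rcases powerLawField_eq_zero_iff.1 h0 with ⟨h1, h2⟩ | ⟨h1, h2, h3⟩ | ⟨h1, h2, h3⟩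
  · exact absurd h1 hx0
  · exact absurd h1 hx0
  · exact phase3_ext (by simpa using eq_of_sq_eq_of_abs_sub_lt hε h1 hx) (by simp [h2])
      (by simp [h3])

lemma jacobianCharpoly_of_y {ε : ℝ} (hε : ε ^ 2 = 1) :
    jacobianCharpoly (powerLawField μ) !₂[0, ε, 0] = (X + 3) * (X + 2) * X := by
  rw [jacobianCharpoly_powerLawField, Matrix.charpoly, Matrix.det_fin_three]
  have h2 : (C 2 : ℝ[X]) = 2 := rfl
  have h3 : (C 3 : ℝ[X]) = 3 := rfl
  simp [hε, h2, h3]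
  ring

lemma jacobianCharpoly_of_x {ε : ℝ} (hε : ε ^ 2 = 1) :
    jacobianCharpoly (powerLawField μ) !₂[ε, 0, 0] = (X - 4) * (X - 3) * X := by
  rw [jacobianCharpoly_powerLawField, Matrix.charpoly, Matrix.det_fin_three]
  have h2 : (C 2 : ℝ[X]) = 2 := rfl
  have h6 : (C 6 : ℝ[X]) = 6 := rfl
  simp [hε, h2, h6]
  ring

lemma jacobianCharpoly_of_line (r : ℝ) :
    jacobianCharpoly (powerLawField μ) !₂[0, 0, r] = (X + 2) * (X - 1) * X := by
  rw [jacobianCharpoly_powerLawField, Matrix.charpoly, Matrix.det_fin_three]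
  have h2 : (C 2 : ℝ[X]) = 2 := rfl
  simp [h2]

end CriticalPoints

/-! ### The horizontal plane and its complements -/

section Subspaces

lemma mem_span_xy {v : Phase3} :
    v ∈ Submodule.span ℝ {(!₂[1, 0, 0] : Phase3), !₂[0, 1, 0]} ↔ v 2 = 0 := by
  rw [Submodule.mem_span_pair]
  constructor
  · rintro ⟨a, b, rfl⟩
    simp
  · intro h
    exact ⟨v 0, v 1, phase3_ext (by simp) (by simp) (by simp [h])⟩

lemma isCompl_span_xy {c : Phase3} (hc : c 2 ≠ 0) :
    IsCompl (Submodule.span ℝ {(!₂[1, 0, 0] : Phase3), !₂[0, 1, 0]}) (Submodule.span ℝ {c}) := by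
  constructor
  · rw [Submodule.disjoint_def]
    intro v hv hv'
    obtain ⟨a, rfl⟩ := Submodule.mem_span_singleton.1 hv'
    rw [mem_span_xy] at hv
    have : a = 0 := by simpa [hc] using hv
    simp [this]
  · rw [codisjoint_iff, eq_top_iff]
    rintro v -
    rw [Submodule.mem_sup]
    refine ⟨v - (v 2 / c 2) • c, mem_span_xy.2 (by simp [hc]), (v 2 / c 2) • c,
      Submodule.smul_mem _ _ (Submodule.mem_span_singleton_self c), by simp⟩

lemma span_xy_ne_bot : Submodule.span ℝ {(!₂[1, 0, 0] : Phase3), !₂[0, 1, 0]} ≠ ⊥ := by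
  intro h
  have h1 : (!₂[1, 0, 0] : Phase3) ∈ (⊥ : Submodule ℝ Phase3) := by
    rw [← h]
    exact mem_span_xy.2 (by simp)
  have := congrArg (fun v : Phase3 => v 0) ((Submodule.mem_bot ℝ).1 h1)
  simp at this

end Subspaces

/-! ### Tangent directions and growth criteria -/

section NodeTools

lemma isBounded_of_abs_apply_le {n : ℕ} {S : Set (EuclideanSpace ℝ (Fin n))} {M : ℝ}
    (h : ∀ q ∈ S, ∀ i, |q i| ≤ M) : Bornology.IsBounded S := by
  rw [isBounded_iff_forall_norm_le]
  refine ⟨√(n * M ^ 2), fun q hq => ?_⟩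
  rw [EuclideanSpace.norm_eq]
  refine Real.sqrt_le_sqrt ?_
  calc ∑ i, ‖q i‖ ^ 2 ≤ ∑ _i : Fin n, M ^ 2 :=
        Finset.sum_le_sum fun i _ => pow_le_pow_left₀ (norm_nonneg _) (h q hq i) 2
    _ = n * M ^ 2 := by simp

lemma tendsto_of_tendsto_sq {α : Type*} {l : Filter α} {f : α → ℝ} {ε : ℝ} (hε : ε ^ 2 = 1)
    (h : Tendsto (fun a => f a ^ 2) l (𝓝 1)) (hpos : ∀ᶠ a in l, 0 < ε * f a) :
    Tendsto f l (𝓝 ε) := by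
  have h1 := ((Real.continuous_sqrt.tendsto 1).comp h).const_mul ε
  rw [Real.sqrt_one, mul_one] at h1
  refine h1.congr' (hpos.mono fun a ha => ?_)
  have h2 : f a ^ 2 = (ε * f a) ^ 2 := by rw [mul_pow, hε, one_mul]
  simp only [Function.comp_apply]
  rw [h2, Real.sqrt_sq ha.le, ← mul_assoc, ← sq, hε, one_mul]

/-- If a trajectory approaches `p` at the same rate as a scalar function of constant sign, it has
a limiting tangent direction. -/
lemma exists_tendsto_direction {E : Type*} [NormedAddCommGroup E] [NormedSpace ℝ E]
    {δ : ℝ → E} {m : ℝ → ℝ} {e : E} (hm : ContinuousOn m (Ici 0)) (hne : ∀ t ∈ Ici (0 : ℝ), m t ≠ 0)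
    (he : e ≠ 0) (h : Tendsto (fun t => (m t)⁻¹ • δ t) atTop (𝓝 e)) :
    ∃ e' : E, ‖e'‖ = 1 ∧ Tendsto (fun t => ‖δ t‖⁻¹ • δ t) atTop (𝓝 e') := by
  obtain ⟨σ, hσ, hσm⟩ : ∃ σ : ℝ, σ ^ 2 = 1 ∧ ∀ t ∈ Ici (0 : ℝ), 0 < σ * m t := by
    rcases lt_or_gt_of_ne (hne 0 self_mem_Ici) with h0 | h0
    · refine ⟨-1, by norm_num, fun t ht => ?_⟩
      have := pos_of_continuousOn_of_ne_zero hm.neg (neg_pos.2 h0)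
        (fun t ht => neg_ne_zero.2 (hne t ht)) ht
      simpa using this
    · exact ⟨1, by norm_num, fun t ht => by
        simpa using pos_of_continuousOn_of_ne_zero hm h0 hne ht⟩
  have hσ1 : |σ| = 1 := by
    rw [← sq_abs] at hσ
    exact (pow_eq_one_iff_of_nonneg (abs_nonneg σ) two_ne_zero).1 hσ
  refine ⟨σ • ‖e‖⁻¹ • e, ?_, ?_⟩
  · rw [norm_smul, norm_smul, norm_inv, norm_norm, Real.norm_eq_abs, hσ1,
      inv_mul_cancel₀ (norm_ne_zero_iff.2 he), one_mul]
  · have h1 := ((h.norm.inv₀ (norm_ne_zero_iff.2 he)).smul h).const_smul σ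
    refine h1.congr' ?_
    filter_upwards [eventually_ge_atTop 0] with t ht
    have hpos := hσm t ht
    have hmt := hne t ht
    have habs : |m t| = σ * m t := by
      rw [← abs_of_pos hpos, abs_mul, hσ1, one_mul]
    rw [norm_smul, norm_inv, Real.norm_eq_abs, habs, mul_inv, inv_inv, smul_smul, smul_smul]
    congr 1
    field_simp
    rw [hσ]

lemma linear_ne_zero {f b : ℝ → ℝ} {c : ℝ}
    (h : ∀ t ∈ Ici (0 : ℝ), HasDerivWithinAt f (b t * f t) (Ici 0) t)
    (h0 : ∀ t ∈ Ici (0 : ℝ), c ≤ b t) (hf : f 0 ≠ 0) : ∀ t ∈ Ici (0 : ℝ), f t ≠ 0 := by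
  intro t ht h1
  have h2 := mul_exp_le_abs_of_linear h h0 ht
  rw [h1, abs_zero] at h2
  have := mul_pos (abs_pos.2 hf) (Real.exp_pos (c * (t - 0)))
  linarith

lemma linear_eq_zero {f b : ℝ → ℝ} {c : ℝ}
    (h : ∀ t ∈ Ici (0 : ℝ), HasDerivWithinAt f (b t * f t) (Ici 0) t)
    (h0 : ∀ t ∈ Ici (0 : ℝ), b t ≤ c) (hf : f 0 = 0) : ∀ t ∈ Ici (0 : ℝ), f t = 0 := by
  intro t ht
  have h2 := abs_le_mul_exp_of_linear h h0 ht
  rw [hf, abs_zero, zero_mul] at h2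
  exact abs_nonpos_iff.1 h2

/-- A nonnegative solution of `s' = b s²` with `b ≥ c > 0` is unbounded unless it vanishes. -/
lemma nonpos_of_quadratic_growth {s b : ℝ → ℝ} {c M : ℝ} (hc : 0 < c)
    (h : ∀ t ∈ Ici (0 : ℝ), HasDerivWithinAt s (b t * s t ^ 2) (Ici 0) t)
    (hb : ∀ t ∈ Ici (0 : ℝ), c ≤ b t) (hM : ∀ t ∈ Ici (0 : ℝ), |s t| ≤ M) : s 0 ≤ 0 := by
  by_contra! hcon
  have hmono : ∀ t ∈ Ici (0 : ℝ), s 0 ≤ s t := fun t ht =>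
    monotoneOn_Ici_of_hasDerivWithinAt h
      (fun t ht => mul_nonneg (hc.le.trans (hb t ht)) (sq_nonneg _)) self_mem_Ici ht ht
  -- Once s 0 > 0 the solution is nondecreasing, so s' = (b s) s is a linear equation with
  -- coefficient at least c s(0) > 0.
  have := eq_zero_of_linear_of_bounded (b := fun t => b t * s t) (mul_pos hc hcon)
    (fun t ht => (h t ht).congr_deriv (by ring))
    (fun t ht => mul_le_mul (hb t ht) (hmono t ht) hcon.le (hc.le.trans (hb t ht))) hM
  linarith

end NodeTools

/-! ### Saddle-nodes on the x-axis: estimates and explicit orbits -/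

section SaddleNode

variable {μ ε δ : ℝ}

lemma x_node_bounds (hε : ε ^ 2 = 1) (hδ0 : 0 < δ) (hδ : δ ≤ 1 / 4) (hμδ : |μ| * δ ≤ 1 / 4)
    {x y z : ℝ} (h : (x - ε) ^ 2 + y ^ 2 + z ^ 2 < δ ^ 2) :
    3 / 4 ≤ ε * x ∧ ε * x ≤ 5 / 4 ∧ 9 / 16 ≤ x ^ 2 ∧ x ^ 2 ≤ 25 / 16 ∧ y ^ 2 ≤ 1 / 16 ∧ |z| ≤ 1 ∧
      |μ / 2 * x * z| ≤ 1 / 4 ∧ |x - ε| ≤ 1 / 4 := by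
  have hw : |x - ε| ≤ δ := abs_le_of_sq_le_sq (by nlinarith [sq_nonneg y, sq_nonneg z]) hδ0.le
  have hz : |z| ≤ δ := abs_le_of_sq_le_sq (by nlinarith [sq_nonneg y, sq_nonneg (x - ε)]) hδ0.le
  have hε1 : |ε| = 1 :=
    (pow_eq_one_iff_of_nonneg (abs_nonneg ε) two_ne_zero).1 (by rw [sq_abs, hε])
  have h1 : ε * x = 1 + ε * (x - ε) := by linear_combination hε
  have h2 : |ε * (x - ε)| ≤ 1 / 4 := by rw [abs_mul, hε1, one_mul]; linarith
  have h3 := abs_le.1 h2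
  have h4 : x ^ 2 = (ε * x) ^ 2 := by rw [mul_pow, hε, one_mul]
  have h5 : |x| ≤ 5 / 4 := by
    have : |ε * x| = |x| := by rw [abs_mul, hε1, one_mul]
    rw [← this, abs_le]
    constructor <;> linarith [h3.1, h3.2]
  refine ⟨by linarith [h3.1], by linarith [h3.2], by nlinarith, by nlinarith,
    by nlinarith [sq_nonneg (x - ε), sq_nonneg z], by linarith, ?_, by linarith⟩
  rw [abs_mul, abs_mul, abs_div, abs_two]
  calc |μ| / 2 * |x| * |z| ≤ |μ| / 2 * (5 / 4) * δ := by gcongr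
    _ ≤ 1 / 4 := by nlinarith

/-- Lyapunov estimate for the reversed field at the nodes on the `x`-axis. -/
lemma x_node_lyapunov (hε : ε ^ 2 = 1) (hδ0 : 0 < δ) (hδ : δ ≤ 1 / 4) (hμδ : |μ| * δ ≤ 1 / 4)
    {x y z : ℝ} (h : (x - ε) ^ 2 + y ^ 2 + z ^ 2 < δ ^ 2) (hz : ε * z ≤ 0) :
    2 * ((x - ε) * (2 * x * (1 - x ^ 2) + y ^ 2 * (x - μ / 2 * z)) -
      y ^ 2 * (1 - μ / 2 * x * z + 2 * x ^ 2 - y ^ 2) + x * z ^ 3) ≤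
      -(x - ε) ^ 2 - y ^ 2 + 2 * (3 / 4 * (ε * z) * z ^ 2) := by
  obtain ⟨h1, h2, h3, h4, h5, h6, h7, h8⟩ := x_node_bounds hε hδ0 hδ hμδ h
  -- Modulo ε² = 1 the radial term is a multiple of (x - ε)², and x² + εx ≥ 1 near the node.
  have e1 : (x - ε) * (2 * x * (1 - x ^ 2)) = -2 * (x ^ 2 + ε * x) * (x - ε) ^ 2 := by
    linear_combination (-2 * x ^ 2 + 2 * ε * x) * hε
  have hzδ : |μ / 2 * z| ≤ 1 / 8 := by
    have hz : |z| ≤ δ := abs_le_of_sq_le_sq (by nlinarith [sq_nonneg y, sq_nonneg (x - ε)]) hδ0.le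
    rw [abs_mul, abs_div, abs_two]
    calc |μ| / 2 * |z| ≤ |μ| / 2 * δ := by gcongr
      _ ≤ 1 / 8 := by linarith
  have hx : |x| ≤ 5 / 4 := abs_le_of_sq_le_sq (by linarith) (by norm_num)
  have e2 : (x - ε) * (x - μ / 2 * z) ≤ 1 / 2 := by
    have h9 : |x - μ / 2 * z| ≤ 11 / 8 := by
      refine (abs_sub _ _).trans ?_
      linarith
    calc (x - ε) * (x - μ / 2 * z) ≤ |(x - ε) * (x - μ / 2 * z)| := le_abs_self _
      _ = |x - ε| * |x - μ / 2 * z| := abs_mul _ _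
      _ ≤ 1 / 4 * (11 / 8) := by gcongr
      _ ≤ 1 / 2 := by norm_num
  -- The only term without a contracting factor is x z³, and the half-space εz ≤ 0 is where it has
  -- the right sign.
  have e3 : x * z ^ 3 = (ε * x) * ((ε * z) * z ^ 2) := by
    linear_combination (-x * z ^ 3) * hε
  have e4 : (ε * z) * z ^ 2 ≤ 0 := mul_nonpos_of_nonpos_of_nonneg hz (sq_nonneg _)
  have e5 : (ε * x) * ((ε * z) * z ^ 2) ≤ 3 / 4 * ((ε * z) * z ^ 2) :=
    mul_le_mul_of_nonpos_right h1 e4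
  have e6 : 1 ≤ 1 - μ / 2 * x * z + 2 * x ^ 2 - y ^ 2 := by linarith [le_of_abs_le h7]
  have e7 := mul_le_mul_of_nonneg_right e6 (sq_nonneg y)
  have e8 := mul_le_mul_of_nonneg_right e2 (sq_nonneg y)
  have e9 : 1 * (x - ε) ^ 2 ≤ (x ^ 2 + ε * x) * (x - ε) ^ 2 :=
    mul_le_mul_of_nonneg_right (by linarith) (sq_nonneg _)
  nlinarith

/-- The squared distance to the point `(ε, 0, 0)`. -/
def xDistSq (ε : ℝ) (q : Phase3) : ℝ := (q 0 - ε) ^ 2 + q 1 ^ 2 + q 2 ^ 2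

lemma abs_lt_of_xDistSq (hδ0 : 0 < δ) {q : Phase3} (h : xDistSq ε q < δ ^ 2) :
    |q 0 - ε| < δ ∧ |q 1| < δ ∧ |q 2| < δ := by
  unfold xDistSq at h
  refine ⟨?_, ?_, ?_⟩ <;> refine abs_lt_of_sq_lt_sq ?_ hδ0.le <;>
    nlinarith [sq_nonneg (q 0 - ε), sq_nonneg (q 1), sq_nonneg (q 2)]

/-- On the line x = ε, y = 0 the field reduces to z' = -εz². The condition 0 ≤ κs keeps the
denominator positive for all forward time; κ = 1 and κ = -1 give the two time directions. -/
lemma isForwardSolution_center (hε : ε ^ 2 = 1) {κ s : ℝ} (hs : 0 ≤ κ * s) :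
    IsForwardSolution (κ • powerLawField μ) !₂[ε, 0, ε * s]
      (fun t => !₂[ε, 0, ε * s / (1 + κ * s * t)]) := by
  refine ⟨by simp, fun t ht => hasDerivWithinAt_euclidean fun i => ?_⟩
  have hpos : (1 + κ * s * t) ≠ 0 := by
    have := mul_nonneg hs (show (0 : ℝ) ≤ t from ht)
    positivity
  fin_cases i
  · refine (hasDerivWithinAt_const t _ ε).congr_deriv ?_
    simp only [Fin.zero_eta, Pi.smul_apply, PiLp.smul_apply, powerLawField_apply_zero]
    simp
    right
    linear_combination 2 * ε * hε
  · refine (hasDerivWithinAt_const t _ (0 : ℝ)).congr_deriv ?_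
    simp only [Fin.mk_one, Pi.smul_apply, PiLp.smul_apply, powerLawField_apply_one]
    simp
  · have h1 : HasDerivAt (fun t => 1 + κ * s * t) (κ * s) t := by
      simpa using ((hasDerivAt_id t).const_mul (κ * s)).const_add 1
    refine (((hasDerivAt_const t (ε * s)).div h1 hpos).hasDerivWithinAt).congr_deriv ?_
    simp only [Fin.reduceFinMk, Pi.smul_apply, PiLp.smul_apply, powerLawField_apply_two]
    simp
    generalize 1 + κ * s * t = D
    linear_combination (s ^ 2 * κ * ε / D ^ 2) * hε

lemma tendsto_center {κ s : ℝ} (hκ : κ ≠ 0) (hs : 0 ≤ κ * s) :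
    Tendsto (fun t : ℝ => (!₂[ε, 0, ε * s / (1 + κ * s * t)] : Phase3)) atTop
      (𝓝 !₂[ε, 0, 0]) := by
  refine tendsto_euclidean fun i => ?_
  fin_cases i
  · exact tendsto_const_nhds
  · exact tendsto_const_nhds
  · rcases hs.eq_or_lt with h0 | h0
    · have : s = 0 := (mul_eq_zero.1 h0.symm).resolve_left hκ
      simp [this]
    · have h1 : Tendsto (fun t : ℝ => 1 + κ * s * t) atTop atTop :=
        tendsto_atTop_add_const_left _ _ (tendsto_id.const_mul_atTop h0)
      exact h1.const_div_atTop _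

end SaddleNode

/-! ### Saddle-nodes on the x-axis: the phase portrait -/

section SaddleNode

variable {μ ε δ : ℝ}

lemma continuous_xDistSq : Continuous (xDistSq ε) := by
  unfold xDistSq
  fun_prop

/-- A trajectory which stays near `(ε, 0, 0)` in forward time starts on the line `x = ε`,
`y = 0`. -/
lemma forward_staying_x_node (hε : ε ^ 2 = 1) (hδ0 : 0 < δ) (hδ : δ ≤ 1 / 4)
    (hμδ : |μ| * δ ≤ 1 / 4) {q : Phase3} {γ : ℝ → Phase3}
    (hγ : IsForwardSolution (powerLawField μ) q γ)
    (hU : ∀ t, 0 ≤ t → xDistSq ε (γ t) < δ ^ 2) : q 0 = ε ∧ q 1 = 0 := by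
  have hd := hγ.hasDerivWithinAt_smul
  have hb := fun t ht => x_node_bounds hε hδ0 hδ hμδ (hU t ht)
  -- Both y and the curvature solve linear equations with coefficient at least 1 near the node;
  -- being bounded they vanish, and then x² = 1.
  have hy : γ 0 1 = 0 := by
    refine eq_zero_of_linear_of_bounded (a := 0) (f := fun t => γ t 1) one_pos (M := 1)
      (fun t ht => hasDerivWithinAt_y (hd t ht)) (fun t ht => ?_) (fun t ht => ?_)
    · obtain ⟨-, -, h3, -, h5, -, h7, -⟩ := hb t ht
      linarith [le_of_abs_le h7]
    · obtain ⟨-, -, h3, -, h5, -, h7, -⟩ := hb t ht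
      exact abs_le_of_sq_le_sq (by linarith) zero_le_one
  have hu : curvature (γ 0) = 0 := by
    refine eq_zero_of_linear_of_bounded (a := 0) (f := fun t => curvature (γ t)) one_pos (M := 2)
      (fun t ht => hasDerivWithinAt_curvature (hd t ht)) (fun t ht => ?_) (fun t ht => ?_)
    · obtain ⟨-, -, h3, -, h5, -, h7, -⟩ := hb t ht
      linarith
    · obtain ⟨-, -, h3, h4, h5, -, h7, -⟩ := hb t ht
      unfold curvature
      rw [abs_le]
      constructor <;> nlinarith [sq_nonneg (γ t 1)]
  obtain ⟨-, -, -, -, -, -, -, h8⟩ := hb 0 le_rfl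
  rw [hγ.1] at hy hu h8
  refine ⟨eq_of_sq_eq_of_abs_sub_lt hε ?_ (by linarith), hy⟩
  unfold curvature at hu
  rw [hy] at hu
  linarith

/-- Applied to every later point, the preceding lemma keeps the orbit on x = ε, where s = -εz
satisfies s' = s² and would blow up if positive. -/
lemma forward_staying_x_node_sign (hε : ε ^ 2 = 1) (hδ0 : 0 < δ) (hδ : δ ≤ 1 / 4)
    (hμδ : |μ| * δ ≤ 1 / 4) {q : Phase3} {γ : ℝ → Phase3}
    (hγ : IsForwardSolution (powerLawField μ) q γ)
    (hU : ∀ t, 0 ≤ t → xDistSq ε (γ t) < δ ^ 2) : 0 ≤ ε * q 2 := by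
  have hd := hγ.hasDerivWithinAt_smul
  have hx : ∀ t, 0 ≤ t → γ t 0 = ε := fun t ht =>
    (forward_staying_x_node hε hδ0 hδ hμδ (hγ.shift ht)
      fun r hr => hU _ (add_nonneg hr ht)).1
  have := nonpos_of_quadratic_growth (s := fun t => -(ε * γ t 2)) (b := fun _ => 1) (M := δ)
    one_pos (fun t ht => ((hasDerivWithinAt_z (hd t ht)).const_mul ε).neg.congr_deriv (by
      rw [hx t ht]; ring)) (fun _ _ => le_rfl) (fun t ht => by
      have hε1 : |ε| = 1 :=
        (pow_eq_one_iff_of_nonneg (abs_nonneg ε) two_ne_zero).1 (by rw [sq_abs, hε])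
      rw [abs_neg, abs_mul, hε1, one_mul]
      exact (abs_lt_of_xDistSq hδ0 (hU t ht)).2.2.le)
  rw [hγ.1] at this
  linarith

/-- A trajectory which stays near `(ε, 0, 0)` in backward time starts in `ε z ≤ 0`. -/
lemma backward_staying_x_node_sign (hε : ε ^ 2 = 1) (hδ0 : 0 < δ) (hδ : δ ≤ 1 / 4)
    (hμδ : |μ| * δ ≤ 1 / 4) {q : Phase3} {γ : ℝ → Phase3}
    (hγ : IsForwardSolution (-powerLawField μ) q γ)
    (hU : ∀ t, 0 ≤ t → xDistSq ε (γ t) < δ ^ 2) : ε * q 2 ≤ 0 := by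
  have hd := hγ.hasDerivWithinAt_neg_smul
  have := nonpos_of_quadratic_growth (s := fun t => ε * γ t 2) (b := fun t => ε * γ t 0) (M := δ)
    (c := 3 / 4) (by norm_num)
    (fun t ht => ((hasDerivWithinAt_z (hd t ht)).const_mul ε).congr_deriv (by
      linear_combination (-ε * γ t 0 * γ t 2 ^ 2) * hε))
    (fun t ht => (x_node_bounds hε hδ0 hδ hμδ (hU t ht)).1) (fun t ht => by
      have hε1 : |ε| = 1 :=
        (pow_eq_one_iff_of_nonneg (abs_nonneg ε) two_ne_zero).1 (by rw [sq_abs, hε])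
      rw [abs_mul, hε1, one_mul]
      exact (abs_lt_of_xDistSq hδ0 (hU t ht)).2.2.le)
  rwa [hγ.1] at this

/-- Backward in time y and the curvature decay exponentially, while (z²)' = 2xz³ is negative off z =
0 because εz ≤ 0 along the whole orbit. Then x is recovered from its square and its sign. -/
lemma tendsto_backward_x_node (hε : ε ^ 2 = 1) (hδ0 : 0 < δ) (hδ : δ ≤ 1 / 4)
    (hμδ : |μ| * δ ≤ 1 / 4) {q : Phase3} {γ : ℝ → Phase3}
    (hγ : IsForwardSolution (-powerLawField μ) q γ)
    (hU : ∀ t, 0 ≤ t → xDistSq ε (γ t) < δ ^ 2) : Tendsto γ atTop (𝓝 !₂[ε, 0, 0]) := by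
  have hd := hγ.hasDerivWithinAt_neg_smul
  have hb := fun t ht => x_node_bounds hε hδ0 hδ hμδ (hU t ht)
  have hs : ∀ t, 0 ≤ t → ε * γ t 2 ≤ 0 := fun t ht =>
    backward_staying_x_node_sign hε hδ0 hδ hμδ (hγ.shift ht) fun r hr => hU _ (add_nonneg hr ht)
  have hy : Tendsto (fun t => γ t 1) atTop (𝓝 0) := by
    refine tendsto_zero_of_linear (c := -1) (by norm_num) (fun t ht => hasDerivWithinAt_y (hd t ht))
      (fun t ht => ?_)
    obtain ⟨-, -, h3, -, h5, -, h7, -⟩ := hb t ht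
    linarith [le_of_abs_le h7]
  have hu : Tendsto (fun t => curvature (γ t)) atTop (𝓝 0) := by
    refine tendsto_zero_of_linear (c := -1) (by norm_num)
      (fun t ht => hasDerivWithinAt_curvature (hd t ht)) (fun t ht => ?_)
    obtain ⟨-, -, h3, -, h5, -, h7, -⟩ := hb t ht
    linarith
  have hz2 : Tendsto (fun t => γ t 2 ^ 2) atTop (𝓝 0) := by
    have key : ∀ t, 0 ≤ t → 2 * (γ t 0 * γ t 2 ^ 3) ≤ 2 * (3 / 4 * (ε * γ t 2) * γ t 2 ^ 2) := by
      intro t ht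
      have e3 : γ t 0 * γ t 2 ^ 3 = (ε * γ t 0) * ((ε * γ t 2) * γ t 2 ^ 2) := by
        linear_combination (-γ t 0 * γ t 2 ^ 3) * hε
      have e4 := mul_le_mul_of_nonpos_right (hb t ht).1
        (mul_nonpos_of_nonpos_of_nonneg (hs t ht) (sq_nonneg (γ t 2)))
      rw [e3]
      linarith
    refine tendsto_zero_of_strict_decay (a := 0) (f' := fun t => 2 * (γ t 0 * γ t 2 ^ 3))
      (fun t ht => ((hasDerivWithinAt_z (hd t ht)).pow 2).congr_deriv (by push_cast; ring))
      (fun t _ => sq_nonneg _)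
      (fun t ht => (key t ht).trans (by nlinarith [hs t ht, sq_nonneg (γ t 2)])) (fun c hc => ?_)
    refine ⟨√c * c, by positivity, fun t ht hct => (key t ht).trans ?_⟩
    have h1 : √c ≤ -(ε * γ t 2) := by
      rw [Real.sqrt_le_left (by linarith [hs t ht]), neg_sq, mul_pow, hε, one_mul]
      exact hct
    have h2 : √c * c ≤ -(ε * γ t 2) * γ t 2 ^ 2 :=
      mul_le_mul h1 hct hc.le ((Real.sqrt_nonneg c).trans h1)
    nlinarith [Real.sqrt_nonneg c]
  refine tendsto_euclidean fun i => ?_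
  fin_cases i
  · refine tendsto_of_tendsto_sq hε ?_ ?_
    · have := (tendsto_const_nhds (x := (1 : ℝ))).sub (hu.add (hy.pow 2))
      simpa [curvature] using this
    · filter_upwards [eventually_ge_atTop 0] with t ht
      have := (hb t ht).1
      show 0 < ε * γ t 0
      linarith
  · exact hy
  · have := (Real.continuous_sqrt.tendsto 0).comp hz2
    rw [Real.sqrt_zero] at this
    simp only [Function.comp_def, Real.sqrt_sq_eq_abs] at this
    exact (tendsto_zero_iff_abs_tendsto_zero _).2 this

lemma exists_backward_x_node (hε : ε ^ 2 = 1) (hδ0 : 0 < δ) (hδ : δ ≤ 1 / 4)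
    (hμδ : |μ| * δ ≤ 1 / 4) {q : Phase3} (hq : xDistSq ε q < δ ^ 2) (hqz : ε * q 2 ≤ 0) :
    ∃ γ : ℝ → Phase3, IsForwardSolution (-powerLawField μ) q γ ∧
      ∀ t, 0 ≤ t → xDistSq ε (γ t) < δ ^ 2 := by
  -- At the equilibrium itself the sublevel set is a point and the strict boundary inequality fails,
  -- so this case is separate.
  by_cases hq0 : xDistSq ε q = 0
  · have hqp : q = !₂[ε, 0, 0] := by
      unfold xDistSq at hq0
      refine phase3_ext ?_ ?_ ?_ <;> simp <;>
        nlinarith [sq_nonneg (q 0 - ε), sq_nonneg (q 1), sq_nonneg (q 2)]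
    refine ⟨fun _ => q, isForwardSolution_const ?_, fun _ _ => hq⟩
    rw [hqp, Pi.neg_apply, powerLawField_eq_zero_of_x hε, neg_zero]
  have hpos : 0 < xDistSq ε q := by
    refine lt_of_le_of_ne ?_ (Ne.symm hq0)
    unfold xDistSq
    positivity
  suffices h : ∃ γ, IsForwardSolution (-powerLawField μ) q γ ∧
      ∀ t, 0 ≤ t → γ t ∈ {q | ε * q 2 ≤ 0} ∧ xDistSq ε (γ t) ≤ xDistSq ε q by
    obtain ⟨γ, hγ, hγC⟩ := h
    exact ⟨γ, hγ, fun t ht => (hγC t ht).2.trans_lt hq⟩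
  refine exists_isForwardSolution_of_barrier (F := -powerLawField μ)
    contDiff_powerLawField.neg (V := xDistSq ε) (c := xDistSq ε q) (C := {q | ε * q 2 ≤ 0})
    (V' := fun q => 2 * ((q 0 - ε) * (2 * q 0 * (1 - q 0 ^ 2) + q 1 ^ 2 * (q 0 - μ / 2 * q 2)) -
      q 1 ^ 2 * (1 - μ / 2 * q 0 * q 2 + 2 * q 0 ^ 2 - q 1 ^ 2) + q 0 * q 2 ^ 3))
    ?_ ?_ ?_ ?_ hqz le_rfl
  · intro γ t χ h
    have h' : HasDerivWithinAt γ ((-χ) • powerLawField μ (γ t)) univ t := by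
      rw [neg_smul, ← smul_neg]; exact h.hasDerivWithinAt
    rw [← hasDerivWithinAt_univ]
    refine (((((hasDerivWithinAt_x h').sub_const ε).pow 2).add ((hasDerivWithinAt_y h').pow 2)).add
      ((hasDerivWithinAt_z h').pow 2)).congr_deriv ?_
    push_cast
    ring
  · refine isBounded_of_abs_apply_le (M := 2) fun q' hq' i => ?_
    have h1 := abs_lt_of_xDistSq hδ0 (hq'.2.trans_lt hq)
    have hε1 : |ε| = 1 :=
      (pow_eq_one_iff_of_nonneg (abs_nonneg ε) two_ne_zero).1 (by rw [sq_abs, hε])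
    have h2 : |q' 0| ≤ |q' 0 - ε| + |ε| := by simpa using abs_add_le (q' 0 - ε) ε
    fin_cases i <;> simp only [Fin.zero_eta, Fin.mk_one, Fin.reduceFinMk] <;> linarith
  · intro χ γ hχ hγ h0 t ht
    have hc : Continuous fun t => χ (γ t) * (γ t 0 * γ t 2) := by
      have := hγ.continuous
      fun_prop
    have := eq_mul_exp_of_linear (f := fun t => γ t 2) hc (fun t => by
      have h' : HasDerivWithinAt γ ((-χ (γ t)) • powerLawField μ (γ t)) univ t := by
        rw [neg_smul, ← smul_neg]; exact (hγ t).hasDerivWithinAt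
      have := hasDerivWithinAt_z h'
      rw [hasDerivWithinAt_univ] at this
      exact this.congr_deriv (by ring)) t
    simp only at this
    rw [mem_ofPred_eq, this, ← mul_assoc]
    exact mul_nonpos_of_nonpos_of_nonneg h0 (Real.exp_pos _).le
  · intro q' hq' hqe
    have h1 := x_node_lyapunov (μ := μ) hε hδ0 hδ hμδ (show _ < _ from hqe.trans_lt hq) hq'
    refine lt_of_le_of_lt h1 ?_
    -- Equality in the Lyapunov estimate would force x = ε, y = 0 and z = 0, which the positive
    -- level excludes.
    by_contra! hcon
    have hz3 : 0 ≤ -((ε * q' 2) * q' 2 ^ 2) := by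
      have := mul_nonpos_of_nonpos_of_nonneg (show ε * q' 2 ≤ 0 from hq') (sq_nonneg (q' 2))
      linarith
    have hx := sq_nonneg (q' 0 - ε)
    have hy := sq_nonneg (q' 1)
    have hz0 : (ε * q' 2) * q' 2 ^ 2 = 0 := by linarith
    have hz : q' 2 ^ 2 = 0 := by
      have h3 : q' 2 ^ 3 = 0 := by linear_combination ε * hz0 - q' 2 ^ 3 * hε
      rw [pow_eq_zero_iff three_ne_zero] at h3
      rw [h3]; ring
    have : xDistSq ε q' = 0 := by
      unfold xDistSq
      linarith
    linarith

lemma exists_solution_center (hε : ε ^ 2 = 1) {κ : ℝ} (hκ : κ ≠ 0) {q : Phase3}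
    (hq : xDistSq ε q < δ ^ 2) (h0 : q 0 = ε) (h1 : q 1 = 0) (h2 : 0 ≤ κ * (ε * q 2)) :
    ∃ γ : ℝ → Phase3, IsForwardSolution (κ • powerLawField μ) q γ ∧
      (∀ t, 0 ≤ t → xDistSq ε (γ t) < δ ^ 2) ∧ Tendsto γ atTop (𝓝 !₂[ε, 0, 0]) ∧
      ∀ t, 0 ≤ t → ∃ r, 0 ≤ κ * r ∧ γ t = !₂[ε, 0, ε * r] := by
  have hqe : q = !₂[ε, 0, ε * (ε * q 2)] :=
    phase3_ext (by simp [h0]) (by simp [h1]) (by simp; linear_combination -q 2 * hε)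
  refine ⟨_, by convert isForwardSolution_center hε h2, fun t ht => ?_, tendsto_center hκ h2,
    fun t ht => ⟨ε * q 2 / (1 + κ * (ε * q 2) * t), ?_, by rw [mul_div_assoc]⟩⟩
  · refine lt_of_le_of_lt ?_ hq
    rw [hqe]
    simp only [xDistSq]
    simp only [Matrix.cons_val, sub_self]
    have h3 : ε * (ε * (ε * q 2)) = ε * q 2 := by linear_combination (ε * q 2) * hε
    rw [h3, div_pow]
    gcongr
    exact div_le_self (sq_nonneg _) (one_le_pow₀ (by linarith [mul_nonneg h2 ht]))
  · rw [← mul_div_assoc]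
    have := mul_nonneg h2 ht
    positivity

lemma localStableSet_subset_stayingSet {E : Type*} [NormedAddCommGroup E] [NormedSpace ℝ E]
    {F : E → E} {U : Set E} {p : E} : localStableSet F U p ⊆ stayingSet F U :=
  fun _ ⟨γ, hγ, hγU, _⟩ => ⟨γ, hγ, hγU⟩

/-- The centre curve is the invariant line x = ε, y = 0 and the hypersurface the invariant plane z =
0, so g and k are zero and a Euclidean ball serves as U. With c = (0,0,ε) the parameter is s = εz.
-/
theorem isRepellingSaddleNode_powerLawField (hε : ε ^ 2 = 1) :
    IsRepellingSaddleNode (powerLawField μ) !₂[ε, 0, 0]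
      (Submodule.span ℝ {!₂[1, 0, 0], !₂[0, 1, 0]}) !₂[0, 0, ε] := by
  have hε0 : ε ≠ 0 := by rintro rfl; norm_num at hε
  refine ⟨powerLawField_eq_zero_of_x hε, span_xy_ne_bot, ?_, isCompl_span_xy (by simpa using hε0),
    ?_, ?_, ?_⟩
  · intro h
    have := congrArg (fun v : Phase3 => v 2) h
    simp [hε0] at this
  · intro v _
    rw [mem_span_xy, fderiv_powerLawField]
    simp
  · rw [fderiv_powerLawField]
    refine phase3_ext ?_ ?_ ?_ <;> simp
  intro V hV
  obtain ⟨r, hr, hrV⟩ := exists_box_subset hV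
  set δ := min (min r (1 / 4)) (1 / (4 * (|μ| + 1))) with hδdef
  have hδ0 : 0 < δ := lt_min (lt_min hr (by norm_num)) (by positivity)
  have hδ : δ ≤ 1 / 4 := (min_le_left _ _).trans (min_le_right _ _)
  have hδr : δ ≤ r := (min_le_left _ _).trans (min_le_left _ _)
  have hμδ : |μ| * δ ≤ 1 / 4 := by
    have h1 : δ ≤ 1 / (4 * (|μ| + 1)) := min_le_right _ _
    rw [le_div_iff₀ (by positivity)] at h1
    nlinarith
  refine ⟨{q | xDistSq ε q < δ ^ 2}, fun q hq => hrV q fun i => ?_,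
    isOpen_lt continuous_xDistSq continuous_const, ?_, fun _ => 0, fun _ => 0, contDiff_const, rfl,
    by simp, contDiff_const, rfl, by simp, ?_⟩
  · have := abs_lt_of_xDistSq hδ0 hq
    fin_cases i <;> simp <;> linarith
  · simp [xDistSq]
    positivity
  have hsub1 : stayingSet (powerLawField μ) {q | xDistSq ε q < δ ^ 2} ⊆
      {q | xDistSq ε q < δ ^ 2 ∧ q 0 = ε ∧ q 1 = 0 ∧ 0 ≤ ε * q 2} := by
    rintro q ⟨γ, hγ, hγU⟩
    have h1 := forward_staying_x_node hε hδ0 hδ hμδ hγ hγU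
    refine ⟨?_, h1.1, h1.2, forward_staying_x_node_sign hε hδ0 hδ hμδ hγ hγU⟩
    rw [← hγ.1]
    exact hγU 0 le_rfl
  have hsub2 : {q | xDistSq ε q < δ ^ 2 ∧ q 0 = ε ∧ q 1 = 0 ∧ 0 ≤ ε * q 2} ⊆
      localStableSet (powerLawField μ) {q | xDistSq ε q < δ ^ 2} !₂[ε, 0, 0] := by
    rintro q ⟨hqU, h0, h1, h2⟩
    obtain ⟨γ, hγ, hγU, hγp, -⟩ := exists_solution_center (κ := 1) hε one_ne_zero hqU h0 h1 (by simpa)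
    rw [one_smul] at hγ
    exact ⟨γ, hγ, hγU, hγp⟩
  have hset1 : {q | xDistSq ε q < δ ^ 2 ∧ q 0 = ε ∧ q 1 = 0 ∧ 0 ≤ ε * q 2} =
      {q : Phase3 | q ∈ {q | xDistSq ε q < δ ^ 2} ∧ ∃ s : ℝ, 0 ≤ s ∧
        q = !₂[ε, 0, 0] + s • !₂[0, 0, ε] +
          (((0 : Submodule.span ℝ {(!₂[1, 0, 0] : Phase3), !₂[0, 1, 0]})) : Phase3)} := by
    ext q
    refine and_congr_right fun _ => ⟨fun ⟨h0, h1, h2⟩ => ⟨ε * q 2, h2, ?_⟩, ?_⟩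
    · refine phase3_ext (by simp [h0]) (by simp [h1]) ?_
      simp
      linear_combination -q 2 * hε
    · rintro ⟨s, hs, rfl⟩
      refine ⟨by simp, by simp, ?_⟩
      simp
      nlinarith
  have hsub3 : stayingSet (-powerLawField μ) {q | xDistSq ε q < δ ^ 2} ⊆
      localStableSet (-powerLawField μ) {q | xDistSq ε q < δ ^ 2} !₂[ε, 0, 0] :=
    fun q ⟨γ, hγ, hγU⟩ => ⟨γ, hγ, hγU, tendsto_backward_x_node hε hδ0 hδ hμδ hγ hγU⟩
  refine ⟨(hsub1.trans hsub2).antisymm localStableSet_subset_stayingSet, ?_,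
    hsub3.antisymm localStableSet_subset_stayingSet, ?_, ?_⟩
  · rw [← hset1]
    exact hsub1.antisymm (hsub2.trans localStableSet_subset_stayingSet)
  · ext q
    constructor
    · rintro ⟨γ, hγ, hγU⟩
      refine ⟨?_, ⟨q - !₂[ε, 0, q 2], mem_span_xy.2 (by simp)⟩, ε * q 2,
        backward_staying_x_node_sign hε hδ0 hδ hμδ hγ hγU, ?_⟩
      · rw [← hγ.1]
        exact hγU 0 le_rfl
      · refine phase3_ext (by simp) (by simp) ?_
        simp
        linear_combination -q 2 * hε
    · rintro ⟨hqU, ⟨h, hh⟩, s, hs, rfl⟩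
      refine exists_backward_x_node hε hδ0 hδ hμδ hqU ?_
      rw [mem_span_xy] at hh
      simp [hh]
      nlinarith
  · rintro q ⟨hqU, s, hs, rfl⟩
    obtain ⟨γ, hγ, hγU, -, hγ2⟩ := exists_solution_center (μ := μ) (κ := -1) hε (by norm_num) hqU
      (by simp) (by simp) (by
        simp
        nlinarith)
    rw [neg_one_smul] at hγ
    refine ⟨γ, hγ, fun t ht => ⟨hγU t ht, ?_⟩⟩
    obtain ⟨r, hr, hr2⟩ := hγ2 t ht
    exact ⟨r, by linarith, by rw [hr2]; refine phase3_ext ?_ ?_ ?_ <;> simp [mul_comm]⟩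

end SaddleNode

/-! ### Unstable nodes in the plane z = 0 -/

section PlanarNode

variable {μ ε δ : ℝ}

/-- The quotient of two solutions of homogeneous linear equations. -/
lemma hasDerivWithinAt_div_of_linear {f g a b : ℝ → ℝ} {s : Set ℝ} {t : ℝ}
    (hf : HasDerivWithinAt f (a t * f t) s t) (hg : HasDerivWithinAt g (b t * g t) s t)
    (hne : g t ≠ 0) : HasDerivWithinAt (fun t => f t / g t) ((a t - b t) * (f t / g t)) s t :=
  (hf.div hg hne).congr_deriv (by field_simp)

/-- Eventual behaviour of the backward trajectories in the plane `z = 0` near `(ε, 0, 0)`. -/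
lemma exists_direction_planar (hε : ε ^ 2 = 1) (hδ0 : 0 < δ) (hδ : δ ≤ 1 / 4)
    (hμδ : |μ| * δ ≤ 1 / 4) {q : Phase3} {γ : ℝ → Phase3}
    (hγ : IsForwardSolution (-powerLawField μ) q γ)
    (hU : ∀ t, 0 ≤ t → xDistSq ε (γ t) < δ ^ 2) (hz : ∀ t, 0 ≤ t → γ t 2 = 0)
    (hq : ¬(q 0 = ε ∧ q 1 = 0)) :
    ∃ (m : ℝ → ℝ) (a b : ℝ), ContinuousOn m (Ici 0) ∧ (∀ t ∈ Ici (0 : ℝ), m t ≠ 0) ∧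
      (∀ t, 0 ≤ t → γ t 0 = ε → γ t 1 = 0 → m t = 0) ∧ (a ≠ 0 ∨ b ≠ 0) ∧
      Tendsto (fun t => (m t)⁻¹ * (γ t 0 - ε)) atTop (𝓝 a) ∧
      Tendsto (fun t => (m t)⁻¹ * γ t 1) atTop (𝓝 b) := by
  have hε0 : ε ≠ 0 := by rintro rfl; norm_num at hε
  have hd := hγ.hasDerivWithinAt_neg_smul
  have hb := fun t ht => x_node_bounds hε hδ0 hδ hμδ (hU t ht)
  have hlim := tendsto_backward_x_node hε hδ0 hδ hμδ hγ hU
  have hxε : ∀ t, 0 ≤ t → γ t 0 + ε ≠ 0 := by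
    intro t ht h0
    have h1 := (hb t ht).1
    have h2 : ε * γ t 0 = -1 := by linear_combination ε * h0 - hε
    linarith
  have hx : Tendsto (fun t => (γ t 0 + ε)⁻¹) atTop (𝓝 (ε + ε)⁻¹) :=
    ((tendsto_euclidean_apply hlim 0).add_const ε).inv₀ (by
      simpa using hε0)
  have hy : Tendsto (fun t => γ t 1) atTop (𝓝 0) := tendsto_euclidean_apply hlim 1
  have hxu : ∀ t, 0 ≤ t → γ t 0 - ε = -(curvature (γ t) + γ t 1 ^ 2) * (γ t 0 + ε)⁻¹ := by
    intro t ht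
    rw [← div_eq_mul_inv, eq_div_iff (hxε t ht)]
    unfold curvature
    linear_combination -hε
  have hdy : ∀ t ∈ Ici (0 : ℝ), HasDerivWithinAt (fun t => γ t 1)
      (-(1 + 2 * γ t 0 ^ 2 - γ t 1 ^ 2) * γ t 1) (Ici 0) t := fun t ht =>
    (hasDerivWithinAt_y (hd t ht)).congr_deriv (by rw [hz t ht]; ring)
  have hdu : ∀ t ∈ Ici (0 : ℝ), HasDerivWithinAt (fun t => curvature (γ t))
      (-(4 * γ t 0 ^ 2 - 2 * γ t 1 ^ 2) * curvature (γ t)) (Ici 0) t := fun t ht =>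
    (hasDerivWithinAt_curvature (hd t ht)).congr_deriv (by ring)
  -- In reversed time y decays like exp(-3t) and the curvature like exp(-4t) to first order. The
  -- slower y fixes the direction unless it vanishes identically, in which case the curvature does.
  by_cases hy0 : γ 0 1 = 0
  · have hy1 : ∀ t, 0 ≤ t → γ t 1 = 0 := fun t ht =>
      linear_eq_zero (c := 0) hdy (fun t ht => by
        obtain ⟨-, -, h3, -, h5, -⟩ := hb t ht
        linarith) hy0 t ht
    have hu1 : ∀ t ∈ Ici (0 : ℝ), curvature (γ t) ≠ 0 := by
      refine linear_ne_zero (c := -7) hdu (fun t ht => ?_) (fun h => hq ?_)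
      · obtain ⟨-, -, h3, h4, h5, -⟩ := hb t ht
        linarith [sq_nonneg (γ t 1)]
      · unfold curvature at h
        rw [hγ.1] at h hy0
        have h8 := (hb 0 le_rfl).2.2.2.2.2.2.2
        rw [hγ.1] at h8
        refine ⟨eq_of_sq_eq_of_abs_sub_lt hε ?_ (by linarith), hy0⟩
        rw [hy0] at h
        linarith
    refine ⟨fun t => curvature (γ t), -(ε + ε)⁻¹, 0,
      fun t ht => (hdu t ht).continuousWithinAt, hu1, fun t ht h1 h2 => ?_, Or.inl ?_, ?_, ?_⟩
    · simp only [curvature, h1, h2, hε]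
      ring
    · simpa using hε0
    · refine hx.neg.congr' ?_
      filter_upwards [eventually_ge_atTop 0] with t ht
      rw [hxu t ht, hy1 t ht]
      field_simp [hu1 t ht]
      ring
    · refine tendsto_const_nhds.congr' ?_
      filter_upwards [eventually_ge_atTop 0] with t ht
      rw [hy1 t ht, mul_zero]
  · have hy1 : ∀ t ∈ Ici (0 : ℝ), γ t 1 ≠ 0 := by
      refine linear_ne_zero (c := -5) hdy (fun t ht => ?_) hy0
      obtain ⟨-, -, h3, h4, h5, -⟩ := hb t ht
      linarith [sq_nonneg (γ t 1)]
    have huy : Tendsto (fun t => curvature (γ t) / γ t 1) atTop (𝓝 0) := by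
      -- The quotient has coefficient 1 - 2x² + y², at most 1 - 9/8 + 1/16.
      refine tendsto_zero_of_linear (c := -1 / 16) (by norm_num)
        (fun t ht => hasDerivWithinAt_div_of_linear
          (a := fun t => -(4 * γ t 0 ^ 2 - 2 * γ t 1 ^ 2))
          (b := fun t => -(1 + 2 * γ t 0 ^ 2 - γ t 1 ^ 2)) (hdu t ht) (hdy t ht) (hy1 t ht))
        (fun t ht => ?_)
      obtain ⟨-, -, h3, h4, h5, -⟩ := hb t ht
      linarith
    refine ⟨fun t => γ t 1, 0, 1, fun t ht => (hdy t ht).continuousWithinAt, hy1,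
      fun t ht h1 h2 => h2, Or.inr one_ne_zero, ?_, ?_⟩
    · have := (huy.add hy).neg.mul hx
      simp only [add_zero, neg_zero, zero_mul] at this
      refine this.congr' ?_
      filter_upwards [eventually_ge_atTop 0] with t ht
      rw [hxu t ht]
      field_simp [hy1 t ht]
    · refine tendsto_const_nhds.congr' ?_
      filter_upwards [eventually_ge_atTop 0] with t ht
      rw [inv_mul_cancel₀ (hy1 t ht)]

lemma dist_sq_planar (q : EuclideanSpace ℝ (Fin 2)) :
    xDistSq ε !₂[q 0, q 1, 0] = dist q !₂[ε, 0] ^ 2 := by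
  rw [EuclideanSpace.dist_eq, Real.sq_sqrt (Finset.sum_nonneg fun _ _ => sq_nonneg _)]
  simp [xDistSq, Real.dist_eq]

/-- Backward solutions of the planar system from those of the full system. -/
lemma IsForwardSolution.planar {q : Phase3} {γ : ℝ → Phase3}
    (hγ : IsForwardSolution (-powerLawField μ) q γ) (hz : ∀ t, 0 ≤ t → γ t 2 = 0) :
    IsForwardSolution (-xyPlaneField μ) !₂[q 0, q 1] (fun t => !₂[γ t 0, γ t 1]) := by
  refine ⟨by simp only [hγ.1], fun t ht => hasDerivWithinAt_euclidean fun i => ?_⟩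
  have hz0 := hz t ht
  have h3 : (!₂[γ t 0, γ t 1, 0] : Phase3) = γ t :=
    phase3_ext (by simp) (by simp) (by simp [hz0])
  fin_cases i
  · refine ((hγ.2 t ht).euclidean_apply 0).congr_deriv ?_
    simp [xyPlaneField, h3]
  · refine ((hγ.2 t ht).euclidean_apply 1).congr_deriv ?_
    simp [xyPlaneField, h3]

/-- Planar orbits are obtained by lifting the initial point to z = 0 in the full system, where the
backward existence and convergence results apply and z remains zero. -/
theorem isUnstableNode_xyPlaneField (hε : ε ^ 2 = 1) :
    IsUnstableNode (xyPlaneField μ) !₂[ε, 0] := by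
  obtain ⟨δ₀, hδ₀, hδ₀4, hδ₀μ⟩ : ∃ δ₀ > 0, δ₀ ≤ 1 / 4 ∧ |μ| * δ₀ ≤ 1 / 4 := by
    refine ⟨min (1 / 4) (1 / (4 * (|μ| + 1))), lt_min (by norm_num) (by positivity),
      min_le_left _ _, ?_⟩
    have h1 : min (1 / 4) (1 / (4 * (|μ| + 1))) ≤ 1 / (4 * (|μ| + 1)) := min_le_right _ _
    rw [le_div_iff₀ (by positivity)] at h1
    nlinarith [lt_min (show (0 : ℝ) < 1 / 4 by norm_num)
      (show 0 < 1 / (4 * (|μ| + 1)) by positivity)]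
  have hex : ∀ δ > 0, δ ≤ δ₀ → ∀ q ∈ Metric.ball (!₂[ε, 0] : EuclideanSpace ℝ (Fin 2)) δ,
      ∃ γ : ℝ → Phase3, IsForwardSolution (-powerLawField μ) !₂[q 0, q 1, 0] γ ∧
        (∀ t, 0 ≤ t → xDistSq ε (γ t) < δ ^ 2) ∧ ∀ t, 0 ≤ t → γ t 2 = 0 := by
    intro δ hδ hδδ q hq
    have hq2 : xDistSq ε !₂[q 0, q 1, 0] < δ ^ 2 := by
      rw [dist_sq_planar]
      exact pow_lt_pow_left₀ hq dist_nonneg two_ne_zero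
    have h1 : |μ| * δ ≤ 1 / 4 :=
      (mul_le_mul_of_nonneg_left hδδ (abs_nonneg _)).trans hδ₀μ
    obtain ⟨γ, hγ, hγU⟩ := exists_backward_x_node hε hδ (hδδ.trans hδ₀4) h1 hq2 (by simp)
    refine ⟨γ, hγ, hγU, fun t ht => ?_⟩
    refine linear_eq_zero (f := fun t => γ t 2) (c := 2)
      (fun t ht => hasDerivWithinAt_z (hγ.hasDerivWithinAt_neg_smul t ht)) (fun t ht => ?_)
      (by simp [hγ.1]) t ht
    obtain ⟨-, -, -, h4, -, h6, -⟩ := x_node_bounds hε hδ (hδδ.trans hδ₀4) h1 (hγU t ht)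
    have h5 : |γ t 0| ≤ 5 / 4 := abs_le_of_sq_le_sq (by linarith) (by norm_num)
    have h7 := abs_mul (γ t 0) (γ t 2)
    have h8 : |γ t 0| * |γ t 2| ≤ 5 / 4 * 1 := by gcongr
    linarith [le_abs_self (γ t 0 * γ t 2)]
  refine ⟨?_, fun ρ hρ => ⟨min ρ δ₀, lt_min hρ hδ₀, fun q hq => ?_⟩, δ₀, hδ₀, fun q hq hne => ?_⟩
  · have h3 : powerLawField μ !₂[ε, 0, 0] = 0 := powerLawField_eq_zero_of_x hε
    ext i
    fin_cases i <;> simp [xyPlaneField, h3]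
  · obtain ⟨γ, hγ, hγU, hz⟩ := hex _ (lt_min hρ hδ₀) (min_le_right _ _) q hq
    have hsol := hγ.planar hz
    refine ⟨fun t => !₂[γ t 0, γ t 1], ?_, fun t ht => ?_⟩
    · convert hsol using 1
      ext i
      fin_cases i <;> simp
    have h1 := hγU t ht
    have h3 : (!₂[γ t 0, γ t 1, 0] : Phase3) = γ t :=
      phase3_ext (by simp) (by simp) (by simp [hz t ht])
    have h2 := dist_sq_planar (ε := ε) !₂[γ t 0, γ t 1]
    simp only [Matrix.cons_val, h3] at h2
    rw [h2] at h1
    exact (lt_of_pow_lt_pow_left₀ 2 (lt_min hρ hδ₀).le h1).trans_le (min_le_left _ _)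
  · obtain ⟨γ, hγ, hγU, hz⟩ := hex _ hδ₀ le_rfl q hq
    have hlim := tendsto_backward_x_node hε hδ₀ hδ₀4 hδ₀μ hγ hγU
    obtain ⟨m, a, b, hmc, hm0, hmp, hab, ha, hb⟩ := exists_direction_planar hε hδ₀ hδ₀4 hδ₀μ hγ hγU hz
      (fun h => hne (by ext i; fin_cases i; exacts [by simpa using h.1, by simpa using h.2]))
    have hsol := hγ.planar hz
    refine ⟨fun t => !₂[γ t 0, γ t 1], ?_, tendsto_euclidean fun i => ?_, fun t ht h => ?_,
      exists_tendsto_direction (m := m) (e := !₂[a, b]) hmc hm0 (fun h => ?_)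
        (tendsto_euclidean fun i => ?_)⟩
    · convert hsol using 1
      ext i
      fin_cases i <;> simp
    · fin_cases i
      · exact tendsto_euclidean_apply hlim 0
      · exact tendsto_euclidean_apply hlim 1
    · refine hm0 t ht (hmp t ht ?_ ?_)
      · simpa using congrArg (fun v : EuclideanSpace ℝ (Fin 2) => v 0) h
      · simpa using congrArg (fun v : EuclideanSpace ℝ (Fin 2) => v 1) h
    · have h0 := congrArg (fun v : EuclideanSpace ℝ (Fin 2) => v 0) h
      have h1 := congrArg (fun v : EuclideanSpace ℝ (Fin 2) => v 1) h
      simp at h0 h1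
      rcases hab with h | h
      exacts [h h0, h h1]
    · fin_cases i
      · simpa using ha
      · simpa using hb

end PlanarNode

/-! ### Lyapunov function at the points (0, ±1, 0) -/

section NonhyperbolicNode

variable {μ ε ρ : ℝ}

/-- A Lyapunov function at the equilibria `(0, ±1, 0)`. -/
noncomputable def yDistSq (μ : ℝ) (q : Phase3) : ℝ :=
  (q 0 - μ / 6 * q 2) ^ 2 + curvature q ^ 2 + q 2 ^ 2

/-- The derivative of `yDistSq` along the field. -/
noncomputable def yDistSqDeriv (μ : ℝ) (q : Phase3) : ℝ :=
  2 * ((q 0 - μ / 6 * q 2) * (-2 * q 0 + μ / 2 * q 1 ^ 2 * q 2 - q 0 * q 1 ^ 2 + 2 * q 0 ^ 3 +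
    μ / 6 * (q 0 * q 2 ^ 2)) + (4 * q 0 ^ 2 - 2 * q 1 ^ 2) * curvature q ^ 2 - q 0 * q 2 ^ 3)

/-- `ρ` is so small that the Lyapunov estimates hold in the `ρ`-neighbourhood. -/
structure IsLyapunovRadius (μ ρ : ℝ) : Prop where
  pos : 0 < ρ
  mul_le : ρ * (1 + |μ|) ≤ 1 / 8
  sq_le : ρ ^ 2 * (μ ^ 2 / 36 - 1) ^ 2 ≤ |μ| / 6

lemma continuous_curvature : Continuous curvature := by
  unfold curvature
  fun_prop

lemma continuous_yDistSq : Continuous (yDistSq μ) := by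
  have := continuous_curvature
  unfold yDistSq
  fun_prop

lemma IsLyapunovRadius.mono {ρ' : ℝ} (h : IsLyapunovRadius μ ρ) (h0 : 0 < ρ') (hle : ρ' ≤ ρ) :
    IsLyapunovRadius μ ρ' :=
  ⟨h0, (mul_le_mul_of_nonneg_right hle (by positivity)).trans h.mul_le,
    (mul_le_mul_of_nonneg_right (pow_le_pow_left₀ h0.le hle 2) (sq_nonneg _)).trans h.sq_le⟩

lemma exists_isLyapunovRadius (hμ : μ ≠ 0) : ∃ ρ, IsLyapunovRadius μ ρ := by
  have hμ' := abs_pos.2 hμ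
  have h1 : ∀ᶠ ρ in 𝓝 (0 : ℝ), ρ * (1 + |μ|) < 1 / 8 ∧ ρ ^ 2 * (μ ^ 2 / 36 - 1) ^ 2 < |μ| / 6 := by
    refine (ContinuousAt.eventually_lt (by fun_prop) continuousAt_const (by simp)).and
      (ContinuousAt.eventually_lt (by fun_prop) continuousAt_const (by simpa))
  obtain ⟨ρ, hρ, h0⟩ := ((h1.filter_mono nhdsWithin_le_nhds).and
    (self_mem_nhdsWithin (a := (0 : ℝ)) (s := Ioi 0))).exists
  exact ⟨ρ, h0, hρ.1.le, hρ.2.le⟩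

lemma abs_le_of_yDistSq (hρ : 0 < ρ) {q : Phase3} (h : yDistSq μ q < ρ ^ 2) :
    |q 0 - μ / 6 * q 2| ≤ ρ ∧ |curvature q| ≤ ρ ∧ |q 2| ≤ ρ := by
  unfold yDistSq at h
  refine ⟨?_, ?_, ?_⟩ <;> refine abs_le_of_sq_le_sq ?_ hρ.le <;>
    nlinarith [sq_nonneg (q 0 - μ / 6 * q 2), sq_nonneg (curvature q), sq_nonneg (q 2)]

lemma IsLyapunovRadius.bounds (hρ : IsLyapunovRadius μ ρ) {q : Phase3}
    (hw : |q 0 - μ / 6 * q 2| ≤ ρ) (hu : |curvature q| ≤ ρ) (hz : |q 2| ≤ ρ) :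
    |q 0| ≤ 1 / 8 ∧ |q 2| ≤ 1 / 8 ∧ |μ * q 2| ≤ 1 / 8 ∧ |curvature q| ≤ 1 / 8 ∧
      q 0 ^ 2 ≤ 1 / 64 ∧ |q 0 * q 2| ≤ 1 / 64 ∧ |q 1 ^ 2 - 1| ≤ 9 / 64 := by
  have h1 := hρ.mul_le
  have h0 := hρ.pos
  have hμ0 := mul_nonneg h0.le (abs_nonneg μ)
  have h2 : |μ * q 2| ≤ ρ * |μ| := by
    rw [abs_mul, mul_comm]
    gcongr
  have h3 : |q 0| ≤ |q 0 - μ / 6 * q 2| + |μ / 6 * q 2| := by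
    simpa using abs_add_le (q 0 - μ / 6 * q 2) (μ / 6 * q 2)
  have h4 : |μ / 6 * q 2| = |μ * q 2| / 6 := by
    rw [div_mul_eq_mul_div, abs_div]
    norm_num
  have h5 : |q 0| ≤ 1 / 8 := by linarith
  have h6 : |q 2| ≤ 1 / 8 := by linarith
  have h7 : q 0 ^ 2 ≤ 1 / 64 := by
    rw [← sq_abs]
    nlinarith [abs_nonneg (q 0)]
  refine ⟨h5, h6, by linarith, by linarith, h7, ?_, ?_⟩
  · rw [abs_mul]
    nlinarith [abs_nonneg (q 0), abs_nonneg (q 2)]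
  · have h8 : q 1 ^ 2 - 1 = -curvature q - q 0 ^ 2 := by
      unfold curvature
      ring
    rw [h8, abs_le]
    have := abs_le.1 hu
    constructor <;> linarith [sq_nonneg (q 0)]

/-- With w = x - μz/6 the leading part is -6w² - 4u² - (μ/3)z⁴. The cross terms are absorbed by part
of the quadratic decay at the cost of (|μ|/6)z⁴. For μ > 0 the coefficient of z⁴ remains negative;
for μ < 0 it is positive, and the estimate then serves on z = 0. -/
lemma IsLyapunovRadius.deriv_le (hρ : IsLyapunovRadius μ ρ) {q : Phase3}
    (hw : |q 0 - μ / 6 * q 2| ≤ ρ) (hu : |curvature q| ≤ ρ) (hz : |q 2| ≤ ρ) :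
    yDistSqDeriv μ q ≤ -((q 0 - μ / 6 * q 2) ^ 2 + curvature q ^ 2) +
      (|μ| - 2 * μ) / 6 * q 2 ^ 4 := by
  obtain ⟨h1, h2, h3, h4, h5, h6, h7⟩ := hρ.bounds hw hu hz
  have hsq := hρ.sq_le
  have hy : q 1 ^ 2 = 1 - curvature q - q 0 ^ 2 := by
    unfold curvature
    ring
  unfold yDistSqDeriv
  rw [hy]
  generalize curvature q = u at *
  obtain ⟨w, hwq⟩ : ∃ w, q 0 = w + μ / 6 * q 2 := ⟨q 0 - μ / 6 * q 2, by ring⟩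
  generalize q 0 = x at *
  generalize q 2 = z at *
  have hwx : x - μ / 6 * z = w := by rw [hwq]; ring
  rw [hwx] at hw ⊢
  have e1 : 2 * (w * (-2 * x + μ / 2 * (1 - u - x ^ 2) * z - x * (1 - u - x ^ 2) + 2 * x ^ 3 +
      μ / 6 * (x * z ^ 2)) + (4 * x ^ 2 - 2 * (1 - u - x ^ 2)) * u ^ 2 - x * z ^ 3) =
      -6 * (1 - x ^ 2) * w ^ 2 + 2 * (u * w * (x - μ * z / 2)) + (μ * z) / 3 * z * w ^ 2 +
      2 * (w * z ^ 3 * (μ ^ 2 / 36 - 1)) + 2 * (6 * x ^ 2 - 2 + 2 * u) * u ^ 2 - μ / 3 * z ^ 4 := by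
    rw [hwq]; ring
  rw [e1]
  have e2 : 2 * (u * w * (x - μ * z / 2)) ≤ u ^ 2 + w ^ 2 := by
    have a1 := abs_le.1 h1
    have a3 := abs_le.1 h3
    have a4 : (x - μ * z / 2) ^ 2 ≤ 1 := by
      rw [sq_le_one_iff_abs_le_one, abs_le]
      constructor <;> linarith
    nlinarith [sq_nonneg (u - w * (x - μ * z / 2)), mul_le_mul_of_nonneg_left a4 (sq_nonneg w)]
  have e3 : (μ * z) / 3 * z * w ^ 2 ≤ 1 * w ^ 2 := by
    refine mul_le_mul_of_nonneg_right ?_ (sq_nonneg w)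
    have : |μ * z * z| ≤ 1 / 8 * (1 / 8) := by
      rw [abs_mul]
      gcongr
    have := le_of_abs_le this
    linarith
  -- From 2ab ≤ a² + b²: the square of z³(μ²/36 - 1) is z⁴ times a factor that `sq_le` bounds by
  -- |μ|/6.
  have e4 : 2 * (w * z ^ 3 * (μ ^ 2 / 36 - 1)) ≤ w ^ 2 + |μ| / 6 * z ^ 4 := by
    have b1 : z ^ 2 ≤ ρ ^ 2 := sq_le_sq.2 (by rwa [abs_of_pos hρ.pos])
    have b2 : z ^ 2 * (μ ^ 2 / 36 - 1) ^ 2 ≤ |μ| / 6 :=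
      (mul_le_mul_of_nonneg_right b1 (sq_nonneg _)).trans hsq
    have b3 := mul_le_mul_of_nonneg_right b2 (show 0 ≤ z ^ 4 by positivity)
    nlinarith [sq_nonneg (w - z ^ 3 * (μ ^ 2 / 36 - 1))]
  have e5 : -6 * (1 - x ^ 2) * w ^ 2 ≤ -5 * w ^ 2 :=
    mul_le_mul_of_nonneg_right (by linarith) (sq_nonneg w)
  have e6 : 2 * (6 * x ^ 2 - 2 + 2 * u) * u ^ 2 ≤ -2 * u ^ 2 :=
    mul_le_mul_of_nonneg_right (by linarith [le_of_abs_le h4]) (sq_nonneg u)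
  nlinarith [sq_nonneg w, sq_nonneg u]

lemma hasDerivWithinAt_yDistSq {γ : ℝ → Phase3} {s : Set ℝ} {t χ : ℝ}
    (h : HasDerivWithinAt γ (χ • powerLawField μ (γ t)) s t) :
    HasDerivWithinAt (fun t => yDistSq μ (γ t)) (χ * yDistSqDeriv μ (γ t)) s t :=
  ((((((hasDerivWithinAt_x h).sub ((hasDerivWithinAt_z h).const_mul (μ / 6))).pow 2).add
    ((hasDerivWithinAt_curvature h).pow 2)).add ((hasDerivWithinAt_z h).pow 2))).congr_deriv (by
      simp only [yDistSqDeriv, Pi.sub_apply]; push_cast; ring)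

/-- The sign of `y` is invariant under all rescalings of the flow. -/
lemma pos_y_of_isIntegralCurve {χ : Phase3 → ℝ} {γ : ℝ → Phase3} (hχ : Continuous χ)
    (hγ : IsIntegralCurve γ (fun _ q => χ q • powerLawField μ q)) (h0 : 0 < ε * γ 0 1) (t : ℝ) :
    0 < ε * γ t 1 := by
  have hc : Continuous fun t => χ (γ t) *
      (1 - μ / 2 * γ t 0 * γ t 2 + 2 * γ t 0 ^ 2 - γ t 1 ^ 2) := by
    have := hγ.continuous
    fun_prop
  have := eq_mul_exp_of_linear (f := fun t => γ t 1) hc (fun t => by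
    have := hasDerivWithinAt_y (hγ t).hasDerivWithinAt (s := univ)
    rwa [hasDerivWithinAt_univ] at this) t
  simp only at this
  rw [this, ← mul_assoc]
  exact mul_pos h0 (Real.exp_pos _)

lemma eq_zero_z_of_isIntegralCurve {χ : Phase3 → ℝ} {γ : ℝ → Phase3} (hχ : Continuous χ)
    (hγ : IsIntegralCurve γ (fun _ q => χ q • powerLawField μ q)) (h0 : γ 0 2 = 0) (t : ℝ) :
    γ t 2 = 0 := by
  have hc : Continuous fun t => χ (γ t) * (-γ t 0 * γ t 2) := by
    have := hγ.continuous
    fun_prop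
  have := eq_mul_exp_of_linear (f := fun t => γ t 2) hc (fun t => by
    have := hasDerivWithinAt_z (hγ t).hasDerivWithinAt (s := univ)
    rwa [hasDerivWithinAt_univ] at this) t
  simp only at this
  rw [this, h0, zero_mul]

lemma eq_of_yDistSq_eq_zero (hε : ε ^ 2 = 1) {q : Phase3} (hq : 0 < ε * q 1)
    (h : yDistSq μ q = 0) : q = !₂[0, ε, 0] := by
  unfold yDistSq at h
  have hz : q 2 = 0 := by
    nlinarith [sq_nonneg (q 0 - μ / 6 * q 2), sq_nonneg (curvature q), sq_nonneg (q 2)]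
  have hu : curvature q = 0 := by
    nlinarith [sq_nonneg (q 0 - μ / 6 * q 2), sq_nonneg (curvature q), sq_nonneg (q 2)]
  have hx : q 0 = 0 := by
    rw [hz, hu] at h
    nlinarith
  unfold curvature at hu
  rw [hx] at hu
  have hy : (q 1 - ε) * (q 1 + ε) = 0 := by linear_combination -hu - hε
  refine phase3_ext (by simp [hx]) ?_ (by simp [hz])
  rcases mul_eq_zero.1 hy with h1 | h1
  · simpa using sub_eq_zero.1 h1
  · have : ε * q 1 = -1 := by linear_combination ε * h1 - hε
    linarith

/-- Existence of trajectories in the sublevel sets of `yDistSq`, relative to a flow-invariant set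
in which the Lyapunov derivative is negative. -/
lemma exists_isForwardSolution_yDistSq (hε : ε ^ 2 = 1) (hρ : IsLyapunovRadius μ ρ)
    {q : Phase3} (hq : yDistSq μ q < ρ ^ 2) (hqy : 0 < ε * q 1) (hμq : 0 < μ ∨ q 2 = 0) :
    ∃ γ, IsForwardSolution (powerLawField μ) q γ ∧ ∀ t, 0 ≤ t → 0 < ε * γ t 1 ∧
      (0 < μ ∨ γ t 2 = 0) ∧ yDistSq μ (γ t) < ρ ^ 2 := by
  rcases eq_or_ne (yDistSq μ q) 0 with h0 | h0
  · refine ⟨fun _ => q, isForwardSolution_const ?_, fun _ _ => ⟨hqy, hμq, hq⟩⟩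
    rw [eq_of_yDistSq_eq_zero hε hqy h0]
    exact powerLawField_eq_zero_of_y hε
  suffices h : ∃ γ, IsForwardSolution (powerLawField μ) q γ ∧
      ∀ t, 0 ≤ t → γ t ∈ {q | 0 < ε * q 1 ∧ (0 < μ ∨ q 2 = 0)} ∧
        yDistSq μ (γ t) ≤ yDistSq μ q by
    obtain ⟨γ, hγ, hγC⟩ := h
    exact ⟨γ, hγ, fun t ht => ⟨(hγC t ht).1.1, (hγC t ht).1.2, (hγC t ht).2.trans_lt hq⟩⟩
  refine exists_isForwardSolution_of_barrier contDiff_powerLawField (V' := yDistSqDeriv μ)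
    ?_ ?_ ?_ ?_ ⟨hqy, hμq⟩ le_rfl
  · intro γ t χ h
    have := hasDerivWithinAt_yDistSq h.hasDerivWithinAt (s := univ)
    rwa [hasDerivWithinAt_univ] at this
  · refine isBounded_of_abs_apply_le (M := 2) fun q' hq' i => ?_
    obtain ⟨hw, hu, hz⟩ := abs_le_of_yDistSq hρ.pos (hq'.2.trans_lt hq)
    obtain ⟨h1, h2, h3, h4, h5, h6, h7⟩ := hρ.bounds hw hu hz
    have h8 : |q' 1| ≤ 2 := abs_le_of_sq_le_sq (by linarith [le_of_abs_le h7]) (by norm_num)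
    fin_cases i <;> simp only [Fin.zero_eta, Fin.mk_one, Fin.reduceFinMk] <;> linarith
  · intro χ γ hχ hγ h0 t ht
    exact ⟨pos_y_of_isIntegralCurve hχ hγ h0.1 t,
      h0.2.imp_right fun hz => eq_zero_z_of_isIntegralCurve hχ hγ hz t⟩
  · intro q' hq' hqe
    obtain ⟨hw, hu, hz⟩ := abs_le_of_yDistSq hρ.pos (hqe.trans_lt hq)
    refine lt_of_le_of_lt (hρ.deriv_le hw hu hz) ?_
    have hpos : 0 < yDistSq μ q' := by
      rw [hqe]
      refine lt_of_le_of_ne ?_ h0.symm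
      unfold yDistSq
      positivity
    unfold yDistSq at hpos
    -- Either μ > 0 makes the quartic term negative, or z = 0 removes it. This covers both the node
    -- and the stable plane of the saddle.
    rcases hq'.2 with hμ | hz0
    · rw [abs_of_pos hμ]
      by_contra! hcon
      have h4 : 0 ≤ μ / 6 * q' 2 ^ 4 := by positivity
      have h5 : μ / 6 * q' 2 ^ 4 = 0 := by
        nlinarith [sq_nonneg (q' 0 - μ / 6 * q' 2), sq_nonneg (curvature q')]
      have h6 : q' 2 = 0 := by
        simpa [hμ.ne'] using h5
      rw [h6] at hpos hcon
      nlinarith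
    · rw [hz0] at hpos ⊢
      nlinarith

/-- Trajectories in a neighbourhood of `(0, ε, 0)` in which `yDistSq` tends to zero. -/
lemma tendsto_of_yDistSq (hε : ε ^ 2 = 1) {γ : ℝ → Phase3} (hy : ∀ t, 0 ≤ t → 0 < ε * γ t 1)
    (h : Tendsto (fun t => yDistSq μ (γ t)) atTop (𝓝 0)) : Tendsto γ atTop (𝓝 !₂[0, ε, 0]) := by
  have hsq : ∀ f : ℝ → ℝ, (∀ t, f t ^ 2 ≤ yDistSq μ (γ t)) → Tendsto f atTop (𝓝 0) := by
    intro f hf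
    have h1 : Tendsto (fun t => f t ^ 2) atTop (𝓝 0) :=
      squeeze_zero (fun _ => sq_nonneg _) hf h
    have := (Real.continuous_sqrt.tendsto 0).comp h1
    rw [Real.sqrt_zero] at this
    simp only [Function.comp_def, Real.sqrt_sq_eq_abs] at this
    exact (tendsto_zero_iff_abs_tendsto_zero _).2 this
  have hw := hsq (fun t => γ t 0 - μ / 6 * γ t 2) fun t => by
    unfold yDistSq
    linarith [sq_nonneg (curvature (γ t)), sq_nonneg (γ t 2)]
  have hu := hsq (fun t => curvature (γ t)) fun t => by
    unfold yDistSq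
    linarith [sq_nonneg (γ t 0 - μ / 6 * γ t 2), sq_nonneg (γ t 2)]
  have hz := hsq (fun t => γ t 2) fun t => by
    unfold yDistSq
    linarith [sq_nonneg (γ t 0 - μ / 6 * γ t 2), sq_nonneg (curvature (γ t))]
  have hx : Tendsto (fun t => γ t 0) atTop (𝓝 0) := by
    simpa using hw.add (hz.const_mul (μ / 6))
  refine tendsto_euclidean fun i => ?_
  fin_cases i
  · exact hx
  · refine tendsto_of_tendsto_sq hε ?_ ?_
    · have := (tendsto_const_nhds (x := (1 : ℝ))).sub (hu.add (hx.pow 2))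
      simp only [add_zero, sub_zero, ne_eq, OfNat.ofNat_ne_zero, not_false_eq_true, zero_pow] at this
      refine this.congr fun t => ?_
      simp only [curvature, Fin.mk_one]
      ring
    · filter_upwards [eventually_ge_atTop 0] with t ht using hy t ht
  · exact hz

/-- The decay is only quartic in z. At a level c either z² ≥ c/2, with rate (|μ|/6)(c/2)², or the
quadratic part is at least c/2; these are the two entries of the minimum. When μ = 0 the hypothesis
leaves only z = 0. -/
lemma tendsto_yDistSq (hρ : IsLyapunovRadius μ ρ) {q : Phase3} {γ : ℝ → Phase3}
    (hγ : IsForwardSolution (powerLawField μ) q γ)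
    (hU : ∀ t, 0 ≤ t → (0 < μ ∨ γ t 2 = 0) ∧ yDistSq μ (γ t) < ρ ^ 2) :
    Tendsto (fun t => yDistSq μ (γ t)) atTop (𝓝 0) := by
  have hd := hγ.hasDerivWithinAt_smul
  have hle : ∀ t, 0 ≤ t → 1 * yDistSqDeriv μ (γ t) ≤
      -((γ t 0 - μ / 6 * γ t 2) ^ 2 + curvature (γ t) ^ 2 + |μ| / 6 * γ t 2 ^ 4) := by
    intro t ht
    obtain ⟨hw, hu, hz⟩ := abs_le_of_yDistSq hρ.pos (hU t ht).2
    rw [one_mul]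
    refine (hρ.deriv_le hw hu hz).trans ?_
    rcases (hU t ht).1 with hμ | h0
    · rw [abs_of_pos hμ]
      linarith
    · rw [h0]
      linarith
  refine tendsto_zero_of_strict_decay (a := 0) (fun t ht => hasDerivWithinAt_yDistSq (hd t ht))
    (fun t _ => ?_) (fun t ht => (hle t ht).trans ?_) (fun c hc => ?_)
  · unfold yDistSq
    positivity
  · rw [neg_nonpos]
    positivity
  · by_cases hμ : 0 < |μ|
    · refine ⟨min (c / 2) (|μ| / 6 * (c / 2) ^ 2), lt_min (by linarith) (by positivity),
        fun t ht hct => (hle t ht).trans (neg_le_neg ?_)⟩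
      unfold yDistSq at hct
      rcases le_total (c / 2) (γ t 2 ^ 2) with h1 | h1
      · have h2 : (c / 2) ^ 2 ≤ γ t 2 ^ 4 := by
          calc (c / 2) ^ 2 ≤ (γ t 2 ^ 2) ^ 2 := pow_le_pow_left₀ (by linarith) h1 2
            _ = γ t 2 ^ 4 := by ring
        have h3 := mul_le_mul_of_nonneg_left h2 (show 0 ≤ |μ| / 6 by positivity)
        refine (min_le_right _ _).trans ?_
        nlinarith [sq_nonneg (γ t 0 - μ / 6 * γ t 2), sq_nonneg (curvature (γ t))]
      · have h3 : 0 ≤ |μ| / 6 * γ t 2 ^ 4 := by positivity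
        refine (min_le_left _ _).trans ?_
        linarith
    · have hμ0 : μ = 0 := by simpa using hμ
      refine ⟨c, hc, fun t ht hct => (hle t ht).trans (neg_le_neg ?_)⟩
      unfold yDistSq at hct
      rcases (hU t ht).1 with h1 | h1
      · exact absurd h1 (by simp [hμ0])
      · rw [h1] at hct ⊢
        linarith

end NonhyperbolicNode

/-! ### Tangent directions and the stable node for μ > 0 -/

section NonhyperbolicNode

variable {μ ε ρ : ℝ}

lemma add_ne_zero_of_mul_pos (hε : ε ^ 2 = 1) {y : ℝ} (hy : 0 < ε * y) : y + ε ≠ 0 := by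
  intro h0
  have : ε * y = -1 := by linear_combination ε * h0 - hε
  linarith

lemma sub_eq_of_curvature (hε : ε ^ 2 = 1) {q : Phase3} (hy : 0 < ε * q 1) :
    q 1 - ε = -(curvature q + q 0 ^ 2) * (q 1 + ε)⁻¹ := by
  rw [← div_eq_mul_inv, eq_div_iff (add_ne_zero_of_mul_pos hε hy)]
  unfold curvature
  linear_combination -hε

/-- The trajectories of a stable node approach it at the rate of one of the scalar functions `z`,
`1 - x² - y²`, `x`. -/
lemma exists_direction_y_node (hε : ε ^ 2 = 1) (hρ : IsLyapunovRadius μ ρ)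
    {q : Phase3} {γ : ℝ → Phase3} (hγ : IsForwardSolution (powerLawField μ) q γ)
    (hU : ∀ t, 0 ≤ t → 0 < ε * γ t 1 ∧ yDistSq μ (γ t) < ρ ^ 2)
    (hlim : Tendsto γ atTop (𝓝 !₂[0, ε, 0])) (hq : q ≠ !₂[0, ε, 0]) :
    ∃ (m : ℝ → ℝ) (e : Phase3), ContinuousOn m (Ici 0) ∧ (∀ t ∈ Ici (0 : ℝ), m t ≠ 0) ∧
      (∀ t, 0 ≤ t → γ t = !₂[0, ε, 0] → m t = 0) ∧ e ≠ 0 ∧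
      Tendsto (fun t => (m t)⁻¹ • (γ t - !₂[0, ε, 0])) atTop (𝓝 e) := by
  have hε0 : ε ≠ 0 := by rintro rfl; norm_num at hε
  have hd := hγ.hasDerivWithinAt_smul
  have hb := fun t (ht : (0 : ℝ) ≤ t) =>
    let h := abs_le_of_yDistSq hρ.pos (hU t ht).2
    hρ.bounds h.1 h.2.1 h.2.2
  have hx : Tendsto (fun t => γ t 0) atTop (𝓝 0) := tendsto_euclidean_apply hlim 0
  have hz : Tendsto (fun t => γ t 2) atTop (𝓝 0) := tendsto_euclidean_apply hlim 2
  have hy : Tendsto (fun t => γ t 1) atTop (𝓝 ε) := tendsto_euclidean_apply hlim 1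
  have hyε : Tendsto (fun t => (γ t 1 + ε)⁻¹) atTop (𝓝 (ε + ε)⁻¹) :=
    (hy.add_const ε).inv₀ (by simpa using hε0)
  have hyu := fun t ht => sub_eq_of_curvature hε (hU t ht).1
  have hdu : ∀ t ∈ Ici (0 : ℝ), HasDerivWithinAt (fun t => curvature (γ t))
      ((4 * γ t 0 ^ 2 - 2 * γ t 1 ^ 2) * curvature (γ t)) (Ici 0) t := fun t ht =>
    (hasDerivWithinAt_curvature (hd t ht)).congr_deriv (by ring)
  have hdz : ∀ t ∈ Ici (0 : ℝ), HasDerivWithinAt (fun t => γ t 2)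
      ((-γ t 0 * γ t 2) * γ t 2) (Ici 0) t := fun t ht =>
    (hasDerivWithinAt_z (hd t ht)).congr_deriv (by ring)
  -- The scale m is the slowest quantity that does not vanish identically: z (eigenvalue 0), else
  -- the curvature (eigenvalue -2), else x (eigenvalue -3).
  by_cases hz0 : γ 0 2 = 0
  · have hz1 : ∀ t, 0 ≤ t → γ t 2 = 0 := fun t ht =>
      linear_eq_zero (c := 1) hdz (fun t ht => by
        obtain ⟨-, -, -, -, -, h6, -⟩ := hb t ht
        linarith [neg_le_of_abs_le h6]) hz0 t ht
    have hdx : ∀ t ∈ Ici (0 : ℝ), HasDerivWithinAt (fun t => γ t 0)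
        ((-2 - γ t 1 ^ 2 + 2 * γ t 0 ^ 2) * γ t 0) (Ici 0) t := fun t ht =>
      (hasDerivWithinAt_x (hd t ht)).congr_deriv (by rw [hz1 t ht]; ring)
    by_cases hu0 : curvature (γ 0) = 0
    · have hu1 : ∀ t, 0 ≤ t → curvature (γ t) = 0 := fun t ht =>
        linear_eq_zero (c := 0) hdu (fun t ht => by
          obtain ⟨-, -, -, -, h5, -, h7⟩ := hb t ht
          linarith [neg_le_of_abs_le h7]) hu0 t ht
      have hx1 : ∀ t ∈ Ici (0 : ℝ), γ t 0 ≠ 0 := by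
        refine linear_ne_zero (c := -4) hdx (fun t ht => ?_) (fun h => hq ?_)
        · obtain ⟨-, -, -, -, h5, -, h7⟩ := hb t ht
          linarith [le_of_abs_le h7, sq_nonneg (γ t 0)]
        · rw [hγ.1] at h hu0 hz0
          refine eq_of_yDistSq_eq_zero (μ := μ) hε (by simpa [hγ.1] using (hU 0 le_rfl).1) ?_
          simp [yDistSq, h, hu0, hz0]
      refine ⟨fun t => γ t 0, !₂[1, 0, 0], fun t ht => (hdx t ht).continuousWithinAt, hx1,
        fun t ht h => by simp [h], fun h => ?_, tendsto_euclidean fun i => ?_⟩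
      · simpa using congrArg (fun v : Phase3 => v 0) h
      · fin_cases i
        · refine tendsto_const_nhds.congr' ?_
          filter_upwards [eventually_ge_atTop 0] with t ht
          simp [hx1 t ht]
        · have h1 := hx.neg.mul hyε
          rw [neg_zero, zero_mul] at h1
          refine h1.congr' ?_
          filter_upwards [eventually_ge_atTop 0] with t ht
          have hne := hx1 t ht
          simp only [PiLp.smul_apply, PiLp.sub_apply, smul_eq_mul, Fin.mk_one, Matrix.cons_val_one,
            Matrix.cons_val_zero, hyu t ht, hu1 t ht]
          field_simp
          ring
        · refine tendsto_const_nhds.congr' ?_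
          filter_upwards [eventually_ge_atTop 0] with t ht
          simp [hz1 t ht]
    · have hu1 : ∀ t ∈ Ici (0 : ℝ), curvature (γ t) ≠ 0 := by
        refine linear_ne_zero (c := -4) hdu (fun t ht => ?_) hu0
        obtain ⟨-, -, -, -, h5, -, h7⟩ := hb t ht
        linarith [le_of_abs_le h7, sq_nonneg (γ t 0)]
      have hxu : Tendsto (fun t => γ t 0 / curvature (γ t)) atTop (𝓝 0) := by
        refine tendsto_zero_of_linear (c := -1 / 2) (by norm_num)
          (fun t ht => hasDerivWithinAt_div_of_linear
            (a := fun t => -2 - γ t 1 ^ 2 + 2 * γ t 0 ^ 2)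
            (b := fun t => 4 * γ t 0 ^ 2 - 2 * γ t 1 ^ 2) (hdx t ht) (hdu t ht) (hu1 t ht))
          (fun t ht => ?_)
        obtain ⟨-, -, -, -, h5, -, h7⟩ := hb t ht
        linarith [le_of_abs_le h7, sq_nonneg (γ t 0)]
      refine ⟨fun t => curvature (γ t), !₂[0, -(ε + ε)⁻¹, 0],
        fun t ht => (hdu t ht).continuousWithinAt, hu1, fun t ht h => by simp [h, curvature, hε],
        fun h => ?_, tendsto_euclidean fun i => ?_⟩
      · have := congrArg (fun v : Phase3 => v 1) h
        simp [hε0] at this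
      · fin_cases i
        · refine hxu.congr' ?_
          filter_upwards [eventually_ge_atTop 0] with t ht
          simp [div_eq_inv_mul]
        · have h1 := ((hx.mul hxu).const_add 1).neg.mul hyε
          rw [mul_zero, add_zero, neg_one_mul] at h1
          refine h1.congr' ?_
          filter_upwards [eventually_ge_atTop 0] with t ht
          have hne := hu1 t ht
          simp only [PiLp.smul_apply, PiLp.sub_apply, smul_eq_mul, Fin.mk_one, Matrix.cons_val_one,
            Matrix.cons_val_zero, hyu t ht]
          field_simp
        · refine tendsto_const_nhds.congr' ?_
          filter_upwards [eventually_ge_atTop 0] with t ht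
          simp [hz1 t ht]
  · have hz1 : ∀ t ∈ Ici (0 : ℝ), γ t 2 ≠ 0 := by
      refine linear_ne_zero (c := -1) hdz (fun t ht => ?_) hz0
      obtain ⟨-, -, -, -, -, h6, -⟩ := hb t ht
      linarith [le_of_abs_le h6]
    have huz : Tendsto (fun t => curvature (γ t) / γ t 2) atTop (𝓝 0) := by
      refine tendsto_zero_of_linear (c := -1) (by norm_num)
        (fun t ht => hasDerivWithinAt_div_of_linear
          (a := fun t => 4 * γ t 0 ^ 2 - 2 * γ t 1 ^ 2)
          (b := fun t => -γ t 0 * γ t 2) (hdu t ht) (hdz t ht) (hz1 t ht))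
        (fun t ht => ?_)
      obtain ⟨-, -, -, -, h5, h6, h7⟩ := hb t ht
      linarith [neg_le_of_abs_le h7, le_of_abs_le h6]
    -- The quotient x/z solves a linear equation with damping tending to 3 and forcing tending to
    -- μ/2; its limit μ/6 is the slope of the zero eigenvector.
    have hxz : Tendsto (fun t => γ t 0 / γ t 2) atTop (𝓝 (μ / 2 / 3)) := by
      refine tendsto_div_of_linear (a := 0)
        (b := fun t => 2 + γ t 1 ^ 2 - 2 * γ t 0 ^ 2 - γ t 0 * γ t 2)
        (d := fun t => μ / 2 * γ t 1 ^ 2) (by norm_num)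
        (fun t ht => ((hasDerivWithinAt_x (hd t ht)).div (hdz t ht) (hz1 t ht)).congr_deriv ?_) ?_ ?_
      · have := hz1 t ht
        field_simp
        ring
      · have := (((hy.pow 2).const_add 2).sub ((hx.pow 2).const_mul 2)).sub (hx.mul hz)
        rw [hε] at this
        convert this using 2
        norm_num
      · have := (hy.pow 2).const_mul (μ / 2)
        rwa [hε, mul_one] at this
    refine ⟨fun t => γ t 2, !₂[μ / 2 / 3, 0, 1], fun t ht => (hdz t ht).continuousWithinAt, hz1,
      fun t ht h => by simp [h], fun h => ?_, tendsto_euclidean fun i => ?_⟩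
    · simpa using congrArg (fun v : Phase3 => v 2) h
    · fin_cases i
      · refine hxz.congr' ?_
        filter_upwards [eventually_ge_atTop 0] with t ht
        simp [div_eq_inv_mul]
      · have h1 := (huz.add (hx.mul hxz)).neg.mul hyε
        rw [zero_mul, add_zero, neg_zero, zero_mul] at h1
        refine h1.congr' ?_
        filter_upwards [eventually_ge_atTop 0] with t ht
        have hne := hz1 t ht
        simp only [PiLp.smul_apply, PiLp.sub_apply, smul_eq_mul, Fin.mk_one, Matrix.cons_val_one,
          Matrix.cons_val_zero, hyu t ht]
        field_simp
      · refine tendsto_const_nhds.congr' ?_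
        filter_upwards [eventually_ge_atTop 0] with t ht
        simp [hz1 t ht]

/-- The sublevel sets of `yDistSq` in the half space `ε y > 0` are neighbourhoods of
`(0, ε, 0)`. -/
lemma isOpen_yDistSq (r : ℝ) : IsOpen {q : Phase3 | 0 < ε * q 1 ∧ yDistSq μ q < r} :=
  IsOpen.inter (s := {q : Phase3 | 0 < ε * q 1}) (t := {q | yDistSq μ q < r})
    (isOpen_lt continuous_const (by fun_prop)) (isOpen_lt continuous_yDistSq continuous_const)

lemma yDistSq_self (hε : ε ^ 2 = 1) : yDistSq μ !₂[0, ε, 0] = 0 := by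
  simp [yDistSq, curvature, hε]

lemma abs_sub_le_of_curvature (hε : ε ^ 2 = 1) {q : Phase3} (hy : 0 < ε * q 1) :
    |q 1 - ε| ≤ |curvature q| + q 0 ^ 2 := by
  have hε1 : |ε| = 1 :=
    (pow_eq_one_iff_of_nonneg (abs_nonneg ε) two_ne_zero).1 (by rw [sq_abs, hε])
  have h1 : 1 ≤ |q 1 + ε| := by
    have h2 : |q 1 + ε| = |ε * q 1 + 1| := by
      have : ε * q 1 + 1 = ε * (q 1 + ε) := by linear_combination -hε
      rw [this, abs_mul, hε1, one_mul]
    rw [h2]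
    exact le_trans (by linarith) (le_abs_self _)
  have h3 : (q 1 - ε) * (q 1 + ε) = -(curvature q + q 0 ^ 2) := by
    unfold curvature
    linear_combination -hε
  calc |q 1 - ε| ≤ |q 1 - ε| * |q 1 + ε| := le_mul_of_one_le_right (abs_nonneg _) h1
    _ = |curvature q + q 0 ^ 2| := by rw [← abs_mul, h3, abs_neg]
    _ ≤ |curvature q| + q 0 ^ 2 := by
      refine (abs_add_le _ _).trans ?_
      rw [abs_of_nonneg (sq_nonneg (q 0))]

lemma exists_yDistSq_subset (hε : ε ^ 2 = 1) (hρ : IsLyapunovRadius μ ρ) {V : Set Phase3}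
    (hV : V ∈ 𝓝 !₂[0, ε, 0]) : ∃ r, 0 < r ∧ r ≤ ρ ∧ ∀ q : Phase3, 0 < ε * q 1 →
      |q 0 - μ / 6 * q 2| ≤ r → |curvature q| ≤ r → |q 2| ≤ r → q ∈ V := by
  obtain ⟨R, hR, hRV⟩ := exists_box_subset hV
  refine ⟨min ρ (R / (2 * (1 + |μ|))), lt_min hρ.pos (by positivity), min_le_left _ _,
    fun q hy hw hu hz => hRV q fun i => ?_⟩
  set r := min ρ (R / (2 * (1 + |μ|))) with hr
  have hr0 : 0 < r := lt_min hρ.pos (by positivity)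
  have hrR : r * (1 + |μ|) ≤ R / 2 := by
    have := min_le_right ρ (R / (2 * (1 + |μ|)))
    rw [← hr, le_div_iff₀ (by positivity)] at this
    linarith
  have hb := hρ.mono hr0 (min_le_left _ _)
  obtain ⟨h1, -, -, -, -, -, -⟩ := hb.bounds hw hu hz
  have h3 : |q 0| ≤ |q 0 - μ / 6 * q 2| + |μ / 6 * q 2| := by
    simpa using abs_add_le (q 0 - μ / 6 * q 2) (μ / 6 * q 2)
  have h4 : |μ / 6 * q 2| ≤ |μ| / 6 * r := by
    rw [abs_mul, abs_div, abs_of_pos (show (0 : ℝ) < 6 by norm_num)]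
    gcongr
  have hμ := mul_nonneg hr0.le (abs_nonneg μ)
  have h5 : |q 0| ≤ R / 2 := by linarith
  have h6 := abs_sub_le_of_curvature hε hy
  have h7 : q 0 ^ 2 ≤ |q 0| * (1 / 8) := by
    rw [← sq_abs, sq]
    gcongr
  fin_cases i <;> simp <;> linarith [abs_nonneg (q 0)]

theorem isStableNode_powerLawField (hμ : 0 < μ) (hε : ε ^ 2 = 1) :
    IsStableNode (powerLawField μ) !₂[0, ε, 0] := by
  obtain ⟨ρ, hρ⟩ := exists_isLyapunovRadius hμ.ne'
  have hmem : ∀ r > 0, ∃ δ > 0, Metric.ball !₂[0, ε, 0] δ ⊆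
      {q : Phase3 | 0 < ε * q 1 ∧ yDistSq μ q < r ^ 2} := fun r hr =>
    Metric.isOpen_iff.1 (isOpen_yDistSq _) _
      ⟨by simp [← sq, hε], by rw [yDistSq_self hε]; positivity⟩
  refine ⟨powerLawField_eq_zero_of_y hε, fun R hR => ?_, ?_⟩
  · obtain ⟨r, hr, hrρ, hrV⟩ := exists_yDistSq_subset hε hρ (Metric.ball_mem_nhds _ hR)
    obtain ⟨δ, hδ, hsub⟩ := hmem r hr
    refine ⟨δ, hδ, fun q hq => ?_⟩
    obtain ⟨γ, hγ, hγU⟩ := exists_isForwardSolution_yDistSq hε (hρ.mono hr hrρ) (hsub hq).2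
      (hsub hq).1 (Or.inl hμ)
    refine ⟨γ, hγ, fun t ht => ?_⟩
    obtain ⟨hw, hu, hz⟩ := abs_le_of_yDistSq hr (hγU t ht).2.2
    exact hrV _ (hγU t ht).1 hw hu hz
  · obtain ⟨δ, hδ, hsub⟩ := hmem ρ hρ.pos
    refine ⟨δ, hδ, fun q hq hne => ?_⟩
    obtain ⟨γ, hγ, hγU⟩ := exists_isForwardSolution_yDistSq hε hρ (hsub hq).2
      (hsub hq).1 (Or.inl hμ)
    have hlim := tendsto_of_yDistSq hε (fun t ht => (hγU t ht).1)
      (tendsto_yDistSq hρ hγ fun t ht => (hγU t ht).2)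
    obtain ⟨m, e, hmc, hm0, hmp, he, h⟩ := exists_direction_y_node hε hρ hγ
      (fun t ht => ⟨(hγU t ht).1, (hγU t ht).2.2⟩) hlim hne
    exact ⟨γ, hγ, hlim, fun t ht h => hm0 t ht (hmp t ht h), exists_tendsto_direction hmc hm0 he h⟩

end NonhyperbolicNode

/-! ### Consequences of staying near an equilibrium -/

section Staying

/-- Solutions of `f' = -b f + d` with `b ≥ 0` and `d` negative are eventually nonpositive. -/
lemma exists_forall_nonpos_of_linear {f b d : ℝ → ℝ} {m : ℝ} (hm : 0 < m)
    (h : ∀ t ∈ Ici (0 : ℝ), HasDerivWithinAt f (-b t * f t + d t) (Ici 0) t)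
    (hb : ∀ t ∈ Ici (0 : ℝ), 0 ≤ b t) (hd : ∀ t ∈ Ici (0 : ℝ), d t ≤ -m) :
    ∃ T, 0 ≤ T ∧ ∀ t, T ≤ t → f t ≤ 0 := by
  obtain ⟨T, hT, hfT⟩ : ∃ T, 0 ≤ T ∧ f T ≤ 0 := by
    by_contra! hcon
    have h1 := antitoneOn_Ici_of_hasDerivWithinAt (a := (0 : ℝ)) (f := fun t => f t + m * t)
      (fun t ht => (h t ht).add ((hasDerivWithinAt_id t _).const_mul m)) (fun t ht => by
        have := mul_nonneg (hb t ht) (hcon t ht).le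
        have := hd t ht
        linarith)
    have h0 := hcon 0 le_rfl
    have h2 : 0 ≤ f 0 / m := by positivity
    have h3 := h1 self_mem_Ici (mem_Ici.2 h2) h2
    simp only [mul_zero, add_zero, mul_div_cancel₀ _ hm.ne'] at h3
    linarith [hcon _ h2]
  refine ⟨T, hT, fun t ht => ?_⟩
  refine image_le_of_deriv_right_lt_deriv_boundary (a := T) (b := t) (f := f)
    (f' := fun t => -b t * f t + d t)
    (fun s hs => ((h s (mem_Ici.2 (hT.trans hs.1))).continuousWithinAt).mono
      fun r hr => mem_Ici.2 (hT.trans hr.1))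
    (fun s hs => (h s (mem_Ici.2 (hT.trans hs.1))).mono (Ici_subset_Ici.2 (hT.trans hs.1)))
    (B := fun _ => 0) (B' := fun _ => 0) hfT (fun s => hasDerivAt_const _ _)
    (fun s hs hs0 => ?_) ⟨ht, le_rfl⟩
  rw [hs0, mul_zero, zero_add]
  linarith [hd s (mem_Ici.2 (hT.trans hs.1))]

variable {E : Type*} [NormedAddCommGroup E]

section

variable {p : E} {ν : ℝ}

lemma tendsto_exp_mul_norm_sq_of_bounded (hν : 0 < ν) {γ : ℝ → E} {U : Set E}
    (hU : Bornology.IsBounded U) (hγ : ∀ t, 0 ≤ t → γ t ∈ U) :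
    Tendsto (fun t => Real.exp (-ν * t) * ‖γ t - p‖ ^ 2) atTop (𝓝 0) := by
  obtain ⟨R, hR⟩ := hU.subset_closedBall p
  have h1 := (tendsto_exp_mul_atTop_zero (neg_lt_zero.2 hν) 0 (R ^ 2))
  simp only [sub_zero] at h1
  refine squeeze_zero' (Eventually.of_forall fun t => by positivity) ?_ h1
  filter_upwards [eventually_ge_atTop 0] with t ht
  have h2 := hR (hγ t ht)
  rw [Metric.mem_closedBall, dist_eq_norm] at h2
  rw [mul_comm]
  gcongr

end

variable [NormedSpace ℝ E]

variable {G : E → E} {p : E} {A : E →L[ℝ] E} {ℓ₀ ℓ₁ ℓ₂ : E →L[ℝ] ℝ} {e : E}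
  {l₀ l₁ l₂ ν C : ℝ}

/-- If the separating exponent `ν` is positive, all bounded trajectories lie in the cone. -/
lemma IsConeSplitting.exists_nhds_coneForm_nonpos
    (h : IsConeSplitting G p A ℓ₀ ℓ₁ ℓ₂ e l₀ l₁ l₂ ν C) (hν : 0 < ν) {κ : ℝ} (hκ : 0 < κ) :
    ∃ O ∈ 𝓝 p, ∀ U ⊆ O, Bornology.IsBounded U → ∀ q γ, IsForwardSolution G q γ →
      (∀ t, 0 ≤ t → γ t ∈ U) → coneForm ℓ₀ ℓ₁ ℓ₂ κ (q - p) ≤ 0 := by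
  obtain ⟨O, hO, hcone⟩ := h.exists_nhds_coneFormDeriv hκ
  refine ⟨O, hO, fun U hUO hU q γ hγ hγU => ?_⟩
  have := coneForm_nonpos_of_tendsto (ℓ₀ := ℓ₀) (ℓ₁ := ℓ₁) (ℓ₂ := ℓ₂) (p := p) (ν := ν) (κ := κ)
    (a := γ) (b := fun _ => p) (va := fun t => G (γ t)) (vb := fun _ => G p) (fun t ht => hγ.2 t ht)
    (fun t _ => (hasDerivWithinAt_const t _ p).congr_deriv h.zero.symm)
    (fun t ht => hcone _ (hUO (hγU t ht)) _ (mem_of_mem_nhds hO))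
    (tendsto_exp_mul_norm_sq_of_bounded hν hU hγU) (by simp)
  rwa [hγ.1] at this

end Staying

/-! ### Saddles at (0, ±1, 0) for μ < 0 -/

section Saddle

variable {μ ε ρ : ℝ}

/-- The coordinate functionals of the phase space. -/
noncomputable def coordL (i : Fin 3) : Phase3 →L[ℝ] ℝ := EuclideanSpace.proj i

@[simp] lemma coordL_apply (i : Fin 3) (v : Phase3) : coordL i v = v i := rfl

lemma norm_le_sum_abs (v : Phase3) : ‖v‖ ≤ |v 0| + |v 1| + |v 2| := by
  rw [EuclideanSpace.norm_eq]
  refine Real.sqrt_le_iff.2 ⟨by positivity, ?_⟩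
  simp only [Fin.sum_univ_three, Real.norm_eq_abs]
  nlinarith [abs_nonneg (v 0), abs_nonneg (v 1), abs_nonneg (v 2),
    mul_nonneg (abs_nonneg (v 0)) (abs_nonneg (v 1)),
    mul_nonneg (abs_nonneg (v 0)) (abs_nonneg (v 2)),
    mul_nonneg (abs_nonneg (v 1)) (abs_nonneg (v 2))]

/-- In reversed time the eigenvalues are 0, 3, 2, and the null direction is the dominated one. Here
ν = 1 is positive, so every bounded orbit near the point converges fast enough for the cone
argument, slow as its actual approach is. -/
lemma isConeSplitting_y (hε : ε ^ 2 = 1) : IsConeSplitting (-powerLawField μ) !₂[0, ε, 0]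
    (-fderiv ℝ (powerLawField μ) !₂[0, ε, 0]) (coordL 2) (coordL 0 - (μ / 6) • coordL 2) (coordL 1)
    !₂[μ / 6, 0, 1] 0 3 2 1 (1 + |μ|) where
  strict := (hasStrictFDerivAt_powerLawField _).neg
  zero := by rw [Pi.neg_apply, powerLawField_eq_zero_of_y hε, neg_zero]
  eig₀ v := by simp [fderiv_powerLawField]
  eig₁ v := by
    simp [fderiv_powerLawField, hε]
    ring
  eig₂ v := by
    simp [fderiv_powerLawField, hε]
    ring
  lt₀ := by norm_num
  lt₁ := by norm_num
  lt₂ := by norm_num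
  apply₀ := by simp
  apply₁ := by simp
  apply₂ := by simp
  pos := by positivity
  norm_le v := by
    refine (norm_le_sum_abs v).trans ?_
    simp only [coordL_apply, sub_apply, smul_apply,
      smul_eq_mul]
    have h1 : |v 0| ≤ |v 0 - μ / 6 * v 2| + |μ / 6 * v 2| := by
      simpa using abs_add_le (v 0 - μ / 6 * v 2) (μ / 6 * v 2)
    rw [abs_mul, abs_div, abs_of_pos (show (0 : ℝ) < 6 by norm_num)] at h1
    nlinarith [abs_nonneg μ, mul_nonneg (abs_nonneg μ) (abs_nonneg (v 2)),
      mul_nonneg (abs_nonneg μ) (abs_nonneg (v 1)),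
      mul_nonneg (abs_nonneg μ) (abs_nonneg (v 0 - μ / 6 * v 2))]

/-- For `μ < 0` the trajectories which stay near `(0, ±1, 0)` in forward time lie in the plane
`z = 0`. -/
lemma forward_staying_y_saddle (hμ : μ < 0) (hρ : IsLyapunovRadius μ ρ) {q : Phase3}
    {γ : ℝ → Phase3} (hγ : IsForwardSolution (powerLawField μ) q γ)
    (hU : ∀ t, 0 ≤ t → |γ t 0 - μ / 6 * γ t 2| ≤ ρ ∧ |curvature (γ t)| ≤ ρ ∧ |γ t 2| ≤ ρ) :
    q 2 = 0 := by
  by_contra hne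
  have hd := hγ.hasDerivWithinAt_smul
  have hb := fun t (ht : (0 : ℝ) ≤ t) => hρ.bounds (hU t ht).1 (hU t ht).2.1 (hU t ht).2.2
  have hdz : ∀ t ∈ Ici (0 : ℝ), HasDerivWithinAt (fun t => γ t 2)
      ((-γ t 0 * γ t 2) * γ t 2) (Ici 0) t := fun t ht =>
    (hasDerivWithinAt_z (hd t ht)).congr_deriv (by ring)
  have hz1 : ∀ t ∈ Ici (0 : ℝ), γ t 2 ≠ 0 := by
    refine linear_ne_zero (c := -1) hdz (fun t ht => ?_) (by rwa [hγ.1])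
    obtain ⟨-, -, -, -, -, h6, -⟩ := hb t ht
    linarith [le_of_abs_le h6]
  -- The quotient x/z is driven towards μ/6 and so eventually falls below half of it, μ/12 < 0. From
  -- then on (z²)' = -2(x/z)(z²)² ≥ (-μ/6)(z²)², which no bounded nonzero solution satisfies. The
  -- forcing of x/z - μ/12 is at most (μ/12)(3/2) = μ/8.
  obtain ⟨T, hT, hfT⟩ := exists_forall_nonpos_of_linear (m := -μ / 8) (by linarith)
    (f := fun t => γ t 0 / γ t 2 - μ / 12)
    (b := fun t => 2 + γ t 1 ^ 2 - 2 * γ t 0 ^ 2 - γ t 0 * γ t 2)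
    (d := fun t => μ / 2 * γ t 1 ^ 2 -
      (2 + γ t 1 ^ 2 - 2 * γ t 0 ^ 2 - γ t 0 * γ t 2) * (μ / 12))
    (fun t ht => (((hasDerivWithinAt_x (hd t ht)).div (hdz t ht) (hz1 t ht)).sub_const
      (μ / 12)).congr_deriv (by
        have := hz1 t ht
        field_simp
        ring))
    (fun t ht => by
      obtain ⟨-, -, -, -, h5, h6, h7⟩ := hb t ht
      linarith [neg_le_of_abs_le h7, le_of_abs_le h6])
    (fun t ht => by
      obtain ⟨-, -, -, -, h5, h6, h7⟩ := hb t ht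
      have e1 : 3 / 2 ≤ 6 * γ t 1 ^ 2 - (2 + γ t 1 ^ 2 - 2 * γ t 0 ^ 2 - γ t 0 * γ t 2) := by
        linarith [neg_le_of_abs_le h7, neg_le_of_abs_le h6, sq_nonneg (γ t 0)]
      nlinarith)
  have hsh := hγ.shift hT
  have key := nonpos_of_quadratic_growth (s := fun t => γ (t + T) 2 ^ 2)
    (b := fun t => -2 * (γ (t + T) 0 / γ (t + T) 2)) (c := -μ / 6) (M := 1) (by linarith)
    (fun t ht => ((hasDerivWithinAt_z (hsh.hasDerivWithinAt_smul t ht)).pow 2).congr_deriv (by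
      have := hz1 (t + T) (mem_Ici.2 (add_nonneg ht hT))
      push_cast
      field_simp))
    (fun t ht => by
      have := hfT (t + T) (by linarith [mem_Ici.1 ht])
      linarith)
    (fun t ht => by
      obtain ⟨-, h2, -⟩ := hb (t + T) (add_nonneg ht hT)
      rw [abs_of_nonneg (sq_nonneg _), sq_le_one_iff_abs_le_one]
      linarith)
  simp only [zero_add] at key
  exact hz1 T (mem_Ici.2 hT) (pow_eq_zero_iff two_ne_zero |>.1 (key.antisymm (sq_nonneg _)))

/-- The opening -μ/12 is half the slope of the axis, so xz ≤ (μ/12)z² in the cone and backward (z²)'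
≤ (μ/6)z⁴. The remaining coordinates are dominated by |z|. -/
lemma tendsto_backward_y_saddle (hμ : μ < 0) {q : Phase3} {γ : ℝ → Phase3}
    (hγ : IsForwardSolution (-powerLawField μ) q γ)
    (hcone : ∀ t, 0 ≤ t → coneForm (coordL 2) (coordL 0 - (μ / 6) • coordL 2) (coordL 1) (-μ / 12)
      (γ t - !₂[0, ε, 0]) ≤ 0) : Tendsto γ atTop (𝓝 !₂[0, ε, 0]) := by
  have hd := hγ.hasDerivWithinAt_neg_smul
  have habs := fun t ht => abs_le_of_coneForm_nonpos (show 0 ≤ -μ / 12 by linarith) (hcone t ht)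
  simp at habs
  have key : ∀ t, 0 ≤ t → 2 * (γ t 0 * γ t 2 ^ 3) ≤ -(-μ / 6 * (γ t 2 ^ 2) ^ 2) := by
    intro t ht
    have h1 := le_of_abs_le (show |(γ t 0 - μ / 6 * γ t 2) * γ t 2| ≤ -μ / 12 * γ t 2 ^ 2 by
      rw [abs_mul, ← sq_abs (γ t 2), sq, ← mul_assoc]
      exact mul_le_mul_of_nonneg_right (habs t ht).1 (abs_nonneg _))
    nlinarith [mul_le_mul_of_nonneg_right h1 (sq_nonneg (γ t 2))]
  have hz2 : Tendsto (fun t => γ t 2 ^ 2) atTop (𝓝 0) := by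
    refine tendsto_zero_of_strict_decay (a := 0) (f' := fun t => 2 * (γ t 0 * γ t 2 ^ 3))
      (fun t ht => ((hasDerivWithinAt_z (hd t ht)).pow 2).congr_deriv (by push_cast; ring))
      (fun t _ => sq_nonneg _) (fun t ht => (key t ht).trans ?_)
      (fun c hc => ⟨-μ / 6 * c ^ 2, ?_, fun t ht hct => (key t ht).trans (neg_le_neg ?_)⟩)
    · nlinarith [sq_nonneg (γ t 2 ^ 2)]
    · have : 0 < -μ / 6 := by linarith
      positivity
    · refine mul_le_mul_of_nonneg_left (pow_le_pow_left₀ hc.le hct 2) (by linarith)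
  have hz' : Tendsto (fun t => |γ t 2|) atTop (𝓝 0) := by
    have := (Real.continuous_sqrt.tendsto 0).comp hz2
    rw [Real.sqrt_zero] at this
    simpa only [Function.comp_def, Real.sqrt_sq_eq_abs] using this
  have hz := (tendsto_zero_iff_abs_tendsto_zero _).2 hz'
  have hκ : Tendsto (fun t => -μ / 12 * |γ t 2|) atTop (𝓝 0) := by
    simpa using hz'.const_mul (-μ / 12)
  have hw : Tendsto (fun t => γ t 0 - μ / 6 * γ t 2) atTop (𝓝 0) := by
    refine squeeze_zero_norm' ?_ hκ
    filter_upwards [eventually_ge_atTop 0] with t ht using (habs t ht).1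
  have hy : Tendsto (fun t => γ t 1 - ε) atTop (𝓝 0) := by
    refine squeeze_zero_norm' ?_ hκ
    filter_upwards [eventually_ge_atTop 0] with t ht using (habs t ht).2
  refine tendsto_euclidean fun i => ?_
  fin_cases i
  · simpa using hw.add (hz.const_mul (μ / 6))
  · simpa using hy.add_const ε
  · exact hz

/-- The stable manifold is a piece of the plane z = 0, the graph of 0. The unstable one is a centre
curve, obtained from the cone theorem for the reversed field. -/
theorem isSaddle_powerLawField (hμ : μ < 0) (hε : ε ^ 2 = 1) :
    IsSaddle (powerLawField μ) !₂[0, ε, 0]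
      (Submodule.span ℝ {!₂[1, 0, 0], !₂[0, 1, 0]}) (Submodule.span ℝ {!₂[μ / 6, 0, 1]}) := by
  have hε1 : |ε| = 1 :=
    (pow_eq_one_iff_of_nonneg (abs_nonneg ε) two_ne_zero).1 (by rw [sq_abs, hε])
  refine ⟨powerLawField_eq_zero_of_y hε, span_xy_ne_bot, ?_, isCompl_span_xy (by simp), ?_, ?_, ?_⟩
  · rw [Ne, Submodule.span_singleton_eq_bot]
    intro h
    simpa using congrArg (fun v : Phase3 => v 2) h
  · intro v hv
    rw [mem_span_xy, fderiv_powerLawField]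
    simp
  · intro v hv
    obtain ⟨a, rfl⟩ := Submodule.mem_span_singleton.1 hv
    have : fderiv ℝ (powerLawField μ) !₂[0, ε, 0] (a • !₂[μ / 6, 0, 1]) = 0 := by
      rw [fderiv_powerLawField]
      refine phase3_ext ?_ ?_ ?_ <;> simp [hε]
      ring
    rw [this]
    exact Submodule.zero_mem _
  intro V hV
  have hsplit := isConeSplitting_y (μ := μ) hε
  set κ := -μ / 12 with hκdef
  have hκ : 0 < κ := by rw [hκdef]; linarith
  obtain ⟨O, hO, hgraph⟩ := hsplit.exists_nhds_isC1GraphAt hκ (Eventually.of_forall fun q hq h0 => by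
    have habs := (abs_le_of_coneForm_nonpos hκ.le hq).1
    simp at habs h0 ⊢
    have h1 := le_of_abs_le (show |(q 0 - μ / 6 * q 2) * q 2| ≤ κ * q 2 ^ 2 by
      rw [abs_mul, ← sq_abs (q 2), sq, ← mul_assoc]
      exact mul_le_mul_of_nonneg_right habs (abs_nonneg _))
    have h2 : 0 < q 2 ^ 2 := by positivity
    have h3 : q 0 * q 2 ≤ μ / 12 * q 2 ^ 2 := by
      rw [hκdef] at h1
      linarith
    have h4 : μ / 12 * q 2 ^ 2 * q 2 ^ 2 < 0 := by
      have : 0 < -μ / 12 * q 2 ^ 2 * q 2 ^ 2 := by positivity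
      linarith
    show 0 < q 2 * powerLawField μ q 2
    have h5 : powerLawField μ q 2 = -q 0 * q 2 ^ 2 := rfl
    have h6 := mul_le_mul_of_nonneg_right h3 h2.le
    rw [h5]
    nlinarith)
  obtain ⟨O', hO', hcone⟩ := hsplit.exists_nhds_coneForm_nonpos one_pos hκ
  obtain ⟨ρ, hρ⟩ := exists_isLyapunovRadius hμ.ne
  obtain ⟨r, hr, hrρ, hrV⟩ := exists_yDistSq_subset hε hρ (inter_mem hV (inter_mem hO hO'))
  have hρr := hρ.mono hr hrρ
  -- The slab is so thin that the cone over it stays in U: there |w| and |y - ε| are at most r/26,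
  -- hence |x| ≤ 3r/26 and |u| ≤ r/2.
  obtain ⟨b, hb, hbr, hbκ⟩ : ∃ b, 0 < b ∧ b ≤ r ∧ κ * b ≤ r / 26 := by
    refine ⟨min r (r / (26 * κ)), lt_min hr (by positivity), min_le_left _ _, ?_⟩
    have h1 := min_le_right r (r / (26 * κ))
    rw [le_div_iff₀ (by positivity)] at h1
    linarith
  -- The shape serves two ends: on z = 0 it is a sublevel set of `yDistSq`, hence forward invariant,
  -- and the bound on z gives the slab of the cone theorem.
  set U : Set Phase3 := {q | 0 < ε * q 1 ∧
    (q 0 - μ / 6 * q 2) ^ 2 + curvature q ^ 2 < r ^ 2 ∧ |q 2| < b} with hU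
  have hUb : ∀ q ∈ U, |q 0 - μ / 6 * q 2| ≤ r ∧ |curvature q| ≤ r ∧ |q 2| ≤ r := by
    intro q hq
    refine ⟨abs_le_of_sq_le_sq ?_ hr.le, abs_le_of_sq_le_sq ?_ hr.le, hq.2.2.le.trans hbr⟩ <;>
      nlinarith [hq.2.1, sq_nonneg (q 0 - μ / 6 * q 2), sq_nonneg (curvature q)]
  have hUV : U ⊆ V ∩ (O ∩ O') := fun q hq =>
    hrV q hq.1 (hUb q hq).1 (hUb q hq).2.1 (hUb q hq).2.2
  have hUo : IsOpen U := by
    have hc := continuous_curvature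
    have h1 : IsOpen {q : Phase3 | 0 < ε * q 1} := isOpen_lt continuous_const (by fun_prop)
    have h2 : IsOpen {q : Phase3 | (q 0 - μ / 6 * q 2) ^ 2 + curvature q ^ 2 < r ^ 2} :=
      isOpen_lt (by fun_prop) continuous_const
    have h3 : IsOpen {q : Phase3 | |q 2| < b} := isOpen_lt (by fun_prop) continuous_const
    exact h1.inter (h2.inter h3)
  have hpU : !₂[0, ε, 0] ∈ U := by
    refine ⟨by simp [← sq, hε], ?_, by simpa⟩
    simp [curvature, hε]
    positivity
  have hUbdd : Bornology.IsBounded U := by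
    refine isBounded_of_abs_apply_le (M := 2) fun q' hq' i => ?_
    obtain ⟨hw, hu, hz⟩ := hUb q' hq'
    obtain ⟨h1, h2, h3, h4, h5, h6, h7⟩ := hρr.bounds hw hu hz
    have h8 : |q' 1| ≤ 2 := abs_le_of_sq_le_sq (by linarith [le_of_abs_le h7]) (by norm_num)
    fin_cases i <;> simp only [Fin.zero_eta, Fin.mk_one, Fin.reduceFinMk] <;> linarith
  have hfwd : stayingSet (powerLawField μ) U ⊆ {q | q ∈ U ∧ q 2 = 0} := by
    rintro q ⟨γ, hγ, hγU⟩
    refine ⟨by simpa [hγ.1] using hγU 0 le_rfl, forward_staying_y_saddle hμ hρr hγ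
      fun t ht => hUb _ (hγU t ht)⟩
  have hfwd' : {q | q ∈ U ∧ q 2 = 0} ⊆ localStableSet (powerLawField μ) U !₂[0, ε, 0] := by
    rintro q ⟨hq, hz⟩
    obtain ⟨γ, hγ, hγU⟩ := exists_isForwardSolution_yDistSq hε hρr
      (by simpa [yDistSq, hz] using hq.2.1) hq.1 (Or.inr hz)
    refine ⟨γ, hγ, fun t ht => ?_, tendsto_of_yDistSq hε (fun t ht => (hγU t ht).1)
      (tendsto_yDistSq hρr hγ fun t ht => (hγU t ht).2)⟩
    obtain ⟨h1, h2, h3⟩ := hγU t ht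
    have h4 := h2.resolve_left hμ.le.not_gt
    refine ⟨h1, ?_, by simpa [h4]⟩
    simpa [yDistSq, h4] using h3
  have hbwd : stayingSet (-powerLawField μ) U ⊆
      localStableSet (-powerLawField μ) U !₂[0, ε, 0] := by
    rintro q ⟨γ, hγ, hγU⟩
    refine ⟨γ, hγ, hγU, tendsto_backward_y_saddle hμ hγ fun t ht => ?_⟩
    exact hcone U (hUV.trans fun q hq => hq.2.2) hUbdd _ _ (hγ.shift ht)
      fun s hs => hγU _ (add_nonneg hs ht)
  refine ⟨U, hUV.trans inter_subset_left, hUo, hpU, ?_, ?_,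
    fun q hq => ⟨_, rfl, hfwd' (hfwd hq)⟩, fun q hq => ⟨_, rfl, hbwd hq⟩⟩
  · refine ⟨Submodule.span ℝ {!₂[μ / 6, 0, 1]}, {s | !₂[0, ε, 0] + (s : Phase3) ∈ U}, fun _ => 0,
      isCompl_span_xy (by simp), hUo.preimage (by fun_prop), by simpa using hpU, contDiffOn_const,
      rfl, by simp, ?_⟩
    rw [show localStableSet (powerLawField μ) U !₂[0, ε, 0] = {q | q ∈ U ∧ q 2 = 0} from
      (localStableSet_subset_stayingSet.trans hfwd).antisymm hfwd']
    ext q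
    constructor
    · rintro ⟨hq, hz⟩
      exact ⟨⟨q - !₂[0, ε, 0], mem_span_xy.2 (by simp [hz])⟩, by simpa using hq, by simp⟩
    · rintro ⟨⟨s, hs⟩, hsD, rfl⟩
      rw [mem_span_xy] at hs
      exact ⟨by simpa using hsD, by simp [hs]⟩
  · refine hgraph U (hUV.trans fun q hq => hq.2.1) hUo b hb (fun q hq => by simpa using hq.2.2)
      (fun q hq hc => ?_) fun q γ _ hγU _ => tendsto_exp_mul_norm_sq_of_bounded one_pos hUbdd hγU
    have habs := abs_le_of_coneForm_nonpos hκ.le hc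
    simp at habs hq
    have hz : κ * |q 2| ≤ r / 26 := (mul_le_mul_of_nonneg_left hq.le hκ.le).trans hbκ
    have hw := habs.1.trans hz
    have hy := habs.2.trans hz
    have hr8 : r ≤ 1 / 8 := by
      have := hρr.mul_le
      nlinarith [mul_nonneg hr.le (abs_nonneg μ)]
    have h3 : |q 0| ≤ |q 0 - μ / 6 * q 2| + |μ / 6 * q 2| := by
      simpa using abs_add_le (q 0 - μ / 6 * q 2) (μ / 6 * q 2)
    have h4 : |μ / 6 * q 2| = 2 * (κ * |q 2|) := by
      rw [abs_mul, abs_of_neg (by linarith), hκdef]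
      ring
    have hx : |q 0| ≤ 3 * (r / 26) := by linarith
    have hεy : |ε * (q 1 - ε)| ≤ r / 26 := by rw [abs_mul, hε1, one_mul]; exact hy
    have e1 : ε * q 1 = 1 + ε * (q 1 - ε) := by linear_combination hε
    have e2 := abs_le.1 hεy
    have hu : |curvature q| ≤ r / 2 := by
      have e3 : curvature q = -(2 + ε * (q 1 - ε)) * (ε * (q 1 - ε)) - q 0 ^ 2 := by
        unfold curvature
        linear_combination (q 1 ^ 2 - 2 * ε * q 1 + ε ^ 2 - 1) * hε
      have e4 : |-(2 + ε * (q 1 - ε)) * (ε * (q 1 - ε))| ≤ 3 * (r / 26) := by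
        rw [abs_mul]
        refine mul_le_mul ?_ hεy (abs_nonneg _) (by norm_num)
        rw [abs_neg, abs_le]
        constructor <;> linarith
      have e5 : q 0 ^ 2 ≤ r / 26 := by
        rw [← sq_abs]
        nlinarith [abs_nonneg (q 0)]
      rw [e3]
      have e6 := abs_le.1 e4
      rw [abs_le]
      constructor <;> linarith [sq_nonneg (q 0)]
    refine ⟨by linarith, ?_, hq⟩
    have e7 : (q 0 - μ / 6 * q 2) ^ 2 ≤ (r / 26) ^ 2 := by
      rw [← sq_abs]
      exact pow_le_pow_left₀ (abs_nonneg _) hw 2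
    have e8 : curvature q ^ 2 ≤ (r / 2) ^ 2 := by
      rw [← sq_abs]
      exact pow_le_pow_left₀ (abs_nonneg _) hu 2
    nlinarith

end Saddle

/-! ### The line of equilibria -/

section Line

variable {μ r a : ℝ}

lemma powerLawField_eq_zero_of_line : powerLawField μ !₂[0, 0, r] = 0 :=
  powerLawField_eq_zero_iff.2 (Or.inl (by simp))

lemma norm_le_line_splitting (v : Phase3) :
    ‖v‖ ≤ (1 + r ^ 2 / 2) * (|v 0| + |v 1| + |v 2 - r ^ 2 / 2 * v 0|) := by
  refine (norm_le_sum_abs v).trans ?_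
  have h1 : |v 2| ≤ |v 2 - r ^ 2 / 2 * v 0| + |r ^ 2 / 2 * v 0| := by
    linarith [abs_sub_abs_le_abs_sub (v 2) (r ^ 2 / 2 * v 0)]
  rw [abs_mul, abs_of_nonneg (show 0 ≤ r ^ 2 / 2 by positivity)] at h1
  nlinarith [mul_nonneg (sq_nonneg r) (abs_nonneg (v 1)),
    mul_nonneg (sq_nonneg r) (abs_nonneg (v 2 - r ^ 2 / 2 * v 0))]

/-- Doubled, the eigenvalue -2 lies below ν = -1 and the eigenvalues 0 and 1 above it. As ν is
negative, boundedness does not suffice: orbits must converge faster than exp(-t/2). The functional z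
- (r²/2)x annihilates the image of the linearization. -/
lemma isConeSplitting_line_forward : IsConeSplitting (powerLawField μ) !₂[0, 0, r]
    (fderiv ℝ (powerLawField μ) !₂[0, 0, r]) (coordL 0) (coordL 1)
    (coordL 2 - (r ^ 2 / 2) • coordL 0) !₂[1, 0, r ^ 2 / 2] (-2) 1 0 (-1) (1 + r ^ 2 / 2) where
  strict := hasStrictFDerivAt_powerLawField _
  zero := powerLawField_eq_zero_of_line
  eig₀ v := by simp [fderiv_powerLawField]
  eig₁ v := by simp [fderiv_powerLawField]
  eig₂ v := by
    simp [fderiv_powerLawField]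
    ring
  lt₀ := by norm_num
  lt₁ := by norm_num
  lt₂ := by norm_num
  apply₀ := by simp
  apply₁ := by simp
  apply₂ := by simp
  pos := by positivity
  norm_le v := by simpa using norm_le_line_splitting v

lemma isConeSplitting_line_backward : IsConeSplitting (-powerLawField μ) !₂[0, 0, r]
    (-fderiv ℝ (powerLawField μ) !₂[0, 0, r]) (coordL 1) (coordL 0)
    (coordL 2 - (r ^ 2 / 2) • coordL 0) !₂[0, 1, 0] (-1) 2 0 (-1) (1 + r ^ 2 / 2) where
  strict := (hasStrictFDerivAt_powerLawField _).neg
  zero := by rw [Pi.neg_apply, powerLawField_eq_zero_of_line, neg_zero]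
  eig₀ v := by simp [fderiv_powerLawField]
  eig₁ v := by simp [fderiv_powerLawField]
  eig₂ v := by
    simp [fderiv_powerLawField]
    ring
  lt₀ := by norm_num
  lt₁ := by norm_num
  lt₂ := by norm_num
  apply₀ := by simp
  apply₁ := by simp
  apply₂ := by simp
  pos := by positivity
  norm_le v := by
    have := norm_le_line_splitting (r := r) v
    rw [add_comm |v 0|] at this
    simpa using this

/-- Trajectories along which `x` and `y` decay exponentially converge to a point of the line of
equilibria. -/
lemma exists_tendsto_line {χ M : ℝ} (hχ : |χ| = 1) {γ : ℝ → Phase3}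
    (hd : ∀ t ∈ Ici (0 : ℝ), HasDerivWithinAt γ (χ • powerLawField μ (γ t)) (Ici 0) t)
    (hx : ∀ t, 0 ≤ t → |γ t 0| ≤ a * Real.exp (-(3 / 4) * t))
    (hy : ∀ t, 0 ≤ t → |γ t 1| ≤ a * Real.exp (-(3 / 4) * t))
    (hz : ∀ t, 0 ≤ t → |γ t 2| ≤ M) :
    ∃ l : ℝ, Tendsto γ atTop (𝓝 !₂[0, 0, l]) ∧
      Tendsto (fun t => Real.exp (-(-1) * t) * ‖γ t - !₂[0, 0, l]‖ ^ 2) atTop (𝓝 0) := by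
  obtain ⟨l, -, hl⟩ := exists_tendsto_of_deriv_le_exp (C := a * M ^ 2) (c := 3 / 4) (by norm_num)
    (fun t ht => hasDerivWithinAt_z (hd t ht)) (fun t ht => by
      have h1 : |χ * (-γ t 0 * γ t 2) * γ t 2| = |γ t 0| * |γ t 2| ^ 2 := by
        rw [abs_mul, abs_mul, abs_mul, abs_neg, hχ]
        ring
      have h2 : |γ t 2| ^ 2 ≤ M ^ 2 := pow_le_pow_left₀ (abs_nonneg _) (hz t ht) 2
      rw [h1]
      calc |γ t 0| * |γ t 2| ^ 2 ≤ a * Real.exp (-(3 / 4) * t) * M ^ 2 :=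
            mul_le_mul (hx t ht) h2 (sq_nonneg _) ((abs_nonneg _).trans (hx t ht))
        _ = _ := by ring)
  set B := a + a + a * M ^ 2 / (3 / 4) with hB
  have hnorm : ∀ t, 0 ≤ t → ‖γ t - !₂[0, 0, l]‖ ≤ B * Real.exp (-(3 / 4) * t) := by
    intro t ht
    have h1 := norm_le_sum_abs (γ t - !₂[0, 0, l])
    simp at h1
    have h2 := hl t ht
    have h3 := hx t ht
    have h4 := hy t ht
    rw [hB, add_mul, add_mul]
    linarith
  refine ⟨l, ?_, ?_⟩
  · rw [tendsto_iff_norm_sub_tendsto_zero]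
    refine squeeze_zero' (Eventually.of_forall fun _ => norm_nonneg _) ?_
      (by simpa only [sub_zero] using tendsto_exp_mul_atTop_zero (show -(3 / 4 : ℝ) < 0 by norm_num) 0 B)
    filter_upwards [eventually_ge_atTop 0] with t ht using hnorm t ht
  -- The rate 3/4 exceeds the threshold 1/2: exp(t) times the square of exp(-3t/4) is exp(-t/2).
  · refine squeeze_zero' (Eventually.of_forall fun _ => by positivity) ?_
      (by simpa only [sub_zero] using tendsto_exp_mul_atTop_zero (show -(1 / 2 : ℝ) < 0 by norm_num) 0 (B ^ 2))
    filter_upwards [eventually_ge_atTop 0] with t ht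
    have h1 := pow_le_pow_left₀ (norm_nonneg _) (hnorm t ht) 2
    calc Real.exp (-(-1) * t) * ‖γ t - !₂[0, 0, l]‖ ^ 2
        ≤ Real.exp (-(-1) * t) * (B * Real.exp (-(3 / 4) * t)) ^ 2 := by gcongr
      _ = B ^ 2 * (Real.exp (-(-1) * t) * (Real.exp (-(3 / 4) * t) * Real.exp (-(3 / 4) * t))) := by
          ring
      _ = B ^ 2 * Real.exp (-(1 / 2) * t) := by
          rw [← Real.exp_add, ← Real.exp_add]
          ring_nf

/-- Smallness conditions near a point of the line of equilibria. -/
structure IsNearLine (μ : ℝ) (q : Phase3) : Prop where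
  x_le : |q 0| ≤ 1 / 4
  y_le : |q 1| ≤ 1 / 4
  mul_le : |μ * q 0 * q 2| ≤ 1 / 4

lemma IsNearLine.sq_le {q : Phase3} (h : IsNearLine μ q) :
    q 0 ^ 2 ≤ 1 / 16 ∧ q 1 ^ 2 ≤ 1 / 16 := by
  have h1 := pow_le_pow_left₀ (abs_nonneg _) h.x_le 2
  have h2 := pow_le_pow_left₀ (abs_nonneg _) h.y_le 2
  rw [sq_abs] at h1 h2
  constructor <;> linarith

lemma eventually_isNearLine : ∀ᶠ q in 𝓝 (!₂[0, 0, r] : Phase3), IsNearLine μ q := by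
  have h1 : ∀ᶠ q in 𝓝 (!₂[0, 0, r] : Phase3), |q 0| < 1 / 4 :=
    ContinuousAt.eventually_lt (by fun_prop) continuousAt_const (by simp)
  have h2 : ∀ᶠ q in 𝓝 (!₂[0, 0, r] : Phase3), |q 1| < 1 / 4 :=
    ContinuousAt.eventually_lt (by fun_prop) continuousAt_const (by simp)
  have h3 : ∀ᶠ q in 𝓝 (!₂[0, 0, r] : Phase3), |μ * q 0 * q 2| < 1 / 4 :=
    ContinuousAt.eventually_lt (by fun_prop) continuousAt_const (by simp)
  filter_upwards [h1, h2, h3] with q h1 h2 h3 using ⟨h1.le, h2.le, h3.le⟩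

lemma forward_approach_line {q : Phase3} (h : IsNearLine μ q) (hy : |q 1| ≤ 1 / 2 * |q 0|)
    (hx : q 0 ≠ 0) : q 0 * powerLawField μ q 0 < 0 := by
  have h1 := h.sq_le.1
  have h2 : q 1 ^ 2 ≤ q 0 ^ 2 / 4 := by
    have := pow_le_pow_left₀ (abs_nonneg _) hy 2
    rw [mul_pow, sq_abs, sq_abs] at this
    linarith
  have h3 : μ * q 0 * q 2 * q 1 ^ 2 ≤ 1 / 4 * q 1 ^ 2 :=
    mul_le_mul_of_nonneg_right (le_of_abs_le h.mul_le) (sq_nonneg _)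
  have h4 : 0 < q 0 ^ 2 := by positivity
  rw [powerLawField_apply_zero]
  have h5 : q 0 ^ 2 * q 0 ^ 2 ≤ 1 / 16 * q 0 ^ 2 := mul_le_mul_of_nonneg_right h1 h4.le
  nlinarith [mul_nonneg (sq_nonneg (q 0)) (sq_nonneg (q 1))]

lemma backward_approach_line {q : Phase3} (h : IsNearLine μ q) (hy : q 1 ≠ 0) :
    q 1 * (-powerLawField μ) q 1 < 0 := by
  have h1 := h.sq_le
  have h2 := le_of_abs_le h.mul_le
  have h4 : 0 < q 1 ^ 2 := by positivity
  show q 1 * -powerLawField μ q 1 < 0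
  rw [powerLawField_apply_one]
  have h5 : 0 < 1 - μ / 2 * q 0 * q 2 + 2 * q 0 ^ 2 - q 1 ^ 2 := by
    linarith [sq_nonneg (q 0)]
  nlinarith [mul_pos h4 h5]

/-- Near the line y expands at rate at least 1/2, so it vanishes on a staying orbit. What remains is
x' = (-2 + 2x²)x, which contracts at a definite rate. -/
lemma forward_staying_line {M : ℝ} {q : Phase3} {γ : ℝ → Phase3}
    (hγ : IsForwardSolution (powerLawField μ) q γ) (hU : ∀ t, 0 ≤ t → IsNearLine μ (γ t))
    (hz : ∀ t, 0 ≤ t → |γ t 2| ≤ M) :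
    ∃ l : ℝ, Tendsto γ atTop (𝓝 !₂[0, 0, l]) ∧
      Tendsto (fun t => Real.exp (-(-1) * t) * ‖γ t - !₂[0, 0, l]‖ ^ 2) atTop (𝓝 0) := by
  have hd := hγ.hasDerivWithinAt_smul
  have hy : ∀ t, 0 ≤ t → γ t 1 = 0 := by
    intro T hT
    have hd' := (hγ.shift hT).hasDerivWithinAt_smul
    have := eq_zero_of_linear_of_bounded (a := 0) (f := fun t => γ (t + T) 1) (c := 1 / 2)
      (M := 1 / 4) (by norm_num) (fun t ht => hasDerivWithinAt_y (hd' t ht)) (fun t ht => ?_)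
      (fun t ht => (hU _ (add_nonneg ht hT)).y_le)
    · simpa using this
    · have h1 := (hU _ (add_nonneg ht hT)).sq_le
      have h2 := le_of_abs_le (hU _ (add_nonneg ht hT)).mul_le
      linarith [sq_nonneg (γ (t + T) 0)]
  refine exists_tendsto_line (a := 1 / 4) (χ := 1) (by simp) hd (fun t ht => ?_) (fun t ht => ?_) hz
  · have h1 := abs_le_mul_exp_of_linear (a := 0) (f := fun t => γ t 0) (c := -(3 / 4))
      (b := fun t => -2 + 2 * γ t 0 ^ 2)
      (fun t ht => (hasDerivWithinAt_x (hd t ht)).congr_deriv (by rw [hy t ht]; ring))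
      (fun t ht => by linarith [(hU t ht).sq_le.1]) (mem_Ici.2 ht)
    rw [sub_zero] at h1
    exact h1.trans (mul_le_mul_of_nonneg_right (hU 0 le_rfl).x_le (Real.exp_pos _).le)
  · rw [hy t ht, abs_zero]
    positivity

lemma backward_staying_line {M : ℝ} {q : Phase3} {γ : ℝ → Phase3}
    (hγ : IsForwardSolution (-powerLawField μ) q γ) (hU : ∀ t, 0 ≤ t → IsNearLine μ (γ t))
    (hz : ∀ t, 0 ≤ t → |γ t 2| ≤ M) :
    ∃ l : ℝ, Tendsto γ atTop (𝓝 !₂[0, 0, l]) ∧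
      Tendsto (fun t => Real.exp (-(-1) * t) * ‖γ t - !₂[0, 0, l]‖ ^ 2) atTop (𝓝 0) := by
  have hd := hγ.hasDerivWithinAt_neg_smul
  have hy : ∀ t, 0 ≤ t → |γ t 1| ≤ 1 / 4 * Real.exp (-(3 / 4) * t) := by
    intro t ht
    have h1 := abs_le_mul_exp_of_linear (a := 0) (f := fun t => γ t 1) (c := -(3 / 4))
      (fun t ht => hasDerivWithinAt_y (hd t ht)) (fun t ht => by
        have h1 := (hU _ ht).sq_le
        have h2 := le_of_abs_le (hU _ ht).mul_le
        linarith [sq_nonneg (γ t 0)]) (mem_Ici.2 ht)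
    rw [sub_zero] at h1
    exact h1.trans (mul_le_mul_of_nonneg_right (hU 0 le_rfl).y_le (Real.exp_pos _).le)
  -- The equation for x is forced by y²z and is not homogeneous. In reversed time x² - y² grows at
  -- least like exp(t) once positive, so boundedness gives |x| ≤ |y| and x inherits the decay of y.
  have hxy : ∀ t, 0 ≤ t → γ t 0 ^ 2 - γ t 1 ^ 2 ≤ 0 := by
    intro T hT
    have hd' := (hγ.shift hT).hasDerivWithinAt_neg_smul
    have key : ∀ t ∈ Ici (0 : ℝ), (γ T 0 ^ 2 - γ T 1 ^ 2) * Real.exp (1 * (t - 0)) ≤ 1 / 16 := by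
      intro t ht
      have := mul_exp_le_of_hasDerivWithinAt (a := 0) (c := 1)
        (f := fun t => γ (t + T) 0 ^ 2 - γ (t + T) 1 ^ 2)
        (fun t ht => (((hasDerivWithinAt_x (hd' t ht)).pow 2).sub
          ((hasDerivWithinAt_y (hd' t ht)).pow 2))) (fun t ht => ?_) ht
      · simp only [zero_add] at this
        have h1 := (hU _ (add_nonneg ht hT)).sq_le.1
        linarith [sq_nonneg (γ (t + T) 1)]
      · have h := hU _ (add_nonneg ht hT)
        obtain ⟨h1, h2⟩ := h.sq_le
        have h3 := abs_le.1 h.mul_le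
        generalize γ (t + T) 0 = x at *
        generalize γ (t + T) 1 = y at *
        generalize γ (t + T) 2 = z at *
        have e1 := mul_le_mul_of_nonneg_right h1 (sq_nonneg x)
        have e2 := mul_le_mul_of_nonneg_right h2 (sq_nonneg y)
        have e3 := mul_le_mul_of_nonneg_right h3.2 (sq_nonneg y)
        have e4 := mul_nonneg (sq_nonneg x) (sq_nonneg y)
        push_cast
        nlinarith [sq_nonneg x, sq_nonneg y]
    by_contra! hcon
    obtain ⟨t, ht, ht'⟩ := (((tendsto_mul_exp_atTop one_pos hcon 0).eventually_gt_atTop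
      (1 / 16)).and (eventually_ge_atTop 0)).exists
    linarith [key t ht']
  refine exists_tendsto_line (a := 1 / 4) (χ := -1) (by simp) hd (fun t ht => ?_) hy hz
  refine le_trans ?_ (hy t ht)
  exact sq_le_sq.1 (by linarith [hxy t ht])

theorem hasSaddlePortraitAt_line : HasSaddlePortraitAt (powerLawField μ)
    (range fun r : ℝ => (!₂[0, 0, r] : Phase3)) !₂[0, 0, r]
    (Submodule.span ℝ {!₂[1, 0, r ^ 2 / 2]}) (Submodule.span ℝ {!₂[0, 1, 0]}) := by
  intro V hV
  obtain ⟨O, hO, hgraph⟩ := (isConeSplitting_line_forward (μ := μ) (r := r)).exists_nhds_isC1GraphAt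
    (κ := 1 / 2) (by norm_num) (eventually_isNearLine.mono fun q hq hc h0 => by
      have habs := (abs_le_of_coneForm_nonpos (by norm_num) hc).1
      simp only [coordL_apply, PiLp.sub_apply, Matrix.cons_val, sub_zero] at habs h0 ⊢
      exact forward_approach_line hq habs h0)
  obtain ⟨O', hO', hgraph'⟩ :=
    (isConeSplitting_line_backward (μ := μ) (r := r)).exists_nhds_isC1GraphAt
      (κ := 1 / 2) (by norm_num) (eventually_isNearLine.mono fun q hq _ h0 => by
        simp only [coordL_apply, PiLp.sub_apply, Matrix.cons_val, sub_zero] at h0 ⊢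
        exact backward_approach_line hq h0)
  obtain ⟨R, hR, hRV⟩ := exists_box_subset (inter_mem hV (inter_mem
    (inter_mem hO hO') (eventually_isNearLine (μ := μ) (r := r))))
  -- Over |x| < a the stable cone reaches a height of at most (r²/2)a + a/2 above z = r, so a box of
  -- half-height Ka contains it.
  set K := r ^ 2 / 2 + 2 with hK
  have hK2 : 2 ≤ K := by
    rw [hK]
    linarith [sq_nonneg r]
  obtain ⟨a, ha, haR⟩ : ∃ a, 0 < a ∧ K * a ≤ R := ⟨R / K, by positivity, by
    rw [mul_div_cancel₀ _ (by positivity)]⟩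
  set U : Set Phase3 := {q | |q 0| < a ∧ |q 1| < a ∧ |q 2 - r| < K * a} with hU
  have hUV : U ⊆ V ∩ ((O ∩ O') ∩ {q | IsNearLine μ q}) := fun q hq => hRV q fun i => by
    have h1 : a ≤ K * a := by nlinarith
    obtain ⟨hx, hy, hz⟩ := hq
    fin_cases i <;> simp <;> linarith
  have hUo : IsOpen U := by
    have h1 : IsOpen {q : Phase3 | |q 0| < a} := isOpen_lt (by fun_prop) continuous_const
    have h2 : IsOpen {q : Phase3 | |q 1| < a} := isOpen_lt (by fun_prop) continuous_const
    have h3 : IsOpen {q : Phase3 | |q 2 - r| < K * a} := isOpen_lt (by fun_prop) continuous_const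
    exact h1.inter (h2.inter h3)
  have hpU : !₂[0, 0, r] ∈ U := by
    simp [hU, ha]
    positivity
  have hz : ∀ q ∈ U, |q 2| ≤ |r| + K * a := fun q hq => by
    have h1 : |q 2| ≤ |q 2 - r| + |r| := by simpa using abs_add_le (q 2 - r) r
    linarith [hq.2.2]
  have hcone : ∀ q : Phase3, |q 0| < a → |q 1| < a →
      |q 2 - r - r ^ 2 / 2 * q 0| ≤ 1 / 2 * a → q ∈ U := by
    intro q hx hy h
    refine ⟨hx, hy, ?_⟩
    have h1 : |q 2 - r| ≤ |q 2 - r - r ^ 2 / 2 * q 0| + |r ^ 2 / 2 * q 0| := by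
      linarith [abs_sub_abs_le_abs_sub (q 2 - r) (r ^ 2 / 2 * q 0)]
    rw [abs_mul, abs_of_nonneg (show 0 ≤ r ^ 2 / 2 by positivity)] at h1
    have h2 : r ^ 2 / 2 * |q 0| ≤ r ^ 2 / 2 * a := by gcongr
    rw [hK, add_mul]
    linarith
  have hfwd : ∀ q γ, IsForwardSolution (powerLawField μ) q γ → (∀ t, 0 ≤ t → γ t ∈ U) → _ :=
    fun q γ hγ hγU => forward_staying_line hγ (fun t ht => (hUV (hγU t ht)).2.2)
      fun t ht => hz _ (hγU t ht)
  have hbwd : ∀ q γ, IsForwardSolution (-powerLawField μ) q γ → (∀ t, 0 ≤ t → γ t ∈ U) → _ :=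
    fun q γ hγ hγU => backward_staying_line hγ (fun t ht => (hUV (hγU t ht)).2.2)
      fun t ht => hz _ (hγU t ht)
  refine ⟨U, hUV.trans inter_subset_left, hUo, hpU, ?_, ?_, ?_, ?_⟩
  · refine hgraph U (hUV.trans fun q hq => hq.2.1.1) hUo a ha (fun q hq => by simpa using hq.1)
      (fun q hq hc => ?_) fun q γ hγ hγU hlim => ?_
    · have habs := abs_le_of_coneForm_nonpos (by norm_num) hc
      simp at habs hq
      exact hcone q hq (by linarith) (by linarith)
    · obtain ⟨l, hl, hfast⟩ := hfwd q γ hγ hγU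
      -- Staying orbits converge fast to some point of the line; those converging to the given point
      -- have it as their limit, so the fast rate holds there.
      rwa [← tendsto_nhds_unique hlim hl] at hfast
  · refine hgraph' U (hUV.trans fun q hq => hq.2.1.2) hUo a ha (fun q hq => by simpa using hq.2.1)
      (fun q hq hc => ?_) fun q γ hγ hγU hlim => ?_
    · have habs := abs_le_of_coneForm_nonpos (by norm_num) hc
      simp at habs hq
      exact hcone q (by linarith) hq (by linarith)
    · obtain ⟨l, hl, hfast⟩ := hbwd q γ hγ hγU
      rwa [← tendsto_nhds_unique hlim hl] at hfast
  · rintro q ⟨γ, hγ, hγU⟩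
    obtain ⟨l, hl, -⟩ := hfwd q γ hγ hγU
    exact ⟨_, ⟨l, rfl⟩, γ, hγ, hγU, hl⟩
  · rintro q ⟨γ, hγ, hγU⟩
    obtain ⟨l, hl, -⟩ := hbwd q γ hγ hγU
    exact ⟨_, ⟨l, rfl⟩, γ, hγ, hγU, hl⟩

theorem isNormallyHyperbolicSaddleLine_powerLawField :
    IsNormallyHyperbolicSaddleLine (powerLawField μ) 0 !₂[0, 0, 1] := by
  have hline : (fun r : ℝ => (0 : Phase3) + r • !₂[0, 0, 1]) = fun r => !₂[0, 0, r] := by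
    funext r
    refine phase3_ext ?_ ?_ ?_ <;> simp
  refine ⟨fun h => by simpa using congrArg (fun v : Phase3 => v 2) h, ?_⟩
  rw [hline]
  rintro _ ⟨r, rfl⟩
  refine ⟨powerLawField_eq_zero_of_line, ?_, -2, 1, !₂[1, 0, r ^ 2 / 2], !₂[0, 1, 0], by norm_num,
    one_pos, fun h => by simpa using congrArg (fun v : Phase3 => v 0) h,
    fun h => by simpa using congrArg (fun v : Phase3 => v 1) h, ?_, ?_, ?_,
    hasSaddlePortraitAt_line⟩
  · rw [fderiv_powerLawField]
    refine phase3_ext ?_ ?_ ?_ <;> simp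
  · rw [fderiv_powerLawField]
    refine phase3_ext ?_ ?_ ?_ <;> simp
    ring
  · rw [fderiv_powerLawField]
    refine phase3_ext ?_ ?_ ?_ <;> simp
  · refine eq_top_iff.2 fun v _ => Submodule.mem_span_triple.2
      ⟨v 0, v 1, v 2 - v 0 * (r ^ 2 / 2), phase3_ext ?_ ?_ ?_⟩ <;> simp

end Line

/-! ### Assembly of the results -/

theorem mainTheorem1 (μ : ℝ) :
    -- critical points
    (μ ≠ 0 → {q : Phase3 | powerLawField μ q = 0} =
      {!₂[0, 1, 0], !₂[0, -1, 0], !₂[1, 0, 0], !₂[-1, 0, 0]} ∪ range (fun r : ℝ => !₂[0, 0, r])) ∧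
    -- `C₁` and `C₂`
    (∀ p : Phase3, p = !₂[0, 1, 0] ∨ p = !₂[0, -1, 0] →
      powerLawField μ p = 0 ∧
      (μ ≠ 0 → ∀ᶠ q in 𝓝[≠] p, powerLawField μ q ≠ 0) ∧
      jacobianCharpoly (powerLawField μ) p = (X + 3) * (X + 2) * X ∧
      (0 < μ → IsStableNode (powerLawField μ) p) ∧
      (μ < 0 → IsSaddle (powerLawField μ) p
        (Submodule.span ℝ {!₂[1, 0, 0], !₂[0, 1, 0]}) (Submodule.span ℝ {!₂[μ / 6, 0, 1]}))) ∧
    -- `C₃` (`ε = 1`) and `C₄` (`ε = -1`)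
    (∀ ε : ℝ, ε = 1 ∨ ε = -1 →
      powerLawField μ !₂[ε, 0, 0] = 0 ∧
      (∀ᶠ q in 𝓝[≠] (!₂[ε, 0, 0] : Phase3), powerLawField μ q ≠ 0) ∧
      jacobianCharpoly (powerLawField μ) !₂[ε, 0, 0] = (X - 4) * (X - 3) * X ∧
      IsRepellingSaddleNode (powerLawField μ) !₂[ε, 0, 0]
        (Submodule.span ℝ {!₂[1, 0, 0], !₂[0, 1, 0]}) !₂[0, 0, ε] ∧
      IsUnstableNode (xyPlaneField μ) !₂[ε, 0]) ∧
    -- the line `C₅`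
    (∀ r : ℝ, jacobianCharpoly (powerLawField μ) !₂[0, 0, r] = (X + 2) * (X - 1) * X) ∧
    IsNormallyHyperbolicSaddleLine (powerLawField μ) 0 !₂[0, 0, 1] := by
  refine ⟨powerLawField_zeros, fun p hp => ?_, fun ε h => ?_, jacobianCharpoly_of_line,
    isNormallyHyperbolicSaddleLine_powerLawField⟩
  · obtain ⟨ε, hε, rfl⟩ : ∃ ε : ℝ, ε ^ 2 = 1 ∧ p = !₂[0, ε, 0] := by
      rcases hp with rfl | rfl
      exacts [⟨1, by norm_num, rfl⟩, ⟨-1, by norm_num, rfl⟩]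
    exact ⟨powerLawField_eq_zero_of_y hε, fun hμ => eventually_ne_zero_of_y hμ hε,
      jacobianCharpoly_of_y hε, fun hμ => isStableNode_powerLawField hμ hε,
      fun hμ => isSaddle_powerLawField hμ hε⟩
  · have hε : ε ^ 2 = 1 := by rcases h with rfl | rfl <;> norm_num
    exact ⟨powerLawField_eq_zero_of_x hε, eventually_ne_zero_of_x hε, jacobianCharpoly_of_x hε,
      isRepellingSaddleNode_powerLawField hε, isUnstableNode_xyPlaneField hε⟩
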